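/- For integers $a,b$ let $B=\mathbb{Q}\langle i,j\rangle$ with $i^2=a$, $j^2=b$, $ij=-ji$, and assume that $B$ is ramified exactly at a prime $p$ and at $\infty$. Let $\mathcal{O}_1,\mathcal{O}_2$ be maximal orders in $B$, each specified by a $\mathbb{Z}$-basis written in the basis $1,i,j,ij$, and let $s$ be the total bit length of $a$, $b$ and the two bases. For a maximal order $\mathcal{O}$ with a given basis, a (nonzero, integral) left $\mathcal{O}$-ideal is input or output as a finite list of generators of the left ideal, in coordinates with respect to that basis. Two left ideals $I,J$ of $\mathcal{O}$ are equivalent if $J=I\beta$ for some $\beta\in B^\times$, and $\mathrm{Nrd}(I)=\sqrt{|\mathcal{O}/I|}$. An $\ell$-power algorithm for $\mathcal{O}$ is a probabilistic program (integer registers and stacks, integer arithmetic, branching, loops, fair coin tosses) which takes as input a left $\mathcal{O}$-ideal and, with probability one, halts and outputs an equivalent left $\mathcal{O}$-ideal whose reduced norm is a power of $\ell$. For such a program $A$ and $n\in\mathbb{N}$ let $S_A(n)$, $W_A(n)$, $T_A(n)$ be the suprema, over inputs of bit length at most $n$, of the expected number of instructions executed, the expected largest bit length of an integer computed or moved, and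 the expected number of bit operations (schoolbook multiplication and division); let $S_A^{\max}$, $W_A^{\max}$, $T_A^{\max}$ be the corresponding worst-case quantities over all inputs of bit length at most $n$ and all coin tosses. There is a polynomial $P$ with natural-number coefficients such that for all primes $p,\ell$ and all $B,\mathcal{O}_1,\mathcal{O}_2$ (with bases) as above, with $C=P(s)$, the following holds. Given an $\ell$-power algorithm $A$ for $\mathcal{O}_1$, there exists an $\ell$-power algorithm $A'$ for $\mathcal{O}_2$ with the same complexity up to a constant of size polynomial in $s$: for all $n$, $$S_{A'}(n)\le C\,\bigl(S_A(C(n+1))+n+1\bigr),\qquad W_{A'}(n)\le C\,\bigl(W_A(C(n+1))+n+1\bigr),$$ the same two bounds hold for $S^{\max}$ and $W^{\max}$, and the numbers of bit operations satisfy $$T_{A'}(n)\le C\,(W_A(C)+1)\,\bigl(T_A(C(n+1))+n+1\bigr),\qquad T^{\max}_{A'}(n)\le C\,(W_A(C)+1)\,\bigl(T^{\max}_A(C(n+1))+n+1\bigr).$$ Moreover $A'$ is deterministic if $A$ is, and the length of the program $A'$ (number of syntax nodes plus the bit lengths of its constants) is at most that of $A$ plus $C\,(W_A(C)+1)$. 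-/

import Mathlib

open scoped ENNReal

noncomputable section

namespace QuatPath

/-! ### Sizes -/

/-- Bit length of an integer, including a sign bit. -/
def intSize (z : ℤ) : ℕ := z.natAbs.size + 1

/-- Bit length of a rational number given as a reduced fraction. -/
def ratSize (q : ℚ) : ℕ := intSize q.num + q.den.size

/-- Bit length of a list of integers. -/
def listSize (x : List ℤ) : ℕ := (x.map intSize).sum

/-! ### Quaternion algebras, maximal orders, left ideals -/

/-- The quaternion algebra over `ℚ` with `i² = a`, `j² = b`, `k = ij = -ji`. -/
abbrev Quat (a b : ℤ) : Type := QuaternionAlgebra ℚ (a : ℚ) 0 (b : ℚ)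

/-- The base change to the field `K` of the algebra with `i² = a`, `j² = b` is a division algebra. -/
def RamifiedOver (K : Type) [Field K] (a b : ℤ) : Prop :=
  ∀ x : QuaternionAlgebra K (a : K) 0 (b : K), x ≠ 0 → IsUnit x

/-- The quaternion algebra with `i² = a`, `j² = b` is ramified exactly at `p` and `∞`. -/
def RamifiedExactlyAt (p : ℕ) (a b : ℤ) : Prop :=
  RamifiedOver ℝ a b ∧ ∀ (q : ℕ) [Fact q.Prime], RamifiedOver ℚ_[q] a b ↔ q = p

variable {a b : ℤ}

/-- An order: a subring which is a finitely generated `ℤ`-module spanning the algebra over `ℚ`. -/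
def IsOrder (O : Subring (Quat a b)) : Prop :=
  O.toAddSubgroup.FG ∧ Submodule.span ℚ (O : Set (Quat a b)) = ⊤

/-- A maximal order. -/
def IsMaximalOrder (O : Subring (Quat a b)) : Prop := Maximal IsOrder O

/-- The reduced norm of a left ideal, `√|O/I|`. -/
def idealNrd {O : Subring (Quat a b)} (I : Ideal O) : ℝ :=
  Real.sqrt ((Submodule.toAddSubgroup I).index : ℝ)

/-- The left ideals `I` and `J` are equivalent: `J = Iβ` for an invertible `β` of the algebra. -/
def Equivalent {O : Subring (Quat a b)} (I J : Ideal O) : Prop :=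
  ∃ β : (Quat a b)ˣ,
    (Subtype.val '' (J : Set O)) = (fun x : Quat a b => x * β) '' (Subtype.val '' (I : Set O))

/-- Bit length of a quaternion in the basis `1, i, j, k`. -/
def quatSize (x : Quat a b) : ℕ := ratSize x.re + ratSize x.imI + ratSize x.imJ + ratSize x.imK

/-- Bit length of a `ℤ`-basis of an order. -/
def orderSize {O : Subring (Quat a b)} (e : Module.Basis (Fin 4) ℤ O) : ℕ :=
  ∑ i, quatSize (e i : Quat a b)

/-- Bit length of the specification of two orders: the constants of the algebra and
a `ℤ`-basis of each order. -/
def specSize {O₁ O₂ : Subring (Quat a b)} (e₁ : Module.Basis (Fin 4) ℤ O₁)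
    (e₂ : Module.Basis (Fin 4) ℤ O₂) : ℕ :=
  intSize a + intSize b + orderSize e₁ + orderSize e₂

/-- The list of integers `x` represents the left ideal `I` of `O`: it is the concatenation of the
coordinate vectors, in the basis `e` of `O`, of a finite list of generators of the left ideal. -/
def Represents {O : Subring (Quat a b)} (e : Module.Basis (Fin 4) ℤ O) (x : List ℤ)
    (I : Ideal O) : Prop :=
  ∃ gs : List (Fin 4 → ℤ), x = gs.flatMap List.ofFn ∧
    I = Ideal.span {g : O | ∃ v ∈ gs, g = ∑ i, v i • e i}

/-! ### Probabilistic programs over the integers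

A machine has integer registers, stacks of integers, and a read-once tape of random bits. -/

/-- A state of the machine; `pos` is the number of random bits read so far. -/
structure State where
  reg : ℕ → ℤ
  stk : ℕ → List ℤ
  pos : ℕ

/-- Elementary instructions. -/
inductive Op where
  | const (r : ℕ) (c : ℤ)
  | add (r s t : ℕ)
  | sub (r s t : ℕ)
  | mul (r s t : ℕ)
  | div (r s t : ℕ)
  | flip (r : ℕ)
  | nonempty (r k : ℕ)
  | pop (r k : ℕ)
  | push (k r : ℕ)

/-- The integer computed or moved by an instruction. -/
def Op.val (ω : ℕ → Bool) (σ : State) : Op → ℤ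
  | .const _ c => c
  | .add _ s t => σ.reg s + σ.reg t
  | .sub _ s t => σ.reg s - σ.reg t
  | .mul _ s t => σ.reg s * σ.reg t
  | .div _ s t => σ.reg s / σ.reg t
  | .flip _ => if ω σ.pos then 1 else 0
  | .nonempty _ k => if (σ.stk k).isEmpty then 0 else 1
  | .pop _ k => (σ.stk k).headD 0
  | .push _ r => σ.reg r

/-- Store the integer `v` in register `r`. -/
def State.set (σ : State) (r : ℕ) (v : ℤ) : State := { σ with reg := Function.update σ.reg r v }

/-- The state after an instruction. -/
def Op.next (ω : ℕ → Bool) (σ : State) (o : Op) : State :=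
  match o with
  | .const r _ => σ.set r (o.val ω σ)
  | .add r _ _ => σ.set r (o.val ω σ)
  | .sub r _ _ => σ.set r (o.val ω σ)
  | .mul r _ _ => σ.set r (o.val ω σ)
  | .div r _ _ => σ.set r (o.val ω σ)
  | .flip r => { σ.set r (o.val ω σ) with pos := σ.pos + 1 }
  | .nonempty r _ => σ.set r (o.val ω σ)
  | .pop r k => { σ.set r (o.val ω σ) with stk := Function.update σ.stk k (σ.stk k).tail }
  | .push k _ => { σ with stk := Function.update σ.stk k (o.val ω σ :: σ.stk k) }

/-- The number of bit operations charged for an instruction; multiplication and division are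
charged as by the schoolbook methods. -/
def Op.bitOps (ω : ℕ → Bool) (σ : State) (o : Op) : ℕ :=
  match o with
  | .add _ s t => intSize (σ.reg s) + intSize (σ.reg t)
  | .sub _ s t => intSize (σ.reg s) + intSize (σ.reg t)
  | .mul _ s t => intSize (σ.reg s) * intSize (σ.reg t)
  | .div _ s t => intSize (σ.reg s) * intSize (σ.reg t)
  | _ => intSize (o.val ω σ)

/-- Programs. `ite r c d` runs `c` if register `r` is positive and `d` otherwise;
`loop r c` repeats `c` as long as register `r` is positive. -/
inductive Prog where
  | skip
  | op (o : Op)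
  | seq (c d : Prog)
  | ite (r : ℕ) (c d : Prog)
  | loop (r : ℕ) (c : Prog)

/-- The length of a program: its number of nodes plus the bit lengths of its constants. -/
def Prog.size : Prog → ℕ
  | .skip => 1
  | .op (.const _ c) => 1 + intSize c
  | .op _ => 1
  | .seq c d => 1 + c.size + d.size
  | .ite _ c d => 1 + c.size + d.size
  | .loop _ c => 1 + c.size

/-- The program has no coin-tossing instruction, i.e. it is deterministic. -/
def Prog.CoinFree : Prog → Prop
  | .skip => True
  | .op (.flip _) => False
  | .op _ => True
  | .seq c d => c.CoinFree ∧ d.CoinFree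
  | .ite _ c d => c.CoinFree ∧ d.CoinFree
  | .loop _ c => c.CoinFree

/-- What is measured along a run: the number of instructions executed, the largest bit length of
an integer computed or moved, and the number of bit operations. -/
structure Cost where
  steps : ℕ
  width : ℕ
  time : ℕ

/-- The cost of consecutive runs. -/
def Cost.comp (c d : Cost) : Cost := ⟨c.steps + d.steps, max c.width d.width, c.time + d.time⟩

/-- The cost of an elementary instruction. -/
def Op.cost (ω : ℕ → Bool) (σ : State) (o : Op) : Cost := ⟨1, intSize (o.val ω σ), o.bitOps ω σ⟩

/-- The cost of a test of the sign of a register, or of `skip`. -/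
def Cost.unit : Cost := ⟨1, 0, 1⟩

/-- `Exec ω c σ m τ`: with the random bits `ω`, the program `c` started in the state `σ` halts in
the state `τ`, at cost `m`. -/
inductive Exec (ω : ℕ → Bool) : Prog → State → Cost → State → Prop where
  | skip (σ : State) : Exec ω .skip σ .unit σ
  | op (o : Op) (σ : State) : Exec ω (.op o) σ (o.cost ω σ) (o.next ω σ)
  | seq {c d : Prog} {σ τ υ : State} {m n : Cost} :
      Exec ω c σ m τ → Exec ω d τ n υ → Exec ω (.seq c d) σ (m.comp n) υ
  | ite_pos {r : ℕ} {c d : Prog} {σ τ : State} {m : Cost} :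
      0 < σ.reg r → Exec ω c σ m τ → Exec ω (.ite r c d) σ (Cost.unit.comp m) τ
  | ite_neg {r : ℕ} {c d : Prog} {σ τ : State} {m : Cost} :
      ¬ 0 < σ.reg r → Exec ω d σ m τ → Exec ω (.ite r c d) σ (Cost.unit.comp m) τ
  | loop_done {r : ℕ} {c : Prog} {σ : State} :
      ¬ 0 < σ.reg r → Exec ω (.loop r c) σ .unit σ
  | loop_step {r : ℕ} {c : Prog} {σ τ υ : State} {m n : Cost} :
      0 < σ.reg r → Exec ω c σ m τ → Exec ω (.loop r c) τ n υ →
      Exec ω (.loop r c) σ (Cost.unit.comp (m.comp n)) υ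

/-- The initial state: the input is on stack `0`, everything else is empty. -/
def initState (x : List ℤ) : State := ⟨fun _ => 0, fun k => if k = 0 then x else [], 0⟩

/-- On input `x` and random bits `ω`, the program `A` halts at cost `m` with output `y`
(the content of stack `0`). -/
def Halts (A : Prog) (x : List ℤ) (ω : ℕ → Bool) (m : Cost) (y : List ℤ) : Prop :=
  ∃ τ : State, Exec ω A (initState x) m τ ∧ τ.stk 0 = y

/-- The law of a sequence of independent fair coin tosses. -/
def coin : MeasureTheory.Measure (ℕ → Bool) :=
  MeasureTheory.Measure.infinitePi fun _ => (PMF.uniformOfFintype Bool).toMeasure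

/-- The value of a cost function on the run of `A` on `x` and `ω`; it is `∞` if the run does
not halt. -/
def runCost (f : Cost → ℕ) (A : Prog) (x : List ℤ) (ω : ℕ → Bool) : ℝ≥0∞ :=
  ⨅ (m : Cost) (y : List ℤ) (_ : Halts A x ω m y), (f m : ℝ≥0∞)

/-- `A` takes as input a nonzero left `O`-ideal and, with probability one, halts and outputs an
equivalent left `O`-ideal whose reduced norm is a power of `ℓ`. -/
def SolvesPath {O : Subring (Quat a b)} (e : Module.Basis (Fin 4) ℤ O) (ℓ : ℕ) (A : Prog) : Prop :=
  ∀ (I : Ideal O) (x : List ℤ), I ≠ ⊥ → Represents e x I →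
    ∀ᵐ ω ∂coin, ∃ (m : Cost) (y : List ℤ) (J : Ideal O),
      Halts A x ω m y ∧ Represents e y J ∧ Equivalent I J ∧ ∃ k : ℕ, idealNrd J = (ℓ : ℝ) ^ k

/-- The inputs of bit length at most `n`: the lists that represent a nonzero left `O`-ideal. -/
def inputs {O : Subring (Quat a b)} (e : Module.Basis (Fin 4) ℤ O) (n : ℕ) : Set (List ℤ) :=
  {x | listSize x ≤ n ∧ ∃ I : Ideal O, I ≠ ⊥ ∧ Represents e x I}

/-- The largest expected cost of `A` on an input of bit length at most `n`. -/
def expCost (f : Cost → ℕ) {O : Subring (Quat a b)} (e : Module.Basis (Fin 4) ℤ O) (A : Prog)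
    (n : ℕ) : ℝ≥0∞ :=
  ⨆ x ∈ inputs e n, ∫⁻ ω, runCost f A x ω ∂coin

/-- The largest cost of `A` on an input of bit length at most `n`, over all random bits. -/
def maxCost (f : Cost → ℕ) {O : Subring (Quat a b)} (e : Module.Basis (Fin 4) ℤ O) (A : Prog)
    (n : ℕ) : ℝ≥0∞ :=
  ⨆ x ∈ inputs e n, ⨆ ω, runCost f A x ω

end QuatPath

end

open QuatPath

noncomputable section

namespace QuatPath

/-! ### Rings with a positive definite quaternion norm -/

/-! Choose an integer N ≠ 0 with N O₂ ⊆ O₁. A left O₂-ideal I is sent to the left O₁-ideal N O₁ I,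
and the algorithm A returns J = N O₁ I γ of ℓ-power norm, which has to be brought back to O₂. A
single run of A on N O₁O₂, the image of the unit ideal, provides the way back: it gives J₀ = N O₁O₂
β whose index m is a power of ℓ. Put δ = (m/N) β⁻¹ (`exists_multiplier`), and let r be a positive
integer with r O₂O₁O₂ = O₂ (`exists_scale`). Then I' = r O₂ J δ lies in O₂ and equals I · mγβ⁻¹. It
also contains a power of ℓ, because J contains a power of ℓ times J₀ (`transfer`). So the index of
I' is a power of ℓ. The exponent is even (`even_of_index_eq_pow`), so the reduced norm is a power of
ℓ and not of √ℓ.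

Both r and the evenness come from `mul_conj_eq`: a finitely generated lattice M with O M ⊆ M over a
maximal order O satisfies M · conj M = c O, with c a generator of the group spanned by its norms.
The proof is global. Lattice elements become off-diagonal matrices satisfying integral Clifford
relations; the ring they generate is finitely generated, so the ring of corner entries is caught by
maximality.

On generators both transfers are linear maps in coordinates, so A' is A between two linear programs
with hard-coded matrices (`sandwich`), run on the same coins, and costs are compared coin sequence
by coin sequence. The element β has no a priori bound, but δ does: x δ = m for some x in O₁ and the
norm form is positive definite (`quatSize_multiplier_le`), while m is controlled by the output of
the one run (`size_index_le`). That run can be chosen no wider than the average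
(`exists_runCost_le`), whence the quantity W_A(C) in the program length and in the bit operations.
-/

/-- A ring with involution over `ℚ` with a positive definite reduced norm, of dimension four. -/
class DefiniteQuaternion (B : Type*) [Ring B] [StarRing B] [Algebra ℚ B] where
  nrd : B → ℚ
  mul_star_self : ∀ x : B, x * star x = algebraMap ℚ B (nrd x)
  nrd_pos : ∀ x : B, x ≠ 0 → 0 < nrd x
  det_mulRight : ∀ x : B, LinearMap.det (LinearMap.mulRight ℚ x) = nrd x ^ 2
  finrank_eq : Module.finrank ℚ B = 4

/-! ### Finite generation from Clifford relations. -/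

section Clifford

variable {R : Type*} [Ring R]

/-- The lattice underlying a subring. -/
def lat (O : Subring R) : Submodule ℤ R := AddSubgroup.toIntSubmodule O.toAddSubgroup

@[simp] theorem mem_lat {O : Subring R} {x : R} : x ∈ lat O ↔ x ∈ O := Iff.rfl

theorem lat_fg_iff {O : Subring R} : (lat O).FG ↔ O.toAddSubgroup.FG :=
  Submodule.fg_iff_addSubgroup_fg _

theorem fg_of_le {M N : Submodule ℤ R} (h : M ≤ N) (hN : N.FG) : M.FG := by
  have := isNoetherian_of_fg_of_noetherian N hN
  exact (isNoetherian_submodule.mp this) M h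

/-- A ring generated by finitely many elements that satisfy Clifford relations over `ℤ` is
finitely generated as an additive group. -/
theorem fg_closure_of_clifford {s : Set R} (hs : s.Finite)
    (hsq : ∀ x ∈ s, ∃ k : ℤ, x * x = k) (hanti : ∀ x ∈ s, ∀ y ∈ s, ∃ k : ℤ, x * y + y * x = k) :
    (lat (Subring.closure s)).FG := by
  induction s, hs using Set.Finite.induction_on with
  | empty =>
    refine fg_of_le (N := Submodule.span ℤ {1}) ?_ (Submodule.fg_span_singleton 1)
    intro x hx
    rw [mem_lat, Subring.closure_empty] at hx
    obtain ⟨k, rfl⟩ := Subring.mem_bot.mp hx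
    exact Submodule.mem_span_singleton.mpr ⟨k, by simp⟩
  | @insert X s hX hs ih =>
    have ih := ih (fun x hx => hsq x (Set.mem_insert_of_mem _ hx))
      (fun x hx y hy => hanti x (Set.mem_insert_of_mem _ hx) y (Set.mem_insert_of_mem _ hy))
    set S := Subring.closure s with hS
    -- The Clifford relations move X to the right past any element of S. Hence S + S X is a ring,
    -- and finite generation passes from S to it.
    have key : ∀ c ∈ S, ∃ u ∈ S, ∃ v ∈ S, X * c = u + v * X := by
      intro c hc
      induction hc using Subring.closure_induction with
      | mem x hx =>
        obtain ⟨k, hk⟩ := hanti X (Set.mem_insert _ _) x (Set.mem_insert_of_mem _ hx)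
        exact ⟨k, intCast_mem S k, -x, neg_mem (Subring.subset_closure hx), by
          rw [← hk]; noncomm_ring⟩
      | zero => exact ⟨0, zero_mem _, 0, zero_mem _, by simp⟩
      | one => exact ⟨0, zero_mem _, 1, one_mem _, by simp⟩
      | add x y _ _ hx hy =>
        obtain ⟨u, hu, v, hv, h⟩ := hx
        obtain ⟨u', hu', v', hv', h'⟩ := hy
        exact ⟨u + u', add_mem hu hu', v + v', add_mem hv hv', by
          rw [mul_add, h, h', add_mul]; abel⟩
      | neg x _ hx =>
        obtain ⟨u, hu, v, hv, h⟩ := hx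
        exact ⟨-u, neg_mem hu, -v, neg_mem hv, by rw [mul_neg, h]; noncomm_ring⟩
      | mul x y hxS hyS hx hy =>
        obtain ⟨u, hu, v, hv, h⟩ := hx
        obtain ⟨u', hu', v', hv', h'⟩ := hy
        refine ⟨u * y + v * u', add_mem (mul_mem hu hyS) (mul_mem hv hu'), v * v',
          mul_mem hv hv', ?_⟩
        rw [← mul_assoc, h, add_mul, mul_assoc v X y, h']
        noncomm_ring
    obtain ⟨q, hq⟩ := hsq X (Set.mem_insert _ _)
    let T : Subring R :=
      { carrier := {x | ∃ u ∈ S, ∃ v ∈ S, x = u + v * X}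
        zero_mem' := ⟨0, zero_mem _, 0, zero_mem _, by simp⟩
        one_mem' := ⟨1, one_mem _, 0, zero_mem _, by simp⟩
        add_mem' := by
          rintro _ _ ⟨u, hu, v, hv, rfl⟩ ⟨u', hu', v', hv', rfl⟩
          exact ⟨u + u', add_mem hu hu', v + v', add_mem hv hv', by rw [add_mul]; abel⟩
        neg_mem' := by
          rintro _ ⟨u, hu, v, hv, rfl⟩
          exact ⟨-u, neg_mem hu, -v, neg_mem hv, by noncomm_ring⟩
        mul_mem' := by
          rintro _ _ ⟨u, hu, v, hv, rfl⟩ ⟨u', hu', v', hv', rfl⟩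
          obtain ⟨y, hy, z, hz, h⟩ := key u' hu'
          obtain ⟨y', hy', z', hz', h'⟩ := key v' hv'
          refine ⟨u * u' + v * y + v * z' * q,
            add_mem (add_mem (mul_mem hu hu') (mul_mem hv hy))
              (mul_mem (mul_mem hv hz') (intCast_mem S q)), u * v' + v * z + v * y',
            add_mem (add_mem (mul_mem hu hv') (mul_mem hv hz)) (mul_mem hv hy'), ?_⟩
          have e1 : v * X * u' = v * y + v * z * X := by rw [mul_assoc, h]; noncomm_ring
          have e2 : v * X * (v' * X) = v * y' * X + v * z' * q := by
            rw [← hq, mul_assoc v X, ← mul_assoc X, h']; noncomm_ring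
          rw [mul_add, add_mul, add_mul, e1, e2]
          noncomm_ring }
    have hT : Subring.closure (insert X s) ≤ T := by
      rw [Subring.closure_le]
      rintro x (rfl | hx)
      · exact ⟨0, zero_mem _, 1, one_mem _, by simp⟩
      · exact ⟨x, Subring.subset_closure hx, 0, zero_mem _, by simp⟩
    refine fg_of_le (N := lat S ⊔ (lat S).map (LinearMap.mulRight ℤ X)) ?_
      (ih.sup (ih.map _))
    intro x hx
    obtain ⟨u, hu, v, hv, rfl⟩ := hT hx
    exact Submodule.add_mem_sup hu ⟨v, hv, rfl⟩

end Clifford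

/-! ### Conjugate lattices and rational scalars. -/

section Conj

variable {B : Type*} [Ring B] [StarRing B]

/-- The conjugate of a lattice. -/
def conj (M : Submodule ℤ B) : Submodule ℤ B :=
  M.map (starAddEquiv (R := B)).toAddMonoidHom.toIntLinearMap

theorem mem_conj {M : Submodule ℤ B} {x : B} : x ∈ conj M ↔ star x ∈ M := by
  constructor
  · rintro ⟨y, hy, rfl⟩
    simpa using hy
  · intro h
    exact ⟨star x, h, by simp⟩

theorem star_mem_conj {M : Submodule ℤ B} {x : B} (h : x ∈ M) : star x ∈ conj M := by
  rwa [mem_conj, star_star]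

theorem conj_conj (M : Submodule ℤ B) : conj (conj M) = M := by
  ext x; rw [mem_conj, mem_conj, star_star]

theorem conj_mul_le (M N : Submodule ℤ B) : conj (M * N) ≤ conj N * conj M := by
  suffices h : ∀ x ∈ M * N, star x ∈ conj N * conj M by
    intro x hx
    simpa using h _ (mem_conj.mp hx)
  intro x hx
  induction hx using Submodule.mul_induction_on' with
  | mem_mul_mem m hm n hn =>
    rw [star_mul]
    exact Submodule.mul_mem_mul (star_mem_conj hn) (star_mem_conj hm)
  | add x _ y _ hx hy => rw [star_add]; exact add_mem hx hy

theorem conj_mono {M N : Submodule ℤ B} (h : M ≤ N) : conj M ≤ conj N := Submodule.map_mono h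

theorem conj_mul (M N : Submodule ℤ B) : conj (M * N) = conj N * conj M := by
  refine le_antisymm (conj_mul_le M N) ?_
  have h := conj_mono (conj_mul_le (conj N) (conj M))
  rwa [conj_conj, conj_conj, conj_conj] at h

end Conj

section Scal

variable {B : Type*} [Ring B] [Algebra ℚ B]

/-- The lattice generated by a rational scalar. -/
def scal (B : Type*) [Ring B] [Algebra ℚ B] (c : ℚ) : Submodule ℤ B :=
  Submodule.span ℤ {algebraMap ℚ B c}

theorem mem_scal_mul {c : ℚ} {M : Submodule ℤ B} {x : B} :
    x ∈ scal B c * M ↔ ∃ y ∈ M, algebraMap ℚ B c * y = x :=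
  Submodule.mem_span_singleton_mul

theorem scal_mul_comm (c : ℚ) (M : Submodule ℤ B) : scal B c * M = M * scal B c := by
  ext x
  rw [mem_scal_mul, scal, Submodule.mem_mul_span_singleton]
  simp only [Algebra.commutes]

theorem scal_mul_scal (c d : ℚ) : scal B c * scal B d = scal B (c * d) := by
  rw [scal, scal, scal, Submodule.span_mul_span, Set.singleton_mul_singleton, map_mul]

theorem algebraMap_intCast_eq (k : ℤ) : algebraMap ℚ B (k : ℚ) = (k : B) := map_intCast _ k

end Scal

/-! ### Formal properties of the reduced norm. -/

section Norm

variable {B : Type*} [Ring B] [StarRing B] [Algebra ℚ B] [DefiniteQuaternion B]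

open DefiniteQuaternion

theorem algebraMap_rat_inj {B : Type*} [Ring B] [Algebra ℚ B] [Nontrivial B] {c d : ℚ} :
    algebraMap ℚ B c = algebraMap ℚ B d ↔ c = d :=
  (algebraMap ℚ B).injective.eq_iff

theorem nontrivial_of_definiteQuaternion : Nontrivial B :=
  Module.nontrivial_of_finrank_pos (R := ℚ) (by rw [finrank_eq (B := B)]; norm_num)

theorem nrd_zero : nrd (0 : B) = 0 := by
  have := nontrivial_of_definiteQuaternion (B := B)
  have h := mul_star_self (0 : B)
  rw [zero_mul, eq_comm, map_eq_zero_iff _ (algebraMap ℚ B).injective] at h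
  exact h

/-- Bracketing x · star x · x in both ways compares the scalars nrd x and nrd (star x) on a nonzero
vector. -/
theorem star_mul_self_eq (x : B) : star x * x = algebraMap ℚ B (nrd x) := by
  have := nontrivial_of_definiteQuaternion (B := B)
  by_cases hx : x = 0
  · subst hx; simp [nrd_zero]
  have h1 := mul_star_self x
  have h2 := mul_star_self (star x)
  rw [star_star] at h2
  rw [h2]
  congr 1
  have h3 : algebraMap ℚ B (nrd x) * x = algebraMap ℚ B (nrd (star x)) * x := by
    rw [← h1, mul_assoc, h2, Algebra.commutes]
  rw [← sub_eq_zero, ← sub_mul, ← map_sub, ← Algebra.smul_def, smul_eq_zero] at h3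
  rcases h3 with h3 | h3
  · linarith
  · exact absurd h3 hx

theorem nrd_star (x : B) : nrd (star x) = nrd x := by
  have := nontrivial_of_definiteQuaternion (B := B)
  have h1 := star_mul_self_eq x
  have h2 := mul_star_self (star x)
  rw [star_star, h1, algebraMap_rat_inj] at h2
  exact h2.symm

theorem nrd_mul (x y : B) : nrd (x * y) = nrd x * nrd y := by
  have := nontrivial_of_definiteQuaternion (B := B)
  have h := mul_star_self (x * y)
  rw [star_mul, mul_assoc, ← mul_assoc y, mul_star_self y, Algebra.commutes, ← mul_assoc,
    mul_star_self, ← map_mul, algebraMap_rat_inj] at h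
  exact h.symm

theorem nrd_algebraMap_intCast (k : ℤ) : nrd (k : B) = (k : ℚ) ^ 2 := by
  have := nontrivial_of_definiteQuaternion (B := B)
  have h := mul_star_self (k : B)
  rw [star_intCast] at h
  rw [← algebraMap_rat_inj (B := B), ← h, map_pow, algebraMap_intCast_eq, sq]

theorem nrd_one : nrd (1 : B) = 1 := by
  simpa using nrd_algebraMap_intCast (B := B) 1

theorem nrd_nonneg (x : B) : 0 ≤ nrd x := by
  by_cases hx : x = 0
  · rw [hx, nrd_zero]
  · exact (nrd_pos x hx).le

/-- The polar form of the norm. -/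
theorem mul_star_add_mul_star (x y : B) :
    x * star y + y * star x = algebraMap ℚ B (nrd (x + y) - nrd x - nrd y) := by
  rw [map_sub, map_sub, ← mul_star_self, ← mul_star_self, ← mul_star_self, star_add]
  noncomm_ring

theorem star_mul_add_star_mul (x y : B) :
    star x * y + star y * x = algebraMap ℚ B (nrd (x + y) - nrd x - nrd y) := by
  have h := mul_star_add_mul_star (star x) (star y)
  rwa [star_star, star_star, ← star_add, nrd_star, nrd_star, nrd_star] at h

theorem add_star_eq (x : B) : x + star x = algebraMap ℚ B (nrd (x + 1) - nrd x - 1) := by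
  have h := mul_star_add_mul_star x 1
  rwa [star_one, mul_one, one_mul, nrd_one] at h

/-- The inverse of a nonzero element. -/
def inv (x : B) : B := algebraMap ℚ B (nrd x)⁻¹ * star x

theorem inv_mul {x : B} (hx : x ≠ 0) : inv x * x = 1 := by
  rw [inv, mul_assoc, star_mul_self_eq, ← map_mul, inv_mul_cancel₀ (nrd_pos x hx).ne', map_one]

theorem mul_ne_zero_of {x y : B} (hx : x ≠ 0) (hy : y ≠ 0) : x * y ≠ 0 := by
  intro h
  apply hy
  rw [← one_mul y, ← inv_mul hx, mul_assoc, h, mul_zero]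

end Norm

/-! ### Lattices over a maximal order: M · conj M = c O. -/

section MulConj

open DefiniteQuaternion

variable {B : Type*} [Ring B] [StarRing B] [Algebra ℚ B] [DefiniteQuaternion B]

/-- A subring is maximal among those that are finitely generated additive groups. -/
def IsMaximalFG {B : Type*} [Ring B] (O : Subring B) : Prop :=
  ∀ O' : Subring B, O ≤ O' → (lat O').FG → O' ≤ O

/-- The norms of the elements are integers. -/
def HasIntegralNorms (O : Subring B) : Prop := ∀ x ∈ O, ∃ k : ℤ, nrd x = k

/-- Since nrd (D x) = D² nrd x is an integer, all norms lie in D⁻²ℤ, and a subgroup of a cyclic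
group is cyclic. A nonzero element of M makes the generator nonzero; its absolute value is taken. -/
theorem exists_norm_generator {O : Subring B} (hint : HasIntegralNorms O) {M : Submodule ℤ B}
    {D : ℤ} (hD : D ≠ 0) (hDM : ∀ x ∈ M, (D : B) * x ∈ O) (h0 : ∃ x ∈ M, x ≠ 0) :
    ∃ c : ℚ, 0 < c ∧
      AddSubgroup.closure (nrd '' (M : Set B)) = AddSubgroup.zmultiples c := by
  set G := AddSubgroup.closure (nrd '' (M : Set B)) with hG
  have hD' : (D : ℚ) ≠ 0 := by exact_mod_cast hD
  let f : ℤ →+ ℚ := (AddMonoidHom.mulRight ((D : ℚ) ^ 2)⁻¹).comp (Int.castAddHom ℚ)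
  have hf : ∀ k : ℤ, f k = k * ((D : ℚ) ^ 2)⁻¹ := fun k => rfl
  have hrange : ∀ q ∈ G, ∃ k : ℤ, f k = q := by
    intro q hq
    change q ∈ f.range
    revert q
    change G ≤ f.range
    rw [hG, AddSubgroup.closure_le]
    rintro _ ⟨x, hx, rfl⟩
    obtain ⟨k, hk⟩ := hint _ (hDM x hx)
    refine ⟨k, ?_⟩
    rw [nrd_mul, nrd_algebraMap_intCast] at hk
    rw [hf, ← hk]
    field_simp
  obtain ⟨d, hd⟩ := Int.subgroup_cyclic (G.comap f)
  have hGd : G = AddSubgroup.zmultiples (f d) := by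
    apply le_antisymm
    · intro q hq
      obtain ⟨k, rfl⟩ := hrange q hq
      have hk : k ∈ G.comap f := hq
      rw [hd, ← AddSubgroup.zmultiples_eq_closure, AddSubgroup.mem_zmultiples_iff] at hk
      obtain ⟨j, rfl⟩ := hk
      exact AddSubgroup.mem_zmultiples_iff.mpr ⟨j, by rw [map_zsmul]⟩
    · rw [AddSubgroup.zmultiples_le]
      change d ∈ G.comap f
      rw [hd]
      exact AddSubgroup.subset_closure rfl
  obtain ⟨x, hx, hx0⟩ := h0
  have hfd : f d ≠ 0 := by
    intro h
    have : nrd x ∈ G := AddSubgroup.subset_closure ⟨x, hx, rfl⟩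
    rw [hGd, h, AddSubgroup.zmultiples_zero_eq_bot, AddSubgroup.mem_bot] at this
    exact (nrd_pos x hx0).ne' this
  refine ⟨|f d|, abs_pos.mpr hfd, ?_⟩
  rw [hGd]
  rcases abs_choice (f d) with h | h <;> rw [h]
  simp

/-- A lattice `M` over a maximal order `O` satisfies `M * conj M = c O`, where `c` generates the
group spanned by the norms of the elements of `M`. -/
theorem mul_conj_eq {O : Subring B} (hmax : IsMaximalFG O) {M : Submodule ℤ B}
    (hOM : lat O * M ≤ M) (hfg : M.FG) {c : ℚ} (hc : 0 < c)
    (hcM : AddSubgroup.closure (nrd '' (M : Set B)) = AddSubgroup.zmultiples c) :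
    scal B c⁻¹ * (M * conj M) = lat O := by
  have hint : ∀ x ∈ M, ∃ k : ℤ, nrd x = k * c := by
    intro x hx
    have : nrd x ∈ AddSubgroup.zmultiples c := hcM ▸ AddSubgroup.subset_closure ⟨x, hx, rfl⟩
    obtain ⟨k, hk⟩ := AddSubgroup.mem_zmultiples_iff.mp this
    exact ⟨k, by rw [← hk, zsmul_eq_mul]⟩
  -- The square of X m is the scalar nrd m / c, an integer, and polarisation makes the
  -- anticommutators integral too. The upper-left corner of X m · X (star n) is c⁻¹ m n, so products
  -- of two such matrices produce the lattice c⁻¹ M · conj M.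
  let X : B →ₗ[ℤ] Matrix (Fin 2) (Fin 2) B :=
    { toFun := fun m => !![0, m; algebraMap ℚ B c⁻¹ * star m, 0]
      map_add' := by
        intro x y; ext i j; fin_cases i <;> fin_cases j <;> simp [mul_add]
      map_smul' := by
        intro k x; ext i j; fin_cases i <;> fin_cases j <;> simp
        rw [← (Int.cast_commute k (star x)).eq, ← mul_assoc, ← mul_assoc,
          (Int.cast_commute k _).eq] }
  have hX : ∀ m, X m = !![0, m; algebraMap ℚ B c⁻¹ * star m, 0] := fun _ => rfl
  have hXX : ∀ m m', X m * X m' = !![algebraMap ℚ B c⁻¹ * (m * star m'), 0;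
      0, algebraMap ℚ B c⁻¹ * (star m * m')] := by
    intro m m'
    rw [hX, hX, Matrix.mul_fin_two]
    simp only [zero_mul, mul_zero, zero_add, add_zero, mul_assoc]
    rw [← mul_assoc m, ← Algebra.commutes, mul_assoc]
  have hcast : ∀ k : ℤ, ((k : ℤ) : Matrix (Fin 2) (Fin 2) B) = !![(k : B), 0; 0, (k : B)] := by
    intro k; ext i j; fin_cases i <;> fin_cases j <;> simp [Matrix.intCast_apply]
  obtain ⟨s, hs⟩ := hfg
  have hsM : ∀ x ∈ s, x ∈ M := fun x hx => hs ▸ Submodule.subset_span hx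
  have hS : (lat (Subring.closure (X '' (s : Set B)))).FG := by
    apply fg_closure_of_clifford (s.finite_toSet.image X)
    · rintro _ ⟨x, hx, rfl⟩
      obtain ⟨k, hk⟩ := hint x (hsM x hx)
      refine ⟨k, ?_⟩
      rw [hXX, hcast, mul_star_self, star_mul_self_eq, ← map_mul, hk, mul_comm (k : ℚ),
        inv_mul_cancel_left₀ hc.ne', algebraMap_intCast_eq]
    · rintro _ ⟨x, hx, rfl⟩ _ ⟨y, hy, rfl⟩
      obtain ⟨k, hk⟩ := hint x (hsM x hx)
      obtain ⟨l, hl⟩ := hint y (hsM y hy)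
      obtain ⟨j, hj⟩ := hint (x + y) (add_mem (hsM x hx) (hsM y hy))
      have hjkl : algebraMap ℚ B c⁻¹ * algebraMap ℚ B (nrd (x + y) - nrd x - nrd y)
          = ((j - k - l : ℤ) : B) := by
        have : c⁻¹ * (j * c - k * c - l * c) = ((j - k - l : ℤ) : ℚ) := by
          push_cast
          field_simp
        rw [← map_mul, hj, hk, hl, this, algebraMap_intCast_eq]
      refine ⟨j - k - l, ?_⟩
      rw [hXX, hXX, hcast, ← hjkl]
      nth_rw 1 [← mul_star_add_mul_star]
      rw [← star_mul_add_star_mul]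
      ext i j; fin_cases i <;> fin_cases j <;> simp [mul_add]
  set S := Subring.closure (X '' (s : Set B)) with hSdef
  have hXS : ∀ x ∈ M, X x ∈ S := by
    intro x hx
    have : M ≤ (lat S).comap X := by
      rw [← hs, Submodule.span_le]
      intro y hy
      exact Subring.subset_closure ⟨y, hy, rfl⟩
    exact this hx
  -- Corner entries of the diagonal matrices in S. This ring is finitely generated because S is, and
  -- it contains c⁻¹ M · conj M, which contains O; maximality then forces equality throughout.
  let T : Subring B :=
    { carrier := {z | ∃ w, !![z, 0; 0, w] ∈ S}
      zero_mem' := ⟨0, by convert zero_mem S using 1; ext i j; fin_cases i <;> fin_cases j <;> rfl⟩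
      one_mem' := ⟨1, by convert one_mem S using 1; exact Matrix.one_fin_two.symm⟩
      add_mem' := by
        rintro x y ⟨w, hw⟩ ⟨v, hv⟩
        exact ⟨w + v, by convert add_mem hw hv using 1; simp⟩
      neg_mem' := by
        rintro x ⟨w, hw⟩
        exact ⟨-w, by convert neg_mem hw using 1; simp⟩
      mul_mem' := by
        rintro x y ⟨w, hw⟩ ⟨v, hv⟩
        exact ⟨w * v, by convert mul_mem hw hv using 1; simp⟩ }
  have hTfg : (lat T).FG := by
    let f : Matrix (Fin 2) (Fin 2) B →ₗ[ℤ] B :=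
      { toFun := fun A => A 0 0
        map_add' := fun _ _ => rfl
        map_smul' := fun _ _ => rfl }
    refine fg_of_le (N := (lat S).map f) ?_ (hS.map f)
    rintro z ⟨w, hw⟩
    exact ⟨_, hw, rfl⟩
  have hNT : scal B c⁻¹ * (M * conj M) ≤ lat T := by
    rintro z hz
    obtain ⟨y, hy, rfl⟩ := mem_scal_mul.mp hz
    clear hz
    induction hy using Submodule.mul_induction_on' with
    | mem_mul_mem m hm n hn =>
      refine ⟨algebraMap ℚ B c⁻¹ * (star m * star n), ?_⟩
      have := mul_mem (hXS m hm) (hXS (star n) (mem_conj.mp hn))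
      rwa [hXX, star_star] at this
    | add x _ y _ hx hy => rw [mul_add]; exact add_mem hx hy
  -- The scalar c is an integral combination of norms x · star x with x in M, so it lies in M · conj
  -- M.
  have hone : (1 : B) ∈ scal B c⁻¹ * (M * conj M) := by
    have : ∀ q ∈ AddSubgroup.closure (nrd '' (M : Set B)),
        algebraMap ℚ B q ∈ M * conj M := by
      intro q hq
      induction hq using AddSubgroup.closure_induction with
      | mem q hq =>
        obtain ⟨x, hx, rfl⟩ := hq
        rw [← mul_star_self]
        exact Submodule.mul_mem_mul hx (star_mem_conj hx)
      | zero => rw [map_zero]; exact zero_mem _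
      | add x y _ _ hx hy => rw [map_add]; exact add_mem hx hy
      | neg x _ hx => rw [map_neg]; exact neg_mem hx
    refine mem_scal_mul.mpr ⟨_, this c (hcM ▸ AddSubgroup.mem_zmultiples c), ?_⟩
    rw [← map_mul, inv_mul_cancel₀ hc.ne', map_one]
  have hON : lat O ≤ scal B c⁻¹ * (M * conj M) := by
    intro x hx
    have h := Submodule.mul_mem_mul hx hone
    rw [mul_one, ← mul_assoc, ← scal_mul_comm, mul_assoc, ← mul_assoc (lat O)] at h
    exact mul_le_mul' le_rfl (mul_le_mul' hOM le_rfl) h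
  exact le_antisymm (hNT.trans (hmax T (hON.trans hNT) hTfg)) hON

/-- Some norm of an element of the lattice is not divisible by a given prime. -/
theorem exists_norm_not_dvd {M : Submodule ℤ B} {c : ℚ} (hc : 0 < c)
    (hcM : AddSubgroup.closure (nrd '' (M : Set B)) = AddSubgroup.zmultiples c)
    {ℓ : ℕ} (hℓ : ℓ.Prime) : ∃ x ∈ M, ∃ k : ℤ, nrd x = k * c ∧ ¬ (ℓ : ℤ) ∣ k := by
  by_contra! h
  have hle : AddSubgroup.closure (nrd '' (M : Set B)) ≤ AddSubgroup.zmultiples (ℓ * c) := by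
    rw [AddSubgroup.closure_le]
    rintro _ ⟨x, hx, rfl⟩
    have : nrd x ∈ AddSubgroup.zmultiples c := hcM ▸ AddSubgroup.subset_closure ⟨x, hx, rfl⟩
    obtain ⟨k, hk⟩ := AddSubgroup.mem_zmultiples_iff.mp this
    rw [zsmul_eq_mul] at hk
    obtain ⟨j, rfl⟩ := h x hx k hk.symm
    refine AddSubgroup.mem_zmultiples_iff.mpr ⟨j, ?_⟩
    rw [← hk, zsmul_eq_mul]
    push_cast
    ring
  have : c ∈ AddSubgroup.zmultiples ((ℓ : ℚ) * c) :=
    hle (hcM ▸ AddSubgroup.mem_zmultiples c)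
  obtain ⟨k, hk⟩ := AddSubgroup.mem_zmultiples_iff.mp this
  rw [zsmul_eq_mul, ← mul_assoc] at hk
  have h1 : ((k * ℓ : ℤ) : ℚ) = 1 := by
    push_cast
    exact mul_right_cancel₀ hc.ne' (by rw [hk, one_mul])
  have h2 : k * (ℓ : ℤ) = 1 := by exact_mod_cast h1
  have h3 : (ℓ : ℤ) ∣ 1 := ⟨k, by rw [← h2, mul_comm]⟩
  have h4 : ℓ ∣ 1 := by exact_mod_cast h3
  exact hℓ.one_lt.ne' (Nat.dvd_one.mp h4)

end MulConj

/-! ### Left ideals as lattices. -/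

section LatIdeal

variable {B : Type*} [Ring B] {O : Subring B}

/-- The lattice underlying a left ideal. -/
def latIdeal (I : Ideal O) : Submodule ℤ B :=
  AddSubgroup.toIntSubmodule ((Submodule.toAddSubgroup I).map O.subtype.toAddMonoidHom)

theorem mem_latIdeal {I : Ideal O} {x : B} : x ∈ latIdeal I ↔ ∃ y ∈ I, (y : B) = x := Iff.rfl

theorem coe_mem_latIdeal {I : Ideal O} {x : O} : (x : B) ∈ latIdeal I ↔ x ∈ I := by
  rw [mem_latIdeal]
  refine ⟨?_, fun hx => ⟨x, hx, rfl⟩⟩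
  rintro ⟨y, hy, hyx⟩
  rwa [← Subtype.ext hyx]

theorem latIdeal_le (I : Ideal O) : latIdeal I ≤ lat O := by
  rintro _ ⟨y, -, rfl⟩
  exact y.2

theorem lat_mul_latIdeal (I : Ideal O) : lat O * latIdeal I = latIdeal I := by
  apply le_antisymm
  · rw [Submodule.mul_le]
    rintro x hx _ ⟨y, hy, rfl⟩
    exact ⟨⟨x, hx⟩ * y, I.mul_mem_left _ hy, rfl⟩
  · intro x hx
    rw [← one_mul x]
    exact Submodule.mul_mem_mul (one_mem O) hx

theorem lat_fg (e : Module.Basis (Fin 4) ℤ O) : (lat O).FG := by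
  have : Module.Finite ℤ O := Module.Finite.of_basis e
  have h : lat O = (⊤ : Submodule ℤ O).map O.subtype.toAddMonoidHom.toIntLinearMap := by
    ext x
    exact ⟨fun hx => ⟨⟨x, hx⟩, trivial, rfl⟩, by rintro ⟨y, -, rfl⟩; exact y.2⟩
  rw [h]
  exact Module.Finite.fg_top.map _

end LatIdeal

/-! ### Integrality in orders and indices of left ideals. -/

section Orders

open DefiniteQuaternion

variable {B : Type*} [Ring B] [StarRing B] [Algebra ℚ B] [DefiniteQuaternion B]

theorem coe_sum_smul {B : Type*} [Ring B] {O : Subring B} (e : Module.Basis (Fin 4) ℤ O)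
    (v : Fin 4 → ℤ) : ((∑ i, v i • e i : O) : B) = ∑ i, (v i : B) * (e i : B) := by
  rw [AddSubmonoidClass.coe_finsetSum]
  simp

/-- The rational basis underlying a `ℤ`-basis of an order. -/
def ratBasis {O : Subring B} (e : Module.Basis (Fin 4) ℤ O)
    (h : Submodule.span ℚ (O : Set B) = ⊤) : Module.Basis (Fin 4) ℚ B :=
  basisOfTopLeSpanOfCardEqFinrank (fun i => (e i : B))
    (by
      rw [← h, Submodule.span_le]
      intro x hx
      have hx' : x = ∑ i, ((e.repr ⟨x, hx⟩ i : ℤ) : B) * (e i : B) := by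
        rw [← coe_sum_smul, e.sum_repr]
      rw [hx']
      refine sum_mem fun i _ => ?_
      rw [← algebraMap_intCast_eq, ← Algebra.smul_def]
      exact Submodule.smul_mem _ _ (Submodule.subset_span ⟨i, rfl⟩))
    (by rw [finrank_eq (B := B), Fintype.card_fin])

variable {O : Subring B} (e : Module.Basis (Fin 4) ℤ O) (h : Submodule.span ℚ (O : Set B) = ⊤)

@[simp] theorem ratBasis_apply (i : Fin 4) : ratBasis e h i = (e i : B) := by
  simp [ratBasis]

theorem ratBasis_repr (x : O) (i : Fin 4) : (ratBasis e h).repr (x : B) i = (e.repr x i : ℚ) := by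
  have hx : (x : B) = ∑ i, (e.repr x i : ℚ) • ratBasis e h i := by
    conv_lhs => rw [← e.sum_repr x, coe_sum_smul]
    simp only [Algebra.smul_def, algebraMap_intCast_eq, ratBasis_apply]
  rw [hx, Module.Basis.repr_sum_self]

theorem mem_of_ratBasis_repr {x : B} (z : Fin 4 → ℤ)
    (hz : ∀ i, (ratBasis e h).repr x i = z i) : x ∈ O := by
  have hx : x = ((∑ i, z i • e i : O) : B) := by
    conv_lhs => rw [← (ratBasis e h).sum_repr x]
    rw [coe_sum_smul]
    simp only [Algebra.smul_def, hz, algebraMap_intCast_eq, ratBasis_apply]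
  rw [hx]
  exact Subtype.property _

include h in
theorem det_mul_basis (x : O) : ((e.det fun i => e i * x : ℤ) : ℚ) = nrd (x : B) ^ 2 := by
  rw [← det_mulRight, ← LinearMap.det_toMatrix (ratBasis e h), Module.Basis.det_apply,
    ← eq_intCast (Int.castRingHom ℚ), RingHom.map_det]
  congr 1
  ext i j
  rw [LinearMap.toMatrix_apply, RingHom.mapMatrix_apply, Matrix.map_apply,
    Module.Basis.toMatrix_apply, ratBasis_apply, LinearMap.mulRight_apply, ← Subring.coe_mul,
    ratBasis_repr]
  rfl

include e h in
-- The square of the norm is the determinant of an integral matrix, and a rational number whose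
-- square is an integer is an integer.
theorem hasIntegralNorms : HasIntegralNorms O := by
  intro x hx
  have hdet := det_mul_basis e h ⟨x, hx⟩
  have hden : (nrd x).den ^ 2 = 1 := by
    rw [← Rat.den_pow, ← hdet, Rat.den_intCast]
  refine ⟨(nrd x).num, ?_⟩
  exact ((Rat.den_eq_one_iff _).mp (by simpa using hden)).symm

include e h in
-- The conjugate is the trace minus x, and the trace is the integer nrd (x + 1) − nrd x − 1.
theorem star_mem_order {x : B} (hx : x ∈ O) : star x ∈ O := by
  obtain ⟨k, hk⟩ := hasIntegralNorms e h x hx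
  obtain ⟨l, hl⟩ := hasIntegralNorms e h (x + 1) (add_mem hx (one_mem O))
  have hs : star x = ((l - k - 1 : ℤ) : B) - x := by
    rw [← algebraMap_intCast_eq, eq_sub_iff_add_eq, add_comm, add_star_eq, hk, hl]
    push_cast
    rfl
  rw [hs]
  exact sub_mem (intCast_mem O _) hx

include e h in
theorem conj_lat : conj (lat O) = lat O := by
  ext x
  rw [mem_conj, mem_lat, mem_lat]
  refine ⟨fun hx => ?_, star_mem_order e h⟩
  rw [← star_star x]
  exact star_mem_order e h hx

/-- The multiples `O x` of an element of the order, as a subgroup of the order. -/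
def leftMultiples (x : O) : AddSubgroup O := (AddMonoidHom.mulRight x).range

include e h in
theorem index_leftMultiples {x : O} (hx : x ≠ 0) :
    ((leftMultiples x).index : ℚ) = nrd (x : B) ^ 2 := by
  have hx' : (x : B) ≠ 0 := fun h0 => hx (Subtype.ext h0)
  have hinj : Function.Injective (LinearMap.mulRight ℤ x) := by
    rw [injective_iff_map_eq_zero]
    intro y hy
    by_contra hy0
    refine mul_ne_zero_of (x := (y : B)) (fun h0 => hy0 (Subtype.ext h0)) hx' ?_
    exact congrArg Subtype.val hy
  let E := LinearEquiv.ofInjective _ hinj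
  let N : AddSubgroup O := (LinearMap.range (LinearMap.mulRight ℤ x)).toAddSubgroup
  have hN : leftMultiples x = N := rfl
  let bN : Module.Basis (Fin 4) ℤ N := e.map E
  have hb : ∀ i, ((bN i : N) : O) = e i * x := fun i => rfl
  rw [hN, AddSubgroup.index_eq_natAbs_det e N bN, ← det_mul_basis e h x]
  simp only [hb]
  have hnn : 0 ≤ e.det fun i => e i * x := by
    have : (0 : ℚ) ≤ ((e.det fun i => e i * x : ℤ) : ℚ) := by
      rw [det_mul_basis e h]; positivity
    exact_mod_cast this
  rw [← Int.cast_natCast, Int.natAbs_of_nonneg hnn]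

include e h in
/-- A left ideal of a maximal order whose index is a power of a prime has square index. -/
theorem even_of_index_eq_pow (hmax : IsMaximalFG O) {I : Ideal O} {ℓ s : ℕ} (hℓ : ℓ.Prime)
    (hI : (Submodule.toAddSubgroup I).index = ℓ ^ s) : Even s := by
  have hnt := nontrivial_of_definiteQuaternion (B := B)
  have hpow : ((ℓ ^ s : ℕ) : O) ∈ I := by
    have := AddSubgroup.nsmul_index_mem (Submodule.toAddSubgroup I) (1 : O)
    rwa [hI, nsmul_eq_mul, mul_one] at this
  have hcz : CharZero B := algebraRat.charZero B
  have hpos : (((ℓ ^ s : ℕ) : O) : B) ≠ 0 := by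
    rw [Subring.coe_natCast]
    exact Nat.cast_ne_zero.mpr (pow_ne_zero _ hℓ.ne_zero)
  obtain ⟨c, hc, hcM⟩ := exists_norm_generator (hasIntegralNorms e h) (M := latIdeal I)
    (D := 1) one_ne_zero (fun x hx => by simpa using latIdeal_le I hx)
    ⟨_, coe_mem_latIdeal.mpr hpow, hpos⟩
  have hmul := mul_conj_eq hmax (lat_mul_latIdeal I).le (fg_of_le (latIdeal_le I) (lat_fg e))
    hc hcM
  -- Take x in I with norm k c and ℓ not dividing k. The principal ideal O x then has index in I
  -- prime to ℓ, so I and O x have the same ℓ-part of the index, and the index of O x is a square.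
  obtain ⟨_, ⟨x, hxI, rfl⟩, k, hk, hdvd⟩ := exists_norm_not_dvd hc hcM hℓ
  change nrd (x : B) = _ at hk
  have hx0 : x ≠ 0 := by
    rintro rfl
    rw [ZeroMemClass.coe_zero, nrd_zero, eq_comm, mul_eq_zero] at hk
    rcases hk with hk | hk
    · exact hdvd ((by exact_mod_cast hk : k = 0) ▸ dvd_zero _)
    · exact hc.ne' hk
  have hle : leftMultiples x ≤ Submodule.toAddSubgroup I := by
    rintro _ ⟨y, rfl⟩
    exact I.mul_mem_left _ hxI
  -- For y in I the element c⁻¹ y · star x lies in O by `mul_conj_eq`; multiplying it by x on the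
  -- right gives k y.
  have hkI : ∀ y ∈ I, k • y ∈ leftMultiples x := by
    intro y hy
    have hm : algebraMap ℚ B c⁻¹ * ((y : B) * star (x : B)) ∈ lat O := by
      rw [← hmul]
      exact mem_scal_mul.mpr ⟨_, Submodule.mul_mem_mul ⟨y, hy, rfl⟩ (star_mem_conj ⟨x, hxI, rfl⟩),
        rfl⟩
    refine ⟨⟨_, hm⟩, Subtype.ext ?_⟩
    change algebraMap ℚ B c⁻¹ * ((y : B) * star (x : B)) * x = ((k • y : O) : B)
    rw [mul_assoc, mul_assoc, star_mul_self_eq, ← Algebra.commutes, ← mul_assoc, ← map_mul, hk,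
      mul_comm (k : ℚ), inv_mul_cancel_left₀ hc.ne', algebraMap_intCast_eq]
    simp
  obtain ⟨n, hn⟩ := hasIntegralNorms e h x x.2
  have hindex : (leftMultiples x).index = n.natAbs ^ 2 := by
    have := index_leftMultiples e h hx0
    rw [hn] at this
    have h2 : ((leftMultiples x).index : ℤ) = n ^ 2 := by exact_mod_cast this
    zify
    rw [h2, sq_abs]
  have hn0 : n.natAbs ≠ 0 := by
    have := nrd_pos (x : B) (fun h0 => hx0 (Subtype.ext h0))
    rw [hn] at this
    rw [Int.natAbs_ne_zero]
    rintro rfl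
    simp at this
  have hrel := AddSubgroup.relIndex_mul_index hle
  rw [hI, hindex] at hrel
  set j := (leftMultiples x).relIndex (Submodule.toAddSubgroup I) with hj
  have hj0 : j ≠ 0 := by
    rintro h0
    rw [h0, zero_mul, eq_comm] at hrel
    exact hn0 (pow_eq_zero_iff two_ne_zero |>.mp hrel)
  -- By Cauchy's theorem I / O x would contain an element of order ℓ, but k annihilates this
  -- quotient.
  have hlj : ¬ ℓ ∣ j := by
    intro hdj
    have hcard : Nat.card (Submodule.toAddSubgroup I ⧸
        (leftMultiples x).addSubgroupOf (Submodule.toAddSubgroup I)) = j := rfl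
    have := Nat.finite_of_card_ne_zero (hcard ▸ hj0)
    have : Fact ℓ.Prime := ⟨hℓ⟩
    obtain ⟨g, hg⟩ := exists_prime_addOrderOf_dvd_card' ℓ (hcard ▸ hdj)
    have hkg : k • g = 0 := by
      obtain ⟨y, rfl⟩ := QuotientAddGroup.mk_surjective g
      rw [← QuotientAddGroup.mk_zsmul, QuotientAddGroup.eq_zero_iff]
      exact hkI y y.2
    rw [← addOrderOf_dvd_iff_zsmul_eq_zero, hg] at hkg
    exact hdvd hkg
  -- Compare ℓ-adic valuations in j · ℓ^s = n².
  have hfac := congrArg (fun m => m.factorization ℓ) hrel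
  rw [Nat.factorization_mul hj0 (pow_ne_zero _ hℓ.ne_zero), Nat.factorization_pow,
    Nat.factorization_pow, Finsupp.add_apply, Nat.factorization_eq_zero_of_not_dvd hlj,
    Finsupp.smul_apply, Finsupp.smul_apply, hℓ.factorization_self] at hfac
  simp only [smul_eq_mul] at hfac
  exact ⟨n.natAbs.factorization ℓ, by omega⟩

include e h in
/-- A left ideal of a maximal order that contains a power of a prime has index an even power. -/
theorem exists_index_eq_pow (hmax : IsMaximalFG O) {I : Ideal O} {ℓ r : ℕ} (hℓ : ℓ.Prime)
    (hI : ((ℓ ^ r : ℕ) : O) ∈ I) :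
    ∃ t : ℕ, (Submodule.toAddSubgroup I).index = ℓ ^ (t + t) := by
  have hnt := nontrivial_of_definiteQuaternion (B := B)
  have hcz : CharZero B := algebraRat.charZero B
  have hpos : ((ℓ ^ r : ℕ) : O) ≠ 0 := by
    intro h0
    have h1 : (((ℓ ^ r : ℕ) : O) : B) = 0 := by rw [h0]; rfl
    rw [Subring.coe_natCast] at h1
    exact pow_ne_zero r hℓ.ne_zero (Nat.cast_eq_zero.mp h1)
  have hle : leftMultiples ((ℓ ^ r : ℕ) : O) ≤ Submodule.toAddSubgroup I := by
    rintro _ ⟨y, rfl⟩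
    exact I.mul_mem_left _ hI
  -- The norm of ℓ^r is ℓ^(2r), and the index is its square. The index of I divides it.
  have hindex : (leftMultiples ((ℓ ^ r : ℕ) : O)).index = ℓ ^ (r * 4) := by
    have := index_leftMultiples e h hpos
    rw [Subring.coe_natCast, ← Int.cast_natCast (R := B), nrd_algebraMap_intCast] at this
    rw [pow_mul]
    have h2 : ((leftMultiples ((ℓ ^ r : ℕ) : O)).index : ℚ) = (((ℓ ^ r) ^ 4 : ℕ) : ℚ) := by
      rw [this]; push_cast; ring
    exact_mod_cast h2
  obtain ⟨s, -, hs⟩ := (Nat.dvd_prime_pow hℓ).mp (hindex ▸ AddSubgroup.index_dvd_of_le hle)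
  obtain ⟨t, rfl⟩ := even_of_index_eq_pow e h hmax hℓ hs
  exact ⟨t, hs⟩

end Orders

/-! ### Connecting lattices and the transfer back to the second order. -/

section Connecting

open DefiniteQuaternion

theorem one_le_lat {B : Type*} [Ring B] (O : Subring B) : 1 ≤ lat O := by
  rw [Submodule.one_le]
  exact one_mem O

theorem lat_mul_self {B : Type*} [Ring B] (O : Subring B) : lat O * lat O = lat O := by
  apply le_antisymm
  · rw [Submodule.mul_le]
    exact fun x hx y hy => O.mul_mem hx hy
  · conv_lhs => rw [← one_mul (lat O)]
    exact mul_le_mul' (one_le_lat O) le_rfl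

theorem latIdeal_span {B : Type*} [Ring B] {O : Subring B} (S : Set O) :
    latIdeal (Ideal.span S) = lat O * Submodule.span ℤ ((↑) '' S) := by
  apply le_antisymm
  · rintro _ ⟨y, hy, rfl⟩
    change (y : B) ∈ _
    induction hy using Submodule.span_induction with
    | mem x hx =>
      rw [← one_mul (x : B)]
      exact Submodule.mul_mem_mul (one_mem O) (Submodule.subset_span ⟨x, hx, rfl⟩)
    | zero => exact zero_mem _
    | add x y _ _ hx hy => exact add_mem hx hy
    | smul a x _ hx =>
      rw [← lat_mul_self, mul_assoc]
      exact Submodule.mul_mem_mul a.2 hx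
  · conv_rhs => rw [← lat_mul_latIdeal]
    refine mul_le_mul' le_rfl (Submodule.span_le.mpr ?_)
    rintro _ ⟨y, hy, rfl⟩
    exact coe_mem_latIdeal.mpr (Ideal.subset_span hy)

/-- The element of an order with given coordinates. -/
def comb {B : Type*} [Ring B] {O : Subring B} (e : Module.Basis (Fin 4) ℤ O) (v : Fin 4 → ℤ) : O :=
  ∑ i, v i • e i

theorem coe_comb {B : Type*} [Ring B] {O : Subring B} (e : Module.Basis (Fin 4) ℤ O)
    (v : Fin 4 → ℤ) : (comb e v : B) = ∑ i, (v i : B) * (e i : B) := by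
  rw [comb, AddSubmonoidClass.coe_finsetSum]
  simp

/-- Apply each of four matrices to each vector of a list. -/
def transList (M : Fin 4 → Matrix (Fin 4) (Fin 4) ℤ) (gs : List (Fin 4 → ℤ)) :
    List (Fin 4 → ℤ) :=
  gs.flatMap fun v => List.ofFn fun j => (M j).mulVec v

theorem mem_transList {M : Fin 4 → Matrix (Fin 4) (Fin 4) ℤ} {gs : List (Fin 4 → ℤ)}
    {w : Fin 4 → ℤ} : w ∈ transList M gs ↔ ∃ v ∈ gs, ∃ j, w = (M j).mulVec v := by
  simp only [transList, List.mem_flatMap, List.mem_ofFn, eq_comm]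

theorem coe_comb_mulVec {B : Type*} [Ring B] {O O' : Subring B} (e : Module.Basis (Fin 4) ℤ O)
    (e' : Module.Basis (Fin 4) ℤ O') {M : Matrix (Fin 4) (Fin 4) ℤ} {u δ : B}
    (hM : ∀ k, (comb e' (fun i => M i k) : B) = u * e k * δ) (v : Fin 4 → ℤ) :
    (comb e' (M.mulVec v) : B) = u * comb e v * δ := by
  rw [coe_comb, coe_comb, Finset.mul_sum, Finset.sum_mul]
  have : ∀ k, u * ((v k : B) * e k) * δ = (v k : B) * ∑ i, (M i k : B) * (e' i : B) := by
    intro k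
    rw [← coe_comb, hM, ← mul_assoc, ← (Int.cast_commute (v k) u).eq]
    simp only [mul_assoc]
  simp only [this, Finset.mul_sum, Matrix.mulVec, dotProduct, Int.cast_sum, Finset.sum_mul]
  rw [Finset.sum_comm]
  refine Finset.sum_congr rfl fun k _ => Finset.sum_congr rfl fun i _ => ?_
  rw [mul_comm (M i k), Int.cast_mul, mul_assoc]

/-- The left ideal generated by the elements with given coordinates. -/
def genIdeal {B : Type*} [Ring B] {O : Subring B} (e : Module.Basis (Fin 4) ℤ O)
    (gs : List (Fin 4 → ℤ)) : Ideal O :=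
  Ideal.span {g : O | ∃ v ∈ gs, g = ∑ i, v i • e i}

/-- The span of the elements with given coordinates. -/
def genSpan {B : Type*} [Ring B] {O : Subring B} (e : Module.Basis (Fin 4) ℤ O)
    (gs : List (Fin 4 → ℤ)) : Submodule ℤ B :=
  Submodule.span ℤ ((↑) '' {g : O | ∃ v ∈ gs, g = ∑ i, v i • e i})

theorem latIdeal_genIdeal {B : Type*} [Ring B] {O : Subring B} (e : Module.Basis (Fin 4) ℤ O)
    (gs : List (Fin 4 → ℤ)) : latIdeal (genIdeal e gs) = lat O * genSpan e gs :=
  latIdeal_span _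

theorem genSpan_transList {B : Type*} [Ring B] {O O' : Subring B} (e : Module.Basis (Fin 4) ℤ O)
    (e' : Module.Basis (Fin 4) ℤ O') {M : Fin 4 → Matrix (Fin 4) (Fin 4) ℤ} {u : Fin 4 → B}
    {δ : B} (hM : ∀ j k, (comb e' (fun i => M j i k) : B) = u j * e k * δ)
    (gs : List (Fin 4 → ℤ)) :
    genSpan e' (transList M gs) =
      Submodule.span ℤ (Set.range u) * (genSpan e gs * Submodule.span ℤ {δ}) := by
  rw [genSpan, genSpan, Submodule.span_mul_span, Submodule.span_mul_span]
  congr 1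
  ext x
  simp only [Set.mem_image, Set.mem_ofPred_eq, Set.mem_mul, Set.mem_range, Set.mem_singleton_iff,
    mem_transList]
  constructor
  · rintro ⟨_, ⟨_, ⟨v, hv, j, rfl⟩, rfl⟩, rfl⟩
    refine ⟨u j, ⟨j, rfl⟩, comb e v * δ, ⟨_, ⟨comb e v, ⟨v, hv, rfl⟩, rfl⟩, δ, rfl, rfl⟩, ?_⟩
    rw [← mul_assoc, ← coe_comb_mulVec e e' (hM j) v]
    rfl
  · rintro ⟨_, ⟨j, rfl⟩, _, ⟨_, ⟨_, ⟨v, hv, rfl⟩, rfl⟩, _, rfl, rfl⟩, rfl⟩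
    refine ⟨comb e' ((M j).mulVec v), ⟨_, ⟨v, hv, j, rfl⟩, rfl⟩, ?_⟩
    rw [← mul_assoc, coe_comb_mulVec e e' (hM j) v]
    rfl

theorem span_range_basis {B : Type*} [Ring B] {O : Subring B} (e : Module.Basis (Fin 4) ℤ O) :
    Submodule.span ℤ (Set.range fun i => (e i : B)) = lat O := by
  apply le_antisymm
  · rw [Submodule.span_le]
    rintro _ ⟨i, rfl⟩
    exact (e i).2
  · intro x hx
    have : x = ((∑ i, e.repr ⟨x, hx⟩ i • e i : O) : B) := by rw [e.sum_repr]
    rw [this, coe_sum_smul]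
    refine sum_mem fun i _ => ?_
    rw [← zsmul_eq_mul]
    exact Submodule.smul_mem _ _ (Submodule.subset_span ⟨i, rfl⟩)

theorem span_range_scal {B : Type*} [Ring B] [Algebra ℚ B] {O : Subring B}
    (e : Module.Basis (Fin 4) ℤ O) (q : ℚ) :
    Submodule.span ℤ (Set.range fun i => algebraMap ℚ B q * (e i : B)) = scal B q * lat O := by
  rw [← span_range_basis e, scal, Submodule.span_mul_span]
  congr 1
  ext x
  simp

theorem scal_left_comm {B : Type*} [Ring B] [Algebra ℚ B] (c : ℚ) (M N : Submodule ℤ B) :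
    M * (scal B c * N) = scal B c * (M * N) := by
  rw [← mul_assoc, ← scal_mul_comm, mul_assoc]

theorem span_scal_mul {B : Type*} [Ring B] [Algebra ℚ B] (c : ℚ) (x : B) :
    Submodule.span ℤ {algebraMap ℚ B c * x} = scal B c * Submodule.span ℤ {x} := by
  rw [scal, Submodule.span_mul_span, Set.singleton_mul_singleton]

theorem index_mem {B : Type*} [Ring B] {O : Subring B} {I : Ideal O} {n : ℕ}
    (hI : (Submodule.toAddSubgroup I).index = n) : (n : O) ∈ I := by
  have := AddSubgroup.nsmul_index_mem (Submodule.toAddSubgroup I) (1 : O)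
  rwa [hI, nsmul_eq_mul, mul_one] at this

theorem scal_collect {B : Type*} [Ring B] [Algebra ℚ B] (c n q : ℚ) (L X Y Z : Submodule ℤ B) :
    scal B c * (L * (scal B n * X * Y * (scal B q * Z))) =
      scal B (n * q) * (scal B c * (L * X) * (Y * Z)) := by
  rw [scal_left_comm q, mul_assoc (scal B n), mul_assoc (scal B n), ← mul_assoc (scal B q),
    scal_mul_scal, mul_comm q n, scal_left_comm _ L, scal_left_comm _ (scal B c)]
  simp only [mul_assoc]

/-- Multiplier in the connecting lattice. -/
theorem exists_multiplier {B : Type*} [Ring B] [Algebra ℚ B] {O₁ O₂ : Subring B} {N : ℤ} (hN : N ≠ 0) {J₀ : Ideal O₁} {β : Bˣ} {m : ℕ}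
    (hJ₀ : latIdeal J₀ = scal B N * (lat O₁ * lat O₂) * Submodule.span ℤ {(β : B)})
    (hindex : (Submodule.toAddSubgroup J₀).index = m) :
    ∃ δ : B, δ = algebraMap ℚ B (m / N) * ↑β⁻¹ ∧ δ ∈ lat O₁ * lat O₂ ∧
      ∃ x ∈ J₀, (x : B) * δ = m := by
  have hN' : (N : ℚ) ≠ 0 := by exact_mod_cast hN
  refine ⟨_, rfl, ?_, ?_⟩
  -- The index m lies in J₀ = N O₁O₂ β; dividing by N β places δ in O₁O₂.
  · have hm := coe_mem_latIdeal.mpr (index_mem hindex)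
    rw [hJ₀, Submodule.mem_mul_span_singleton] at hm
    obtain ⟨z, hz, hzm⟩ := hm
    obtain ⟨y, hy, rfl⟩ := mem_scal_mul.mp hz
    convert hy
    rw [Subring.coe_natCast] at hzm
    have hy2 : algebraMap ℚ B N * y = m * ↑β⁻¹ := by rw [← hzm, Units.mul_inv_cancel_right]
    have hy3 : y = algebraMap ℚ B (N : ℚ)⁻¹ * (algebraMap ℚ B N * y) := by
      rw [← mul_assoc, ← map_mul, inv_mul_cancel₀ hN', map_one, one_mul]
    rw [hy3, hy2, ← mul_assoc, ← map_natCast (algebraMap ℚ B), ← map_mul, div_eq_inv_mul]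
  -- The witness is x = N β, which lies in J₀ because 1 lies in O₁O₂.
  · have hx : algebraMap ℚ B N * 1 * β ∈ latIdeal J₀ := by
      rw [hJ₀, Submodule.mem_mul_span_singleton]
      refine ⟨_, mem_scal_mul.mpr ⟨1, ?_, rfl⟩, rfl⟩
      have := Submodule.mul_mem_mul (M := lat O₁) (N := lat O₂) (one_mem O₁) (one_mem O₂)
      rwa [mul_one] at this
    obtain ⟨x, hxJ, hx⟩ := mem_latIdeal.mp hx
    refine ⟨x, hxJ, ?_⟩
    rw [hx, mul_one, mul_assoc, ← mul_assoc (β : B), ← Algebra.commutes, mul_assoc, Units.mul_inv,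
      mul_one, ← map_mul, mul_div_cancel₀ _ hN', map_natCast]

variable {B : Type*} [Ring B] [StarRing B] [Algebra ℚ B] [DefiniteQuaternion B]

variable {O₁ O₂ : Subring B} (e₁ : Module.Basis (Fin 4) ℤ O₁) (e₂ : Module.Basis (Fin 4) ℤ O₂)
  (h₁ : Submodule.span ℚ (O₁ : Set B) = ⊤) (h₂ : Submodule.span ℚ (O₂ : Set B) = ⊤)

include e₁ e₂ h₁ h₂ in
/-- The connecting lattice of two orders, the second being maximal, is invertible. -/
theorem exists_scale (hmax : IsMaximalFG O₂) {D : ℤ} (hD : D ≠ 0)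
    (hDO : ∀ y ∈ O₁, (D : B) * y ∈ O₂) :
    ∃ r : ℕ, 0 < r ∧ (r : ℤ) ∣ D ^ 2 ∧
      scal B r * (lat O₂ * (lat O₁ * lat O₂)) = lat O₂ := by
  have hnt := nontrivial_of_definiteQuaternion (B := B)
  have hDM : ∀ x ∈ lat O₂ * lat O₁, (D : B) * x ∈ O₂ := by
    intro x hx
    induction hx using Submodule.mul_induction_on' with
    | mem_mul_mem m hm n hn =>
      rw [← mul_assoc, (Int.cast_commute D m).eq, mul_assoc]
      exact mul_mem hm (hDO n hn)
    | add x _ y _ hx hy => rw [mul_add]; exact add_mem hx hy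
  have hone : (1 : B) ∈ lat O₂ * lat O₁ := by
    have := Submodule.mul_mem_mul (M := lat O₂) (N := lat O₁) (one_mem O₂) (one_mem O₁)
    rwa [mul_one] at this
  have hint := hasIntegralNorms e₂ h₂
  obtain ⟨c, hc, hcM⟩ := exists_norm_generator hint hD hDM ⟨1, hone, one_ne_zero⟩
  -- For M = O₂O₁ the conjugate is O₁O₂, so M · conj M = O₂O₁O₂. The scale is r = c⁻¹: it is an
  -- integer because 1 in M has norm 1, and it divides D² because D M ⊆ O₂ makes D² c integral.
  have hmul := mul_conj_eq hmax (M := lat O₂ * lat O₁)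
    (by rw [← mul_assoc, lat_mul_self]) ((lat_fg e₂).mul (lat_fg e₁)) hc hcM
  have h1c : (1 : ℚ) ∈ AddSubgroup.zmultiples c :=
    hcM ▸ AddSubgroup.subset_closure ⟨1, hone, nrd_one⟩
  obtain ⟨k, hk⟩ := AddSubgroup.mem_zmultiples_iff.mp h1c
  rw [zsmul_eq_mul] at hk
  have hk0 : 0 < k := by
    have : (0 : ℚ) < k := by
      by_contra hle
      push Not at hle
      nlinarith
    exact_mod_cast this
  have hck : c⁻¹ = k := (eq_inv_of_mul_eq_one_left hk).symm
  have hD2 : ∃ j : ℤ, (D : ℚ) ^ 2 * c = j := by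
    have : ∀ q ∈ AddSubgroup.closure (nrd '' ((lat O₂ * lat O₁ : Submodule ℤ B) : Set B)),
        ∃ j : ℤ, (D : ℚ) ^ 2 * q = j := by
      intro q hq
      induction hq using AddSubgroup.closure_induction with
      | mem q hq =>
        obtain ⟨x, hx, rfl⟩ := hq
        obtain ⟨j, hj⟩ := hint _ (hDM x hx)
        exact ⟨j, by rw [← hj, nrd_mul, nrd_algebraMap_intCast]⟩
      | zero => exact ⟨0, by simp⟩
      | add x y _ _ hx hy =>
        obtain ⟨i, hi⟩ := hx
        obtain ⟨j, hj⟩ := hy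
        exact ⟨i + j, by rw [mul_add, hi, hj]; push_cast; rfl⟩
      | neg x _ hx =>
        obtain ⟨i, hi⟩ := hx
        exact ⟨-i, by rw [mul_neg, hi]; push_cast; rfl⟩
    exact this c (hcM ▸ AddSubgroup.mem_zmultiples c)
  obtain ⟨j, hj⟩ := hD2
  obtain ⟨r, rfl⟩ := Int.eq_ofNat_of_zero_le hk0.le
  refine ⟨r, by exact_mod_cast hk0, ⟨j, ?_⟩, ?_⟩
  · have : (D : ℚ) ^ 2 = r * j := by
      rw [← hj]
      have : (r : ℚ) = c⁻¹ := by rw [hck]; rfl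
      rw [this]
      field_simp
    exact_mod_cast this
  · rw [hck, conj_mul, conj_lat e₁ h₁, conj_lat e₂ h₂] at hmul
    rw [mul_assoc (lat O₂), ← mul_assoc (lat O₁) (lat O₁), lat_mul_self] at hmul
    exact hmul

include e₂ h₂ in
/-- The left `O₂`-ideal obtained from the reduced left `O₁`-ideal is equivalent to the given
one and its index is an even power of the prime. -/
theorem transfer (hmax : IsMaximalFG O₂) {r N : ℤ} (hN : N ≠ 0)
    (hr : scal B r * (lat O₂ * (lat O₁ * lat O₂)) = lat O₂)
    {J₀ : Ideal O₁} {β : Bˣ} {ℓ k : ℕ} (hℓ : ℓ.Prime)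
    (hJ₀ : latIdeal J₀ = scal B N * (lat O₁ * lat O₂) * Submodule.span ℤ {(β : B)})
    {δ : B} (hδ : δ = algebraMap ℚ B ((ℓ ^ k : ℕ) / N) * ↑β⁻¹)
    {I : Ideal O₂} {J : Ideal O₁} {γ : Bˣ} {m : ℕ}
    (hJ : latIdeal J = scal B N * (lat O₁ * latIdeal I) * Submodule.span ℤ {(γ : B)})
    (hJi : (Submodule.toAddSubgroup J).index = ℓ ^ m)
    {I' : Ideal O₂}
    (hI' : latIdeal I' = scal B r * (lat O₂ * (latIdeal J * Submodule.span ℤ {δ}))) :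
    (∃ η : Bˣ, latIdeal I' = latIdeal I * Submodule.span ℤ {(η : B)}) ∧
      ∃ t : ℕ, (Submodule.toAddSubgroup I').index = ℓ ^ (t + t) := by
  have hN' : (N : ℚ) ≠ 0 := by exact_mod_cast hN
  have hℓk : ((ℓ ^ k : ℕ) : ℚ) ≠ 0 := by exact_mod_cast pow_ne_zero k hℓ.ne_zero
  -- Passing to O₁ and back is the identity on left O₂-lattices: write i = O₂ i and use r O₂O₁O₂ =
  -- O₂.
  have hcol : ∀ i : Submodule ℤ B, lat O₂ * i = i →
      scal B r * (lat O₂ * (lat O₁ * i)) = i := by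
    intro i hi
    conv_rhs => rw [← hi, ← hr]
    rw [mul_assoc, mul_assoc, mul_assoc, hi]
  constructor
  · refine ⟨Units.map (algebraMap ℚ B).toMonoidHom (Units.mk0 _ hℓk) * (γ * β⁻¹), ?_⟩
    have hη : ((Units.map (algebraMap ℚ B).toMonoidHom (Units.mk0 _ hℓk) * (γ * β⁻¹) : Bˣ) : B)
      = algebraMap ℚ B (ℓ ^ k : ℕ) * (γ * ↑β⁻¹) := rfl
    rw [hη, hI', hJ, hδ, span_scal_mul, span_scal_mul, scal_collect, mul_div_cancel₀ _ hN',
      hcol _ (lat_mul_latIdeal I), ← Set.singleton_mul_singleton, ← Submodule.span_mul_span,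
      scal_left_comm]
  · refine exists_index_eq_pow e₂ h₂ hmax (r := m + k) hℓ ?_
    rw [← coe_mem_latIdeal, Subring.coe_natCast, hI']
    -- As J₀ ⊆ O₁ and ℓ^m lies in J, the left ideal J contains ℓ^m J₀. Since J₀ δ is ℓ^k O₁O₂, the
    -- lattice I' contains ℓ^(m+k) O₂.
    have hle : scal B (ℓ ^ m : ℕ) * latIdeal J₀ ≤ latIdeal J := by
      refine (mul_le_mul' le_rfl (latIdeal_le J₀)).trans ?_
      rw [← lat_mul_latIdeal J, scal_mul_comm]
      refine mul_le_mul' le_rfl (Submodule.span_le.mpr ?_)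
      rintro _ rfl
      rw [map_natCast]
      exact coe_mem_latIdeal.mpr (index_mem hJi)
    have hle2 : scal B r * (lat O₂ * (scal B (ℓ ^ m : ℕ) * latIdeal J₀ * Submodule.span ℤ {δ})) ≤
        scal B r * (lat O₂ * (latIdeal J * Submodule.span ℤ {δ})) :=
      mul_le_mul' le_rfl (mul_le_mul' le_rfl (mul_le_mul' hle le_rfl))
    refine hle2 ?_
    have heq : scal B r * (lat O₂ * (scal B (ℓ ^ m : ℕ) * latIdeal J₀ * Submodule.span ℤ {δ})) =
        scal B (ℓ ^ (m + k) : ℕ) * lat O₂ := by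
      have hββ : Submodule.span ℤ {(β : B)} * Submodule.span ℤ {((β⁻¹ : Bˣ) : B)} = 1 := by
        rw [Submodule.span_mul_span, Set.singleton_mul_singleton, Units.mul_inv,
          Submodule.one_eq_span]
      rw [hJ₀, hδ, span_scal_mul, mul_assoc (scal B (ℓ ^ m : ℕ)), scal_left_comm _ (lat O₂),
        scal_left_comm _ (scal B (r : ℚ)), scal_collect, hββ, mul_one, mul_div_cancel₀ _ hN',
        hcol _ (lat_mul_self O₂), ← mul_assoc, scal_mul_scal, pow_add, Nat.cast_mul]
    rw [heq]
    exact mem_scal_mul.mpr ⟨1, one_mem O₂, by rw [mul_one, map_natCast]⟩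

end Connecting

/-! ### The algebra with negative constants is definite. -/

section Concrete

/-- A nonnegative constant has a real square root, and (√a − i)(√a + i) = 0 gives zero divisors;
likewise for b and j. -/
theorem neg_of_ramifiedOver_real {a b : ℤ} (h : RamifiedOver ℝ a b) : a < 0 ∧ b < 0 := by
  constructor
  · by_contra! ha
    let x : QuaternionAlgebra ℝ (a : ℝ) 0 (b : ℝ) := ⟨√(a : ℝ), -1, 0, 0⟩
    let y : QuaternionAlgebra ℝ (a : ℝ) 0 (b : ℝ) := ⟨√(a : ℝ), 1, 0, 0⟩
    have hs : √(a : ℝ) * √(a : ℝ) = a := Real.mul_self_sqrt (by exact_mod_cast ha)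
    have hx : x ≠ 0 := fun h0 => by simpa [x] using congrArg QuaternionAlgebra.imI h0
    have hy : y ≠ 0 := fun h0 => by simpa [y] using congrArg QuaternionAlgebra.imI h0
    have hxy : x * y = 0 := by
      ext <;> simp [x, y, hs]
    exact hy ((h x hx).mul_right_eq_zero.mp hxy)
  · by_contra! hb
    let x : QuaternionAlgebra ℝ (a : ℝ) 0 (b : ℝ) := ⟨√(b : ℝ), 0, -1, 0⟩
    let y : QuaternionAlgebra ℝ (a : ℝ) 0 (b : ℝ) := ⟨√(b : ℝ), 0, 1, 0⟩
    have hs : √(b : ℝ) * √(b : ℝ) = b := Real.mul_self_sqrt (by exact_mod_cast hb)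
    have hx : x ≠ 0 := fun h0 => by simpa [x] using congrArg QuaternionAlgebra.imJ h0
    have hy : y ≠ 0 := fun h0 => by simpa [y] using congrArg QuaternionAlgebra.imJ h0
    have hxy : x * y = 0 := by
      ext <;> simp [x, y, hs]
    exact hy ((h x hx).mul_right_eq_zero.mp hxy)

/-- The reduced norm in coordinates. -/
def normForm {a b : ℤ} (x : Quat a b) : ℚ :=
  x.re ^ 2 - a * x.imI ^ 2 - b * x.imJ ^ 2 + a * b * x.imK ^ 2

theorem det_mulRight_quat {a b : ℤ} (x : Quat a b) :
    LinearMap.det (LinearMap.mulRight ℚ x) = normForm x ^ 2 := by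
  have hM : LinearMap.toMatrix (QuaternionAlgebra.basisOneIJK (a : ℚ) 0 (b : ℚ))
      (QuaternionAlgebra.basisOneIJK (a : ℚ) 0 (b : ℚ)) (LinearMap.mulRight ℚ x) =
      !![x.re, a * x.imI, b * x.imJ, -(a * b * x.imK);
        x.imI, x.re, -(b * x.imK), b * x.imJ;
        x.imJ, a * x.imK, x.re, -(a * x.imI);
        x.imK, x.imJ, -x.imI, x.re] := by
    have hb : ∀ j, QuaternionAlgebra.basisOneIJK (a : ℚ) 0 (b : ℚ) j =
        (QuaternionAlgebra.equivTuple (a : ℚ) 0 (b : ℚ)).symm (Pi.single j 1) := by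
      intro j
      apply (QuaternionAlgebra.basisOneIJK (a : ℚ) 0 (b : ℚ)).repr.injective
      ext i
      rw [Module.Basis.repr_self, QuaternionAlgebra.coe_basisOneIJK_repr]
      fin_cases j <;> fin_cases i <;> simp
    ext i j
    rw [LinearMap.toMatrix_apply, QuaternionAlgebra.coe_basisOneIJK_repr, hb,
      LinearMap.mulRight_apply]
    fin_cases j <;> fin_cases i <;> simp
  rw [← LinearMap.det_toMatrix (QuaternionAlgebra.basisOneIJK (a : ℚ) 0 (b : ℚ)), hM, normForm]
  simp [Matrix.det_succ_row_zero, Fin.sum_univ_succ, Fin.succAbove]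
  ring

/-- A quaternion algebra with negative constants is definite. -/
abbrev definiteQuaternion {a b : ℤ} (ha : a < 0) (hb : b < 0) : DefiniteQuaternion (Quat a b) where
  nrd := normForm
  mul_star_self x := by
    rw [QuaternionAlgebra.algebraMap_eq, normForm]
    ext <;> simp <;> ring
  nrd_pos x hx := by
    have ha' : (a : ℚ) < 0 := by exact_mod_cast ha
    have hb' : (b : ℚ) < 0 := by exact_mod_cast hb
    have hab := mul_pos_of_neg_of_neg ha' hb'
    by_contra! hle
    rw [normForm] at hle
    have h1 := sq_nonneg x.re
    have h2 := mul_nonneg (neg_pos.mpr ha').le (sq_nonneg x.imI)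
    have h3 := mul_nonneg (neg_pos.mpr hb').le (sq_nonneg x.imJ)
    have h4 := mul_nonneg hab.le (sq_nonneg x.imK)
    apply hx
    ext
    · exact pow_eq_zero_iff two_ne_zero |>.mp (by linarith)
    · have : -(a : ℚ) * x.imI ^ 2 = 0 := by linarith
      simpa [ha'.ne] using this
    · have : -(b : ℚ) * x.imJ ^ 2 = 0 := by linarith
      simpa [hb'.ne] using this
    · have : (a : ℚ) * b * x.imK ^ 2 = 0 := by linarith
      simpa [ha'.ne, hb'.ne] using this
  det_mulRight := det_mulRight_quat
  finrank_eq := QuaternionAlgebra.finrank_eq_four _ _ _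

end Concrete

/-! ### Sizes of rational numbers -/

section Sizes

theorem one_le_intSize (z : ℤ) : 1 ≤ intSize z := Nat.le_add_left _ _

theorem nat_size_mul_le (m n : ℕ) : (m * n).size ≤ m.size + n.size := by
  rw [Nat.size_le, pow_add]
  exact Nat.mul_lt_mul'' (Nat.lt_size_self m) (Nat.lt_size_self n)

theorem nat_size_add_le (m n : ℕ) : (m + n).size ≤ max m.size n.size + 1 := by
  rw [Nat.size_le, pow_succ]
  have h1 : m < 2 ^ max m.size n.size :=
    (Nat.lt_size_self m).trans_le (Nat.pow_le_pow_right two_pos (le_max_left _ _))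
  have h2 : n < 2 ^ max m.size n.size :=
    (Nat.lt_size_self n).trans_le (Nat.pow_le_pow_right two_pos (le_max_right _ _))
  omega

theorem intSize_mul_le (x y : ℤ) : intSize (x * y) ≤ intSize x + intSize y := by
  have := nat_size_mul_le x.natAbs y.natAbs
  rw [intSize, intSize, intSize, Int.natAbs_mul]
  omega

theorem intSize_add_le (x y : ℤ) : intSize (x + y) ≤ intSize x + intSize y := by
  have h := nat_size_add_le x.natAbs y.natAbs
  have h2 := Nat.size_le_size (Int.natAbs_add_le x y)
  rw [intSize, intSize, intSize]
  omega

theorem intSize_natCast (n : ℕ) : intSize n = n.size + 1 := rfl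

theorem intSize_le_of_abs_le {x y : ℤ} (h : |x| ≤ |y|) : intSize x ≤ intSize y := by
  have : x.natAbs ≤ y.natAbs := by
    rw [Int.abs_eq_natAbs, Int.abs_eq_natAbs] at h
    exact_mod_cast h
  exact Nat.add_le_add_right (Nat.size_le_size this) 1

theorem intSize_num_le (q : ℚ) : intSize q.num ≤ ratSize q := Nat.le_add_right _ _

theorem size_den_le (q : ℚ) : q.den.size ≤ ratSize q := Nat.le_add_left _ _

theorem one_le_ratSize (q : ℚ) : 1 ≤ ratSize q := (one_le_intSize _).trans (intSize_num_le q)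

theorem ratSize_intCast (z : ℤ) : ratSize z = intSize z + 1 := by
  rw [ratSize, Rat.num_intCast, Rat.den_intCast, Nat.size_one]

/-- Numerator and denominator in lowest terms divide those of any representing fraction, so sizes
may be estimated on unreduced fractions. -/
theorem ratSize_le_of_eq_div {q : ℚ} {n : ℤ} {d : ℕ} (hd : d ≠ 0) (h : q = n / d) :
    ratSize q ≤ intSize n + d.size := by
  have hnum : q.num.natAbs ≤ n.natAbs := by
    by_cases hn : n = 0
    · subst hn; simp [h]
    refine Nat.le_of_dvd (Int.natAbs_pos.mpr hn) (Int.natAbs_dvd_natAbs.mpr ?_)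
    rw [h]
    exact_mod_cast Rat.num_dvd n (by exact_mod_cast hd : (d : ℤ) ≠ 0)
  have hden : q.den ≤ d := by
    refine Nat.le_of_dvd (Nat.pos_of_ne_zero hd) ?_
    rw [h]
    have := Rat.den_dvd n d
    exact_mod_cast this
  have h1 := Nat.size_le_size hnum
  have h2 := Nat.size_le_size hden
  rw [ratSize, intSize, intSize]
  omega

theorem ratSize_mul_le (x y : ℚ) : ratSize (x * y) ≤ ratSize x + ratSize y := by
  have h := ratSize_le_of_eq_div (q := x * y) (n := x.num * y.num) (d := x.den * y.den)
    (mul_ne_zero x.den_nz y.den_nz) (by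
      push_cast
      rw [← div_mul_div_comm, Rat.num_div_den, Rat.num_div_den])
  have h1 := intSize_mul_le x.num y.num
  have h2 := nat_size_mul_le x.den y.den
  simp only [ratSize] at h ⊢
  omega

theorem ratSize_add_le (x y : ℚ) : ratSize (x + y) ≤ 3 * (ratSize x + ratSize y) := by
  have h := ratSize_le_of_eq_div (q := x + y) (n := x.num * y.den + y.num * x.den)
    (d := x.den * y.den) (mul_ne_zero x.den_nz y.den_nz) (by
      have hx : (x.den : ℚ) ≠ 0 := by exact_mod_cast x.den_nz
      have hy : (y.den : ℚ) ≠ 0 := by exact_mod_cast y.den_nz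
      conv_lhs => rw [← Rat.num_div_den x, ← Rat.num_div_den y]
      push_cast
      field_simp)
  have h1 := intSize_add_le (x.num * y.den) (y.num * x.den)
  have h2 := intSize_mul_le x.num y.den
  have h3 := intSize_mul_le y.num x.den
  have h4 := nat_size_mul_le x.den y.den
  have h5 := one_le_intSize x.num
  have h6 := one_le_intSize y.num
  rw [intSize_natCast] at h2 h3
  simp only [ratSize] at h ⊢
  omega

theorem ratSize_neg (x : ℚ) : ratSize (-x) = ratSize x := by
  rw [ratSize, ratSize, intSize, intSize, Rat.num_neg_eq_neg_num, Int.natAbs_neg,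
    Rat.den_neg_eq_den]

theorem ratSize_sub_le (x y : ℚ) : ratSize (x - y) ≤ 3 * (ratSize x + ratSize y) := by
  rw [sub_eq_add_neg, ← ratSize_neg y]
  exact ratSize_add_le x (-y)

theorem ratSize_inv_le (x : ℚ) : ratSize x⁻¹ ≤ ratSize x + 1 := by
  by_cases hx : x = 0
  · subst hx; simp
  have hn : x.num.natAbs ≠ 0 := Int.natAbs_ne_zero.mpr (Rat.num_ne_zero.mpr hx)
  have h := ratSize_le_of_eq_div (q := x⁻¹) (n := x.num.sign * x.den) (d := x.num.natAbs) hn (by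
      conv_lhs => rw [← Rat.num_div_den x]
      rw [inv_div]
      have hs : (x.num.natAbs : ℚ) = x.num.sign * x.num := by
        rw [← Int.cast_natCast, ← Int.cast_mul, Int.natCast_natAbs, Int.sign_mul_self_eq_abs]
      rw [hs]
      push_cast
      have hsg : ((x.num.sign : ℤ) : ℚ) ≠ 0 := by
        rw [Int.cast_ne_zero, Ne, Int.sign_eq_zero_iff_zero]
        exact Rat.num_ne_zero.mpr hx
      rw [mul_div_mul_left _ _ hsg])
  have h2 : intSize (x.num.sign * x.den) ≤ x.den.size + 1 := by
    refine (intSize_le_of_abs_le (y := x.den) ?_).trans (intSize_natCast _).le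
    rw [abs_mul, Int.abs_sign_of_ne_zero (Rat.num_ne_zero.mpr hx), one_mul]
  have h3 : ratSize x = x.num.natAbs.size + 1 + x.den.size := rfl
  omega

/-- Each addition at most triples the sum of the two sizes, so the bound is exponential in the
number of terms. This is harmless: it is used only for 4 terms and for the 24 terms of a 4 × 4
determinant. -/
theorem ratSize_sum_le {ι : Type*} (s : Finset ι) (f : ι → ℚ) {K : ℕ}
    (h : ∀ i ∈ s, ratSize (f i) ≤ K) : ratSize (∑ i ∈ s, f i) ≤ 6 ^ s.card * (K + 2) := by
  induction s using Finset.cons_induction with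
  | empty =>
    rw [Finset.sum_empty, Finset.card_empty, pow_zero, one_mul]
    have : ratSize 0 = 2 := by decide
    omega
  | cons i s hi ih =>
    rw [Finset.sum_cons, Finset.card_cons]
    have h1 := ratSize_add_le (f i) (∑ i ∈ s, f i)
    have h2 := ih fun j hj => h j (Finset.mem_cons_of_mem hj)
    have h3 := h i (Finset.mem_cons_self _ _)
    have h4 : 1 * (K + 2) ≤ 6 ^ s.card * (K + 2) :=
      Nat.mul_le_mul_right _ (Nat.one_le_pow _ _ (by norm_num))
    rw [pow_succ]
    linarith

theorem ratSize_prod_le {ι : Type*} (s : Finset ι) (f : ι → ℚ) {K : ℕ}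
    (h : ∀ i ∈ s, ratSize (f i) ≤ K) : ratSize (∏ i ∈ s, f i) ≤ s.card * K + 3 := by
  induction s using Finset.cons_induction with
  | empty =>
    rw [Finset.prod_empty]
    have : ratSize 1 = 3 := by decide
    omega
  | cons i s hi ih =>
    rw [Finset.prod_cons, Finset.card_cons]
    have h1 := ratSize_mul_le (f i) (∏ i ∈ s, f i)
    have h2 := ih fun j hj => h j (Finset.mem_cons_of_mem hj)
    have h3 := h i (Finset.mem_cons_self _ _)
    linarith

theorem ratSize_det_le {M : Matrix (Fin 4) (Fin 4) ℚ} {K : ℕ} (h : ∀ i j, ratSize (M i j) ≤ K) :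
    ratSize M.det ≤ 6 ^ 24 * (4 * K + 8) := by
  rw [Matrix.det_apply]
  refine (ratSize_sum_le _ _ (K := 4 * K + 6) fun σ _ => ?_).trans_eq ?_
  · have hp := ratSize_prod_le Finset.univ (fun i => M (σ i) i) (K := K) fun i _ => h _ _
    rw [Finset.card_fin] at hp
    rcases Int.units_eq_one_or (Equiv.Perm.sign σ) with hs | hs <;> rw [hs]
    · rw [one_smul]; omega
    · rw [Units.neg_smul, one_smul, ratSize_neg]; omega
  · rw [Finset.card_univ, Fintype.card_perm, Fintype.card_fin]
    rfl

theorem ratSize_inv_matrix_le {M : Matrix (Fin 4) (Fin 4) ℚ} {K : ℕ}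
    (h : ∀ i j, ratSize (M i j) ≤ K) (i j : Fin 4) :
    ratSize (M⁻¹ i j) ≤ 6 ^ 24 * (8 * K + 40) := by
  rw [Matrix.inv_def, Matrix.smul_apply, Ring.inverse_eq_inv', smul_eq_mul,
    Matrix.adjugate_apply]
  have h1 := ratSize_mul_le M.det⁻¹ (M.updateRow j (Pi.single i 1)).det
  have h2 := ratSize_inv_le M.det
  have h3 := ratSize_det_le h
  have h4 : ratSize (M.updateRow j (Pi.single i 1)).det ≤ 6 ^ 24 * (4 * (K + 3) + 8) := by
    refine ratSize_det_le fun i' j' => ?_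
    rw [Matrix.updateRow_apply]
    split_ifs
    · rw [Pi.single_apply]
      split_ifs
      · have : ratSize 1 = 3 := by decide
        omega
      · have : ratSize 0 = 2 := by decide
        omega
    · have := h i' j'
      omega
  omega

end Sizes

/-! ### Bit lengths of products, norms and coordinates in an order. -/

section CoordinateSizes

open DefiniteQuaternion

variable {a b : ℤ}

/-- The coordinates in the basis `1, i, j, k`. -/
def coord (x : Quat a b) : Fin 4 → ℚ := QuaternionAlgebra.equivTuple _ _ _ x

theorem ratSize_coord_le (x : Quat a b) (i : Fin 4) : ratSize (coord x i) ≤ quatSize x := by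
  rw [quatSize]
  fin_cases i <;> simp [coord] <;> omega

theorem quatSize_le {x : Quat a b} {K : ℕ} (h : ∀ i, ratSize (coord x i) ≤ K) :
    quatSize x ≤ 4 * K := by
  have h0 : ratSize x.re ≤ K := h 0
  have h1 : ratSize x.imI ≤ K := h 1
  have h2 : ratSize x.imJ ≤ K := h 2
  have h3 : ratSize x.imK ≤ K := h 3
  rw [quatSize]
  omega

theorem quatSize_mul_le (x y : Quat a b) :
    quatSize (x * y) ≤ 2000 * (quatSize x + quatSize y + intSize a + intSize b) := by
  have ha := one_le_intSize a
  have hb := one_le_intSize b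
  have hA := ratSize_intCast a
  have hB := ratSize_intCast b
  have key : ∀ p q r t : ℚ, ratSize (p + q + r - t) ≤
      27 * (ratSize p + ratSize q + ratSize r + ratSize t) := by
    intro p q r t
    have h1 := ratSize_sub_le (p + q + r) t
    have h2 := ratSize_add_le (p + q) r
    have h3 := ratSize_add_le p q
    omega
  have hm : ∀ c x y : ℚ, ratSize (c * x * y) ≤ ratSize c + ratSize x + ratSize y := by
    intro c x y
    have h1 := ratSize_mul_le (c * x) y
    have h2 := ratSize_mul_le c x
    omega
  have hab := ratSize_mul_le a b
  have r1 := ratSize_mul_le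
  have hre : (x * y).re = x.re * y.re + a * x.imI * y.imI + b * x.imJ * y.imJ -
      a * b * x.imK * y.imK := by simp
  have hi : (x * y).imI = x.re * y.imI + x.imI * y.re + b * x.imK * y.imJ -
      b * x.imJ * y.imK := by simp; ring
  have hj : (x * y).imJ = x.re * y.imJ + x.imJ * y.re + a * x.imI * y.imK -
      a * x.imK * y.imI := by simp; ring
  have hk : (x * y).imK = x.re * y.imK + x.imK * y.re + x.imI * y.imJ -
      x.imJ * y.imI := by simp; ring
  have k0 := key (x.re * y.re) (a * x.imI * y.imI) (b * x.imJ * y.imJ) (a * b * x.imK * y.imK)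
  have k1 := key (x.re * y.imI) (x.imI * y.re) (b * x.imK * y.imJ) (b * x.imJ * y.imK)
  have k2 := key (x.re * y.imJ) (x.imJ * y.re) (a * x.imI * y.imK) (a * x.imK * y.imI)
  have k3 := key (x.re * y.imK) (x.imK * y.re) (x.imI * y.imJ) (x.imJ * y.imI)
  have m1 := r1 x.re y.re
  have m2 := hm a x.imI y.imI
  have m3 := hm b x.imJ y.imJ
  have m4 := hm (a * b) x.imK y.imK
  have m5 := r1 x.re y.imI
  have m6 := r1 x.imI y.re
  have m7 := hm b x.imK y.imJ
  have m8 := hm b x.imJ y.imK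
  have m9 := r1 x.re y.imJ
  have m10 := r1 x.imJ y.re
  have m11 := hm a x.imI y.imK
  have m12 := hm a x.imK y.imI
  have m13 := r1 x.re y.imK
  have m14 := r1 x.imK y.re
  have m15 := r1 x.imI y.imJ
  have m16 := r1 x.imJ y.imI
  rw [quatSize, hre, hi, hj, hk, quatSize, quatSize]
  omega

theorem quatSize_algebraMap (q : ℚ) : quatSize (algebraMap ℚ (Quat a b) q) = ratSize q + 6 := by
  rw [QuaternionAlgebra.algebraMap_eq, quatSize]
  have : ratSize 0 = 2 := by decide
  simp only [this]

theorem ratSize_normForm_le (x : Quat a b) :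
    ratSize (normForm x) ≤ 2000 * (quatSize x + intSize a + intSize b) := by
  have ha := one_le_intSize a
  have hb := one_le_intSize b
  have hA := ratSize_intCast a
  have hB := ratSize_intCast b
  have hab := ratSize_mul_le a b
  have hm : ∀ c x : ℚ, ratSize (c * x ^ 2) ≤ ratSize c + 2 * ratSize x := by
    intro c x
    have h1 := ratSize_mul_le c (x ^ 2)
    have h2 := ratSize_mul_le x x
    rw [← sq] at h2
    omega
  have h1 := ratSize_add_le (x.re ^ 2 - a * x.imI ^ 2 - b * x.imJ ^ 2) (a * b * x.imK ^ 2)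
  have h2 := ratSize_sub_le (x.re ^ 2 - a * x.imI ^ 2) (b * x.imJ ^ 2)
  have h3 := ratSize_sub_le (x.re ^ 2) (a * x.imI ^ 2)
  have h4 := ratSize_mul_le x.re x.re
  rw [← sq] at h4
  have h5 := hm a x.imI
  have h6 := hm b x.imJ
  have h7 := hm (a * b) x.imK
  rw [normForm, quatSize]
  omega

theorem intCast_mul_eq_smul {B : Type*} [Ring B] [Algebra ℚ B] (k : ℤ) (x : B) :
    (k : B) * x = (k : ℚ) • x := by
  rw [Algebra.smul_def, algebraMap_intCast_eq]

theorem coord_comb {O : Subring (Quat a b)} (e : Module.Basis (Fin 4) ℤ O) (v : Fin 4 → ℤ)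
    (i : Fin 4) : coord (comb e v : Quat a b) i = ∑ j, (v j : ℚ) * coord (e j : Quat a b) i := by
  rw [coe_comb]
  have h := congrFun (map_sum (QuaternionAlgebra.linearEquivTuple (a : ℚ) 0 (b : ℚ))
    (fun j => (v j : Quat a b) * (e j : Quat a b)) Finset.univ) i
  rw [Finset.sum_apply] at h
  refine h.trans (Finset.sum_congr rfl fun j _ => ?_)
  rw [intCast_mul_eq_smul]
  exact congrFun (map_smul (QuaternionAlgebra.linearEquivTuple (a : ℚ) 0 (b : ℚ)) _ _) i

variable [DefiniteQuaternion (Quat a b)]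

theorem nrd_eq_normForm (x : Quat a b) : nrd x = normForm x := by
  have h := mul_star_self x
  have hx : x * star x = algebraMap ℚ (Quat a b) (normForm x) := by
    rw [QuaternionAlgebra.algebraMap_eq, normForm]
    ext <;> simp <;> ring
  rw [hx] at h
  exact ((algebraMap ℚ (Quat a b)).injective h).symm

variable {O : Subring (Quat a b)} (e : Module.Basis (Fin 4) ℤ O)
  (h : Submodule.span ℚ (O : Set (Quat a b)) = ⊤)

omit [DefiniteQuaternion (Quat a b)] in
theorem quatSize_le_orderSize (i : Fin 4) : quatSize (e i : Quat a b) ≤ orderSize e :=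
  Finset.single_le_sum (f := fun i => quatSize (e i : Quat a b)) (fun _ _ => Nat.zero_le _)
    (Finset.mem_univ i)

omit [DefiniteQuaternion (Quat a b)] in
theorem one_le_quatSize (x : Quat a b) : 1 ≤ quatSize x := by
  have := one_le_ratSize x.re
  rw [quatSize]
  omega

omit [DefiniteQuaternion (Quat a b)] in
theorem one_le_orderSize : 1 ≤ orderSize e :=
  (one_le_quatSize _).trans (quatSize_le_orderSize e 0)

/-- Change of basis from 1, i, j, k to e: the inverse of a 4 × 4 matrix is bounded by Cramer's rule.
-/
theorem ratSize_repr_le (x : Quat a b) (i : Fin 4) :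
    ratSize ((ratBasis e h).repr x i) ≤ 10 ^ 25 * (orderSize e + quatSize x) := by
  let bs := QuaternionAlgebra.basisOneIJK (a : ℚ) 0 (b : ℚ)
  have hinv : (bs.toMatrix (ratBasis e h))⁻¹ = (ratBasis e h).toMatrix bs :=
    Matrix.inv_eq_left_inv (Module.Basis.toMatrix_mul_toMatrix_flip _ _)
  have hE : ∀ i j, ratSize (bs.toMatrix (ratBasis e h) i j) ≤ orderSize e := by
    intro i j
    rw [Module.Basis.toMatrix_apply, QuaternionAlgebra.coe_basisOneIJK_repr, ratBasis_apply]
    exact (ratSize_coord_le _ i).trans (quatSize_le_orderSize e j)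
  have hx : (ratBasis e h).repr x i =
      ∑ j, ((bs.toMatrix (ratBasis e h))⁻¹ i j) * coord x j := by
    rw [hinv]
    exact (congrFun (Module.Basis.toMatrix_mulVec_repr bs (ratBasis e h) x) i).symm
  rw [hx]
  refine (ratSize_sum_le _ _ (K := 6 ^ 24 * (8 * orderSize e + 40) + quatSize x)
    fun j _ => ?_).trans ?_
  · exact (ratSize_mul_le _ _).trans
      (add_le_add (ratSize_inv_matrix_le hE i j) (ratSize_coord_le x j))
  · have := one_le_orderSize e
    rw [Finset.card_fin]
    omega

/-- A common denominator. -/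
theorem exists_common_denominator (q : Fin 4 → Fin 4 → ℚ) {K : ℕ}
    (hK : ∀ i j, ratSize (q i j) ≤ K) :
    ∃ N : ℤ, N ≠ 0 ∧ (∀ i j, ∃ z : ℤ, N * q i j = z) ∧ intSize N ≤ 16 * K + 35 := by
  -- The product of all sixteen denominators is a sufficient common denominator; 16 K + 35 is 16 (K
  -- + 2) + 3 from `ratSize_prod_le`.
  refine ⟨((∏ p : Fin 4 × Fin 4, (q p.1 p.2).den : ℕ) : ℤ), ?_, ?_, ?_⟩
  · exact_mod_cast Finset.prod_ne_zero_iff.mpr fun (p : Fin 4 × Fin 4) _ => (q p.1 p.2).den_nz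
  · intro i j
    obtain ⟨d, hd⟩ := Finset.dvd_prod_of_mem (fun p : Fin 4 × Fin 4 => (q p.1 p.2).den)
      (Finset.mem_univ (i, j))
    refine ⟨d * (q i j).num, ?_⟩
    rw [hd]
    push_cast
    rw [mul_comm ((q i j).den : ℚ), mul_assoc, Rat.den_mul_eq_num]
  · refine (Nat.le_add_right _ 1).trans ((ratSize_intCast _).symm.le.trans ?_)
    have h1 := ratSize_prod_le Finset.univ
      (fun p : Fin 4 × Fin 4 => (((q p.1 p.2).den : ℤ) : ℚ)) (K := K + 2) (by
        intro p _
        rw [ratSize_intCast, intSize_natCast]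
        have h1 := size_den_le (q p.1 p.2)
        have h2 := hK p.1 p.2
        omega)
    rw [Finset.card_univ, Fintype.card_prod, Fintype.card_fin] at h1
    push_cast at h1 ⊢
    omega

theorem mem_of_combination {B : Type*} [Ring B] {O O' : Subring B}
    (e : Module.Basis (Fin 4) ℤ O) {u δ : B} (hu : ∀ i, u * e i * δ ∈ O') {y : B} (hy : y ∈ O) :
    u * y * δ ∈ O' := by
  have hy' : y = ((∑ i, e.repr ⟨y, hy⟩ i • e i : O) : B) := by rw [e.sum_repr]
  rw [hy', coe_sum_smul, Finset.mul_sum, Finset.sum_mul]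
  refine sum_mem fun i _ => ?_
  rw [← mul_assoc, ← (Int.cast_commute _ u).eq, mul_assoc, mul_assoc]
  refine mul_mem (intCast_mem O' _) ?_
  rw [← mul_assoc]
  exact hu i

/-- An integer that moves one order into another, of bounded size. -/
theorem exists_conductor {O O' : Subring (Quat a b)} (e : Module.Basis (Fin 4) ℤ O)
    (e' : Module.Basis (Fin 4) ℤ O') (h : Submodule.span ℚ (O : Set (Quat a b)) = ⊤) :
    ∃ N : ℤ, N ≠ 0 ∧ (∀ y ∈ O', (N : Quat a b) * y ∈ O) ∧
      intSize N ≤ 10 ^ 27 * (orderSize e + orderSize e') := by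
  obtain ⟨N, hN, hz, hs⟩ := exists_common_denominator
    (fun i j => (ratBasis e h).repr (e' i : Quat a b) j)
    (K := 10 ^ 25 * (orderSize e + orderSize e')) fun i j =>
      (ratSize_repr_le e h _ j).trans
        (Nat.mul_le_mul_left _ (Nat.add_le_add_left (quatSize_le_orderSize e' i) _))
  refine ⟨N, hN, fun y hy => ?_, ?_⟩
  · have := mem_of_combination e' (O' := O) (u := N) (δ := 1) (fun i => ?_) hy
    · rwa [mul_one] at this
    choose z hz using hz i
    refine mem_of_ratBasis_repr e h z fun j => ?_
    rw [mul_one, intCast_mul_eq_smul, map_smul, Finsupp.smul_apply, smul_eq_mul, hz]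
  · have := one_le_orderSize e
    omega

include h in
/-- The coordinate matrices of left and right multiplications, with bounded entries. -/
theorem exists_matrices {O' : Subring (Quat a b)} (e' : Module.Basis (Fin 4) ℤ O')
    {u : Fin 4 → Quat a b} {δ : Quat a b} (hu : ∀ j k, u j * (e' k : Quat a b) * δ ∈ O) {K : ℕ}
    (hK : ∀ j k, quatSize (u j * (e' k : Quat a b) * δ) ≤ K) :
    ∃ M : Fin 4 → Matrix (Fin 4) (Fin 4) ℤ,
      (∀ j k, (comb e (fun i => M j i k) : Quat a b) = u j * (e' k : Quat a b) * δ) ∧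
      ∀ j i k, intSize (M j i k) ≤ 10 ^ 25 * (orderSize e + K) := by
  refine ⟨fun j i k => e.repr ⟨_, hu j k⟩ i, fun j k => ?_, fun j i k => ?_⟩
  · rw [comb, e.sum_repr]
  · have h1 := ratBasis_repr e h ⟨_, hu j k⟩ i
    have h2 := ratSize_repr_le e h (u j * (e' k : Quat a b) * δ) i
    rw [h1, ratSize_intCast] at h2
    have h3 := hK j k
    have h4 : 10 ^ 25 * (orderSize e + quatSize (u j * (e' k : Quat a b) * δ)) ≤
        10 ^ 25 * (orderSize e + K) := by omega
    change intSize (e.repr ⟨_, hu j k⟩ i) ≤ _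
    omega

end CoordinateSizes

/-! ### The return multiplier and the index of the connecting ideal are small. -/

section Multiplier

open DefiniteQuaternion

variable {a b : ℤ} [DefiniteQuaternion (Quat a b)] {O₁ O₂ : Subring (Quat a b)}
  (e₁ : Module.Basis (Fin 4) ℤ O₁) (e₂ : Module.Basis (Fin 4) ℤ O₂)
  (h₁ : Submodule.span ℚ (O₁ : Set (Quat a b)) = ⊤)
  (h₂ : Submodule.span ℚ (O₂ : Set (Quat a b)) = ⊤)

theorem sq_coord_le_nrd (ha : a < 0) (hb : b < 0) (x : Quat a b) (i : Fin 4) :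
    coord x i ^ 2 ≤ nrd x := by
  have ha' : (1 : ℚ) ≤ -a := by exact_mod_cast Int.neg_pos_of_neg ha
  have hb' : (1 : ℚ) ≤ -b := by exact_mod_cast Int.neg_pos_of_neg hb
  have hab : (1 : ℚ) ≤ a * b := by nlinarith
  have h1 := sq_nonneg x.re
  have h2 := le_mul_of_one_le_left (sq_nonneg x.imI) ha'
  have h3 := le_mul_of_one_le_left (sq_nonneg x.imJ) hb'
  have h4 := le_mul_of_one_le_left (sq_nonneg x.imK) hab
  have h5 := sq_nonneg x.imI
  have h6 := sq_nonneg x.imJ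
  have h7 := sq_nonneg x.imK
  rw [nrd_eq_normForm, normForm]
  fin_cases i <;> simp [coord] <;> linarith

include e₁ h₁ in
/-- An element of the connecting lattice that divides a small integer is small. -/
theorem quatSize_multiplier_le (ha : a < 0) (hb : b < 0) {N : ℤ} (hN : N ≠ 0)
    (hNO : ∀ y ∈ O₂, (N : Quat a b) * y ∈ O₁) {δ : Quat a b} (hδ : δ ∈ lat O₁ * lat O₂)
    {m : ℕ} (hm : m ≠ 0) (hx : ∃ x ∈ O₁, x * δ = m) :
    quatSize δ ≤ 440 * (orderSize e₁ + intSize N + m.size) := by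
  have hNδ : (N : Quat a b) * δ ∈ O₁ := by
    clear hx
    induction hδ using Submodule.mul_induction_on' with
    | mem_mul_mem x hx y hy =>
      rw [← mul_assoc, (Int.cast_commute N x).eq, mul_assoc]
      exact O₁.mul_mem hx (hNO y hy)
    | add x _ y _ hx hy => rw [mul_add]; exact add_mem hx hy
  obtain ⟨D, hD, hz, hDs⟩ := exists_common_denominator (fun i j => coord (e₁ i : Quat a b) j)
    (K := orderSize e₁) fun i j => (ratSize_coord_le _ _).trans (quatSize_le_orderSize e₁ i)
  have hcoord : ∀ y ∈ O₁, ∀ i, ∃ z : ℤ, D * coord y i = z := by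
    intro y hy i
    have hy' : y = ((∑ j, e₁.repr ⟨y, hy⟩ j • e₁ j : O₁) : Quat a b) := by rw [e₁.sum_repr]
    choose z hz using hz
    refine ⟨∑ j, e₁.repr ⟨y, hy⟩ j * z j i, ?_⟩
    have hc : coord y i = ∑ j, (e₁.repr ⟨y, hy⟩ j : ℚ) * coord (e₁ j : Quat a b) i := by
      conv_lhs => rw [hy']
      exact coord_comb e₁ _ i
    rw [hc, Finset.mul_sum]
    push_cast
    refine Finset.sum_congr rfl fun j _ => ?_
    rw [mul_left_comm, hz]
  obtain ⟨x, hxO, hxδ⟩ := hx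
  -- Here definiteness replaces a bound on β. The norm of x is a positive integer, so nrd δ = m² /
  -- nrd x is at most m²; as −a and −b are at least 1, every coordinate of δ is at most m in
  -- absolute value. Denominators are controlled separately, by D N, because N δ lies in O₁.
  have hnrd : nrd δ ≤ (m : ℚ) ^ 2 := by
    have hmul : nrd x * nrd δ = (m : ℚ) ^ 2 := by
      rw [← nrd_mul, hxδ, ← Int.cast_natCast, nrd_algebraMap_intCast, Int.cast_natCast]
    obtain ⟨k, hk⟩ := hasIntegralNorms e₁ h₁ x hxO
    have hm' : (0 : ℚ) < (m : ℚ) ^ 2 := by positivity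
    have hk0 : nrd x ≠ 0 := by
      intro h0
      rw [h0, zero_mul] at hmul
      exact hm'.ne hmul
    have hk1 : (1 : ℚ) ≤ nrd x := by
      have h0 := nrd_nonneg x
      rw [hk] at hk0 h0 ⊢
      have h1 : (0 : ℤ) ≤ k := by exact_mod_cast h0
      have h2 : k ≠ 0 := by exact_mod_cast hk0
      exact_mod_cast (by omega : 1 ≤ k)
    rw [← hmul]
    exact le_mul_of_one_le_left (nrd_nonneg δ) hk1
  have hcoordN : ∀ i, coord ((N : Quat a b) * δ) i = N * coord δ i := by
    intro i
    rw [intCast_mul_eq_smul]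
    exact congrFun (map_smul (QuaternionAlgebra.linearEquivTuple (a : ℚ) 0 (b : ℚ)) (N : ℚ) δ) i
  refine (quatSize_le (K := 110 * (orderSize e₁ + intSize N + m.size)) fun i => ?_).trans_eq
    (by ring)
  obtain ⟨z, hz⟩ := hcoord _ hNδ i
  rw [hcoordN] at hz
  have hDN : ((D * N).natAbs) ≠ 0 := Int.natAbs_ne_zero.mpr (mul_ne_zero hD hN)
  have hDN' : ((D * N : ℤ) : ℚ) ≠ 0 := by exact_mod_cast mul_ne_zero hD hN
  have hci : |coord δ i| ≤ m :=
    abs_le_of_sq_le_sq ((sq_coord_le_nrd ha hb δ i).trans hnrd) (Nat.cast_nonneg m)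
  have hzle : |z| ≤ |(m : ℤ) * (D * N)| := by
    have : (|z| : ℚ) ≤ |(m : ℚ) * (D * N)| := by
      rw [← hz, ← mul_assoc, abs_mul, abs_mul (m : ℚ), Nat.abs_cast, mul_comm (m : ℚ)]
      exact mul_le_mul_of_nonneg_left hci (abs_nonneg _)
    exact_mod_cast this
  have hsz := ratSize_le_of_eq_div (q := coord δ i) (n := (D * N).sign * z) hDN (by
    have hs : ((D * N).natAbs : ℚ) = (D * N).sign * (D * N : ℤ) := by
      rw [← Int.cast_natCast, ← Int.cast_mul, Int.natCast_natAbs, Int.sign_mul_self_eq_abs]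
    have hsg : (((D * N).sign : ℤ) : ℚ) ≠ 0 := by
      rw [Int.cast_ne_zero, Ne, Int.sign_eq_zero_iff_zero]
      exact mul_ne_zero hD hN
    rw [hs, Int.cast_mul (D * N).sign, mul_div_mul_left _ _ hsg, ← hz, eq_div_iff hDN']
    push_cast
    ring)
  have h1 : intSize ((D * N).sign * z) ≤ intSize ((m : ℤ) * (D * N)) := by
    refine intSize_le_of_abs_le ?_
    rwa [abs_mul, Int.abs_sign_of_ne_zero (mul_ne_zero hD hN), one_mul]
  have h2 := intSize_mul_le m (D * N)
  have h3 := intSize_mul_le D N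
  have h4 : (D * N).natAbs.size + 1 = intSize (D * N) := rfl
  have h5 := one_le_orderSize e₁
  rw [intSize_natCast] at h2
  omega

include h₁ in
/-- The index of a nonzero left ideal with small generators is small. -/
theorem size_index_le {gs : List (Fin 4 → ℤ)} {m W : ℕ} (hm : m ≠ 0)
    (hindex : (Submodule.toAddSubgroup (genIdeal e₁ gs)).index = m)
    (hW : ∀ v ∈ gs, ∀ i, intSize (v i) ≤ W) :
    m.size ≤ 10 ^ 12 * (intSize a + intSize b + orderSize e₁ + W) := by
  have hnt := nontrivial_of_definiteQuaternion (B := Quat a b)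
  have hcz : CharZero (Quat a b) := algebraRat.charZero _
  -- The norm n of any nonzero generator g lies in the ideal, since n = star g · g. Hence the index
  -- divides that of O₁ n, which is n⁴.
  obtain ⟨v, hv, hv0⟩ : ∃ v ∈ gs, comb e₁ v ≠ 0 := by
    by_contra! hall
    have hbot : genIdeal e₁ gs = ⊥ := by
      rw [genIdeal, Ideal.span_eq_bot]
      rintro _ ⟨v, hv, rfl⟩
      exact hall v hv
    have hmem := index_mem hindex
    rw [hbot, Ideal.mem_bot] at hmem
    have h1 := congrArg (Subtype.val) hmem
    rw [Subring.coe_natCast] at h1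
    exact hm (Nat.cast_eq_zero.mp h1)
  set g := comb e₁ v with hg
  have hg0 : (g : Quat a b) ≠ 0 := fun h0 => hv0 (Subtype.ext h0)
  obtain ⟨n, hn⟩ := hasIntegralNorms e₁ h₁ g g.2
  have hnI : (n : O₁) ∈ genIdeal e₁ gs := by
    have hgI : g ∈ genIdeal e₁ gs := Ideal.subset_span ⟨v, hv, rfl⟩
    have := (genIdeal e₁ gs).mul_mem_left ⟨star (g : Quat a b), star_mem_order e₁ h₁ g.2⟩ hgI
    convert this
    apply Subtype.ext
    change _ = star (g : Quat a b) * g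
    rw [star_mul_self_eq, hn, algebraMap_intCast_eq, Subring.coe_intCast]
  have hn0 : n ≠ 0 := by
    rintro rfl
    have := nrd_pos (g : Quat a b) hg0
    rw [hn] at this
    simp at this
  have hnO : (n : O₁) ≠ 0 := by
    intro h0
    have h1 := congrArg (Subtype.val) h0
    rw [Subring.coe_intCast] at h1
    exact hn0 (Int.cast_eq_zero.mp h1)
  have hle : leftMultiples (n : O₁) ≤ Submodule.toAddSubgroup (genIdeal e₁ gs) := by
    rintro _ ⟨y, rfl⟩
    exact (genIdeal e₁ gs).mul_mem_left _ hnI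
  have hidx : (leftMultiples (n : O₁)).index = n.natAbs ^ 4 := by
    have := index_leftMultiples e₁ h₁ hnO
    rw [Subring.coe_intCast, nrd_algebraMap_intCast] at this
    have h2 : ((leftMultiples (n : O₁)).index : ℤ) = n ^ 4 := by
      have : ((leftMultiples (n : O₁)).index : ℚ) = (n : ℚ) ^ 4 := by rw [this]; ring
      exact_mod_cast this
    zify
    rw [h2, Even.pow_abs (by decide)]
  have hmn : m ≤ n.natAbs ^ 4 := by
    have := AddSubgroup.index_dvd_of_le hle
    rw [hindex, hidx] at this
    exact Nat.le_of_dvd (by positivity) this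
  have hs1 : m.size ≤ 4 * n.natAbs.size := by
    refine (Nat.size_le_size hmn).trans ?_
    have h1 := nat_size_mul_le n.natAbs n.natAbs
    have h2 := nat_size_mul_le (n.natAbs * n.natAbs) (n.natAbs * n.natAbs)
    have h3 : n.natAbs ^ 4 = n.natAbs * n.natAbs * (n.natAbs * n.natAbs) := by ring
    rw [h3]
    omega
  have hs2 : intSize n + 1 ≤ 2000 * (quatSize (g : Quat a b) + intSize a + intSize b) := by
    rw [← ratSize_intCast, ← hn, nrd_eq_normForm]
    exact ratSize_normForm_le _
  have hs3 : quatSize (g : Quat a b) ≤ 4 * (6 ^ 4 * (orderSize e₁ + W + 1 + 2)) := by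
    refine quatSize_le fun i => ?_
    have hc : coord (g : Quat a b) i = ∑ j, (v j : ℚ) * coord (e₁ j : Quat a b) i :=
      coord_comb e₁ v i
    rw [hc]
    refine (ratSize_sum_le _ _ fun j _ => ?_).trans_eq (by rw [Finset.card_fin])
    have k1 := ratSize_mul_le (v j) (coord (e₁ j : Quat a b) i)
    have k2 := hW v hv j
    have k3 := (ratSize_coord_le (e₁ j : Quat a b) i).trans (quatSize_le_orderSize e₁ j)
    rw [ratSize_intCast] at k1
    omega
  have hs4 : intSize n = n.natAbs.size + 1 := rfl
  have hs5 := one_le_orderSize e₁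
  omega

end Multiplier

/-! ### Both transfers as integer matrices. -/

section Reduction

open DefiniteQuaternion

variable {a b : ℤ}

theorem IsMaximalOrder.isMaximalFG {O : Subring (Quat a b)} (h : IsMaximalOrder O) :
    IsMaximalFG O := by
  intro O' hle hfg
  refine h.2 ⟨lat_fg_iff.mp hfg, ?_⟩ hle
  rw [eq_top_iff, ← h.1.2]
  exact Submodule.span_mono hle

theorem equivalent_iff {O : Subring (Quat a b)} {I J : Ideal O} :
    Equivalent I J ↔ ∃ β : (Quat a b)ˣ,
      latIdeal J = latIdeal I * Submodule.span ℤ {(β : Quat a b)} := by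
  refine exists_congr fun β => ?_
  rw [← SetLike.coe_set_eq (p := latIdeal J)]
  have h : ((latIdeal I * Submodule.span ℤ {(β : Quat a b)} : Submodule ℤ (Quat a b)) :
      Set (Quat a b)) = (fun x : Quat a b => x * β) '' (Subtype.val '' (I : Set O)) := by
    ext x
    rw [SetLike.mem_coe, Submodule.mem_mul_span_singleton]
    rfl
  rw [h]
  rfl

theorem index_eq_of_idealNrd {O : Subring (Quat a b)} {I : Ideal O} {ℓ k : ℕ} (hℓ : ℓ.Prime)
    (h : idealNrd I = (ℓ : ℝ) ^ k) : (Submodule.toAddSubgroup I).index = ℓ ^ (k + k) := by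
  rw [idealNrd, Real.sqrt_eq_iff_mul_self_eq_of_pos (pow_pos (by exact_mod_cast hℓ.pos) k),
    ← pow_add] at h
  exact_mod_cast h.symm

theorem idealNrd_of_index_eq {O : Subring (Quat a b)} {I : Ideal O} {ℓ k : ℕ}
    (h : (Submodule.toAddSubgroup I).index = ℓ ^ (k + k)) : idealNrd I = (ℓ : ℝ) ^ k := by
  rw [idealNrd, h, pow_add]
  push_cast
  exact Real.sqrt_mul_self (by positivity)

/-- Coordinates of the elements of the basis. -/
def unitList : List (Fin 4 → ℤ) := List.ofFn fun i => Pi.single i 1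

theorem genIdeal_unitList {O : Subring (Quat a b)} (e : Module.Basis (Fin 4) ℤ O) :
    genIdeal e unitList = ⊤ := by
  rw [Ideal.eq_top_iff_one, ← e.sum_repr 1]
  refine sum_mem fun i _ => ?_
  have hi : e i ∈ genIdeal e unitList := by
    refine Ideal.subset_span ⟨Pi.single i 1, ?_, ?_⟩
    · rw [unitList, List.mem_ofFn]
      exact ⟨i, rfl⟩
    · simp [Pi.single_apply]
  exact zsmul_mem hi _

/-- The input lists generators of a left ideal, not of a lattice. The factors f j run through a
basis of O, so that the full lattice of the ideal is formed before the left order is changed to O'.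
-/
theorem latIdeal_transList {B : Type*} [Ring B] [Algebra ℚ B] {O O' : Subring B}
    (e : Module.Basis (Fin 4) ℤ O) (e' : Module.Basis (Fin 4) ℤ O')
    {M : Fin 4 → Matrix (Fin 4) (Fin 4) ℤ} (f : Module.Basis (Fin 4) ℤ O) (c : ℚ) {δ : B}
    (hM : ∀ j k, (comb e' (fun i => M j i k) : B) = algebraMap ℚ B c * f j * e k * δ)
    (gs : List (Fin 4 → ℤ)) :
    latIdeal (genIdeal e' (transList M gs)) =
      scal B c * (lat O' * (latIdeal (genIdeal e gs) * Submodule.span ℤ {δ})) := by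
  rw [latIdeal_genIdeal, genSpan_transList e e' hM, span_range_scal, mul_assoc, scal_left_comm,
    latIdeal_genIdeal, mul_assoc]

theorem unit_mul_mem_lat {B : Type*} [Ring B] {O : Subring B} {M : Submodule ℤ B} (hM : lat O * M = M)
    {x y : B} (hx : x ∈ O) (hy : y ∈ M) : x * y ∈ M := by
  rw [← hM]
  exact Submodule.mul_mem_mul hx hy

/-- The matrices M realise I ↦ N O₁ I and depend only on the two orders; M' realises J ↦ r O₂ J δ
and depends also on one answer `hs` for the connecting ideal, which is the image of `unitList`. The
order of the quantifiers lets that one answer serve all inputs `gs`. -/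
theorem exists_reduction (ha : a < 0) (hb : b < 0) {O₁ O₂ : Subring (Quat a b)}
    (hO₁ : IsMaximalOrder O₁) (hO₂ : IsMaximalOrder O₂) (e₁ : Module.Basis (Fin 4) ℤ O₁)
    (e₂ : Module.Basis (Fin 4) ℤ O₂) :
    ∃ M : Fin 4 → Matrix (Fin 4) (Fin 4) ℤ,
      (∀ j i k, intSize (M j i k) ≤ 10 ^ 80 * specSize e₁ e₂) ∧
      (∀ gs, genIdeal e₂ gs ≠ ⊥ → genIdeal e₁ (transList M gs) ≠ ⊥) ∧
      ∀ (ℓ : ℕ) (_ : ℓ.Prime) (hs : List (Fin 4 → ℤ)) (W k : ℕ),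
        Equivalent (genIdeal e₁ (transList M unitList)) (genIdeal e₁ hs) →
        idealNrd (genIdeal e₁ hs) = (ℓ : ℝ) ^ k → (∀ v ∈ hs, ∀ i, intSize (v i) ≤ W) →
        ∃ M' : Fin 4 → Matrix (Fin 4) (Fin 4) ℤ,
          (∀ j i k, intSize (M' j i k) ≤ 10 ^ 80 * (specSize e₁ e₂ + W)) ∧
          ∀ (gs hs' : List (Fin 4 → ℤ)),
            Equivalent (genIdeal e₁ (transList M gs)) (genIdeal e₁ hs') →
            (∃ m : ℕ, idealNrd (genIdeal e₁ hs') = (ℓ : ℝ) ^ m) →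
            Equivalent (genIdeal e₂ gs) (genIdeal e₂ (transList M' hs')) ∧
            ∃ t : ℕ, idealNrd (genIdeal e₂ (transList M' hs')) = (ℓ : ℝ) ^ t := by
  have := definiteQuaternion ha hb
  have h₁ := hO₁.1.2
  have h₂ := hO₂.1.2
  have hmax := hO₂.isMaximalFG
  have hs1 := one_le_orderSize e₁
  have hs2 := one_le_orderSize e₂
  have hia := one_le_intSize a
  have hib := one_le_intSize b
  obtain ⟨N, hN, hNO, hNs⟩ := exists_conductor e₁ e₂ h₁
  obtain ⟨D, hD, hDO, hDs⟩ := exists_conductor e₂ e₁ h₂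
  have hN' : (N : ℚ) ≠ 0 := by exact_mod_cast hN
  have hu : ∀ j k, algebraMap ℚ (Quat a b) N * (e₂ j : Quat a b) * (e₂ k : Quat a b) * 1 ∈ O₁ := by
    intro j k
    rw [mul_one, mul_assoc, algebraMap_intCast_eq]
    exact hNO _ (O₂.mul_mem (e₂ j).2 (e₂ k).2)
  have hK : ∀ j k, quatSize (algebraMap ℚ (Quat a b) N * (e₂ j : Quat a b) *
      (e₂ k : Quat a b) * 1) ≤ 10 ^ 40 * specSize e₁ e₂ := by
    intro j k
    have k1 := quatSize_mul_le (algebraMap ℚ (Quat a b) N * (e₂ j : Quat a b)) (e₂ k : Quat a b)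
    have k2 := quatSize_mul_le (algebraMap ℚ (Quat a b) N) (e₂ j : Quat a b)
    have k3 := quatSize_algebraMap (a := a) (b := b) N
    have k4 := ratSize_intCast N
    have k5 := quatSize_le_orderSize e₂ j
    have k6 := quatSize_le_orderSize e₂ k
    rw [mul_one, specSize]
    omega
  obtain ⟨M, hM, hMs⟩ := exists_matrices e₁ h₁ e₂ hu hK
  have hpre : ∀ gs, latIdeal (genIdeal e₁ (transList M gs)) =
      scal (Quat a b) N * (lat O₁ * latIdeal (genIdeal e₂ gs)) := by
    intro gs
    rw [latIdeal_transList e₂ e₁ e₂ N hM gs, ← Submodule.one_eq_span, mul_one]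
  refine ⟨M, fun j i k => (hMs j i k).trans (by rw [specSize]; omega), ?_, ?_⟩
  · intro gs hgs hbot
    apply hgs
    rw [eq_bot_iff]
    intro x hx
    have hmem : algebraMap ℚ (Quat a b) N * (1 * (x : Quat a b)) ∈
        latIdeal (genIdeal e₁ (transList M gs)) := by
      rw [hpre]
      exact mem_scal_mul.mpr ⟨_, Submodule.mul_mem_mul (one_mem O₁) (coe_mem_latIdeal.mpr hx), rfl⟩
    rw [hbot] at hmem
    obtain ⟨y, hy, hyx⟩ := mem_latIdeal.mp hmem
    rw [Ideal.mem_bot] at hy ⊢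
    rw [hy, ZeroMemClass.coe_zero, one_mul, ← Algebra.smul_def, eq_comm, smul_eq_zero] at hyx
    exact Subtype.ext (hyx.resolve_left hN')
  intro ℓ hℓ hs W k hequiv hnrd hW
  obtain ⟨β, hβ⟩ := equivalent_iff.mp hequiv
  rw [hpre, genIdeal_unitList] at hβ
  have htop : latIdeal (⊤ : Ideal O₂) = lat O₂ := by
    ext x
    exact ⟨fun hx => latIdeal_le _ hx, fun hx => ⟨⟨x, hx⟩, trivial, rfl⟩⟩
  rw [htop] at hβ
  have hindex := index_eq_of_idealNrd hℓ hnrd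
  obtain ⟨δ, hδ, hδmem, x, hxJ, hxδ⟩ := exists_multiplier hN hβ hindex
  obtain ⟨r, hr0, hrD, hr⟩ := exists_scale e₁ e₂ h₁ h₂ hmax hD hDO
  have hrz : ((r : ℕ) : ℚ) = ((r : ℤ) : ℚ) := rfl
  rw [hrz] at hr
  have hm0 : ℓ ^ (k + k) ≠ 0 := pow_ne_zero _ hℓ.ne_zero
  have hδs := quatSize_multiplier_le e₁ h₁ ha hb hN hNO hδmem hm0 ⟨x, x.2, hxδ⟩
  have hms := size_index_le e₁ h₁ hm0 hindex hW
  -- The scale r is bounded through r ∣ D².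
  have hrs : intSize r ≤ intSize D + intSize D := by
    refine (intSize_le_of_abs_le ?_).trans (intSize_mul_le D D)
    rw [← sq]
    exact abs_le_abs_of_nonneg (by positivity)
      (Int.le_of_dvd (by positivity) hrD)
  -- Because δ lies in O₁O₂, the product belongs to r O₁O₂, hence to r O₂O₁O₂ = O₂.
  have hu' : ∀ j k, algebraMap ℚ (Quat a b) (r : ℤ) * (e₁ j : Quat a b) * (e₁ k : Quat a b) * δ
      ∈ O₂ := by
    intro j k
    rw [← mem_lat, ← hr, mul_assoc, mul_assoc]
    refine mem_scal_mul.mpr ⟨_, ?_, rfl⟩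
    rw [← one_mul ((e₁ j : Quat a b) * ((e₁ k : Quat a b) * δ))]
    have ho : lat O₁ * (lat O₁ * lat O₂) = lat O₁ * lat O₂ := by rw [← mul_assoc, lat_mul_self]
    exact Submodule.mul_mem_mul (one_mem O₂)
      (unit_mul_mem_lat ho (e₁ j).2 (unit_mul_mem_lat ho (e₁ k).2 hδmem))
  have hK' : ∀ j k, quatSize (algebraMap ℚ (Quat a b) (r : ℤ) * (e₁ j : Quat a b) *
      (e₁ k : Quat a b) * δ) ≤ 10 ^ 50 * (specSize e₁ e₂ + W) := by
    intro j k
    have k0 := quatSize_mul_le (algebraMap ℚ (Quat a b) (r : ℤ) * (e₁ j : Quat a b) *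
      (e₁ k : Quat a b)) δ
    have k1 := quatSize_mul_le (algebraMap ℚ (Quat a b) (r : ℤ) * (e₁ j : Quat a b))
      (e₁ k : Quat a b)
    have k2 := quatSize_mul_le (algebraMap ℚ (Quat a b) (r : ℤ)) (e₁ j : Quat a b)
    have k3 := quatSize_algebraMap (a := a) (b := b) (r : ℤ)
    have k4 := ratSize_intCast r
    have k5 := quatSize_le_orderSize e₁ j
    have k6 := quatSize_le_orderSize e₁ k
    rw [specSize]
    omega
  obtain ⟨M', hM', hMs'⟩ := exists_matrices e₂ h₂ e₁ hu' hK'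
  refine ⟨M', fun j i k => (hMs' j i k).trans (by rw [specSize]; omega), ?_⟩
  rintro gs hs' hequiv' ⟨m, hm⟩
  obtain ⟨γ, hγ⟩ := equivalent_iff.mp hequiv'
  rw [hpre] at hγ
  obtain ⟨hη, t, ht⟩ := transfer e₂ h₂ hmax hN hr hℓ hβ hδ hγ (index_eq_of_idealNrd hℓ hm)
    (latIdeal_transList e₁ e₂ e₁ _ hM' hs')
  exact ⟨equivalent_iff.mpr hη, t, idealNrd_of_index_eq ht⟩

end Reduction

section Programs

/-! ### Programs -/

/-- Given the coins, the run is unique; this makes `runCost` the cost of that run. -/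
theorem Exec.det {ω : ℕ → Bool} {c : Prog} {σ : State} {m m' : Cost} {τ τ' : State}
    (h : Exec ω c σ m τ) (h' : Exec ω c σ m' τ') : m = m' ∧ τ = τ' := by
  induction h generalizing m' τ' with
  | skip σ => cases h'; exact ⟨rfl, rfl⟩
  | op o σ => cases h'; exact ⟨rfl, rfl⟩
  | seq _ _ ih1 ih2 =>
    cases h' with
    | seq h1 h2 =>
      obtain ⟨rfl, rfl⟩ := ih1 h1
      obtain ⟨rfl, rfl⟩ := ih2 h2
      exact ⟨rfl, rfl⟩
  | ite_pos hr _ ih =>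
    cases h' with
    | ite_pos _ h1 => obtain ⟨rfl, rfl⟩ := ih h1; exact ⟨rfl, rfl⟩
    | ite_neg hn _ => exact absurd hr hn
  | ite_neg hr _ ih =>
    cases h' with
    | ite_pos hn _ => exact absurd hn hr
    | ite_neg _ h1 => obtain ⟨rfl, rfl⟩ := ih h1; exact ⟨rfl, rfl⟩
  | loop_done hr =>
    cases h' with
    | loop_done _ => exact ⟨rfl, rfl⟩
    | loop_step hn _ _ => exact absurd hn hr
  | loop_step hr _ _ ih1 ih2 =>
    cases h' with
    | loop_done hn => exact absurd hr hn
    | loop_step _ h1 h2 =>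
      obtain ⟨rfl, rfl⟩ := ih1 h1
      obtain ⟨rfl, rfl⟩ := ih2 h2
      exact ⟨rfl, rfl⟩

@[simp] theorem listSize_nil : listSize [] = 0 := rfl

@[simp] theorem listSize_cons (z : ℤ) (l : List ℤ) : listSize (z :: l) = intSize z + listSize l := by
  simp [listSize]

theorem length_le_listSize (l : List ℤ) : l.length ≤ listSize l := by
  induction l with
  | nil => simp
  | cons z l ih =>
    have := one_le_intSize z
    rw [List.length_cons, listSize_cons]
    omega

theorem intSize_le_listSize {l : List ℤ} {z : ℤ} (h : z ∈ l) : intSize z ≤ listSize l :=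
  List.single_le_sum (fun _ _ => Nat.zero_le _) _ (List.mem_map_of_mem h)

theorem listSize_reverse (l : List ℤ) : listSize l.reverse = listSize l := by
  rw [listSize, listSize, List.map_reverse, List.sum_reverse]

/-- The content of a stack grows at most by what the run pays for. -/
def Grows (m : Cost) (l l' : List ℤ) : Prop :=
  l'.length ≤ l.length + m.steps ∧ listSize l' ≤ listSize l + m.time ∧
    ∀ W, m.width ≤ W → (∀ z ∈ l, intSize z ≤ W) → ∀ z ∈ l', intSize z ≤ W

theorem Grows.refl (m : Cost) (l : List ℤ) : Grows m l l :=
  ⟨Nat.le_add_right _ _, Nat.le_add_right _ _, fun _ _ h => h⟩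

theorem Grows.comp {m n : Cost} {l l' l'' : List ℤ} (h : Grows m l l') (h' : Grows n l' l'') :
    Grows (m.comp n) l l'' := by
  obtain ⟨h1, h2, h3⟩ := h
  obtain ⟨h1', h2', h3'⟩ := h'
  refine ⟨?_, ?_, fun W hW hl => ?_⟩
  · simp only [Cost.comp]; omega
  · simp only [Cost.comp]; omega
  · simp only [Cost.comp] at hW
    exact h3' W ((le_max_right _ _).trans hW) (h3 W ((le_max_left _ _).trans hW) hl)

/-- Only a push enlarges a stack, and it pays for the integer pushed. In this way the output of A
and whatever it leaves on other stacks are bounded by the cost of A itself. -/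
theorem Exec.grows {ω : ℕ → Bool} {c : Prog} {σ τ : State} {m : Cost} (h : Exec ω c σ m τ)
    (k : ℕ) : Grows m (σ.stk k) (τ.stk k) := by
  induction h with
  | skip σ => exact Grows.refl _ _
  | op o σ =>
    cases o with
    | pop r j =>
      by_cases hk : k = j
      · subst hk
        have hs : (Op.next ω σ (.pop r k)).stk k = (σ.stk k).tail := by simp [Op.next]
        rw [hs]
        refine ⟨?_, ?_, fun W _ h z hz => h z (List.mem_of_mem_tail hz)⟩
        · rw [List.length_tail]; omega
        · rcases σ.stk k with _ | ⟨z, l⟩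
          · simp
          · simp; omega
      · have hs : (Op.next ω σ (.pop r j)).stk k = σ.stk k := by
          simp [Op.next, State.set, Function.update_of_ne hk]
        rw [hs]
        exact Grows.refl _ _
    | push j r =>
      by_cases hk : k = j
      · subst hk
        have hs : (Op.next ω σ (.push k r)).stk k = σ.reg r :: σ.stk k := by
          simp [Op.next, Op.val]
        rw [hs]
        refine ⟨?_, ?_, fun W hW h z hz => ?_⟩
        · simp [Op.cost]
        · simp [Op.cost, Op.bitOps, Op.val]; omega
        · rcases List.mem_cons.mp hz with rfl | hz
          · exact hW
          · exact h z hz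
      · have hs : (Op.next ω σ (.push j r)).stk k = σ.stk k := by
          simp [Op.next, Function.update_of_ne hk]
        rw [hs]
        exact Grows.refl _ _
    | _ => exact Grows.refl _ _
  | seq _ _ ih1 ih2 => exact ih1.comp ih2
  | ite_pos _ _ ih => exact (Grows.refl _ _).comp ih
  | ite_neg _ _ ih => exact (Grows.refl _ _).comp ih
  | loop_done _ => exact Grows.refl _ _
  | loop_step _ _ _ ih1 ih2 => exact (Grows.refl _ _).comp (ih1.comp ih2)

/-- The program runs from `σ` to `τ` within the given bounds on steps, width and time. -/
def Runs (ω : ℕ → Bool) (c : Prog) (σ τ : State) (S W T : ℕ) : Prop :=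
  ∃ m : Cost, Exec ω c σ m τ ∧ m.steps ≤ S ∧ m.width ≤ W ∧ m.time ≤ T

variable {ω : ℕ → Bool}

theorem Runs.mono {c : Prog} {σ τ : State} {S W T S' W' T' : ℕ} (h : Runs ω c σ τ S W T)
    (hS : S ≤ S') (hW : W ≤ W') (hT : T ≤ T') : Runs ω c σ τ S' W' T' := by
  obtain ⟨m, h, h1, h2, h3⟩ := h
  exact ⟨m, h, h1.trans hS, h2.trans hW, h3.trans hT⟩

theorem Runs.seq {c d : Prog} {σ τ υ : State} {S S' W T T' : ℕ} (h : Runs ω c σ τ S W T)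
    (h' : Runs ω d τ υ S' W T') : Runs ω (.seq c d) σ υ (S + S') W (T + T') := by
  obtain ⟨m, h, h1, h2, h3⟩ := h
  obtain ⟨n, h', h1', h2', h3'⟩ := h'
  exact ⟨_, .seq h h', add_le_add h1 h1', max_le h2 h2', add_le_add h3 h3'⟩

theorem Runs.op {o : Op} {σ : State} {W T : ℕ} (hW : intSize (o.val ω σ) ≤ W)
    (hT : o.bitOps ω σ ≤ T) : Runs ω (.op o) σ (o.next ω σ) 1 W T :=
  ⟨_, .op o σ, le_rfl, hW, hT⟩

theorem Runs.loop_done {r : ℕ} {c : Prog} {σ : State} (W : ℕ) (h : ¬ 0 < σ.reg r) :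
    Runs ω (.loop r c) σ σ 1 W 1 :=
  ⟨_, .loop_done h, le_rfl, Nat.zero_le _, le_rfl⟩

theorem Runs.loop_step {r : ℕ} {c : Prog} {σ τ υ : State} {S S' W T T' : ℕ}
    (h : 0 < σ.reg r) (h1 : Runs ω c σ τ S W T) (h2 : Runs ω (.loop r c) τ υ S' W T') :
    Runs ω (.loop r c) σ υ (1 + (S + S')) W (1 + (T + T')) := by
  obtain ⟨m, h1, a1, a2, a3⟩ := h1
  obtain ⟨n, h2, b1, b2, b3⟩ := h2
  exact ⟨_, .loop_step h h1 h2, Nat.add_le_add_left (add_le_add a1 b1) 1,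
    max_le (Nat.zero_le _) (max_le a2 b2), Nat.add_le_add_left (add_le_add a3 b3) 1⟩

/-- Only the first registers and the first two stacks may have changed. -/
def Frame (σ τ : State) : Prop :=
  (∀ r, 6 < r → τ.reg r = σ.reg r) ∧ (∀ k, 1 < k → τ.stk k = σ.stk k) ∧ τ.pos = σ.pos

theorem Frame.refl (σ : State) : Frame σ σ := ⟨fun _ _ => rfl, fun _ _ => rfl, rfl⟩

theorem Frame.trans {σ τ υ : State} (h : Frame σ τ) (h' : Frame τ υ) : Frame σ υ :=
  ⟨fun r hr => (h'.1 r hr).trans (h.1 r hr), fun k hk => (h'.2.1 k hk).trans (h.2.1 k hk),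
    h'.2.2.trans h.2.2⟩

/-- A sequence of instructions. -/
def ops : List Op → Prog
  | [] => .skip
  | o :: l => .seq (.op o) (ops l)

/-- The final state of a sequence of instructions. -/
def runOps (ω : ℕ → Bool) : List Op → State → State
  | [], σ => σ
  | o :: l, σ => runOps ω l (o.next ω σ)

/-- The total cost of the bit operations of a sequence of instructions. -/
def timeOps (ω : ℕ → Bool) : List Op → State → ℕ
  | [], _ => 1
  | o :: l, σ => o.bitOps ω σ + timeOps ω l (o.next ω σ)

/-- All integers computed in a sequence of instructions are small. -/
def WidthOps (ω : ℕ → Bool) (W : ℕ) : List Op → State → Prop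
  | [], _ => True
  | o :: l, σ => intSize (o.val ω σ) ≤ W ∧ WidthOps ω W l (o.next ω σ)

theorem Runs.ops {l : List Op} {σ : State} {W : ℕ} (hW : WidthOps ω W l σ) :
    Runs ω (ops l) σ (runOps ω l σ) (l.length + 1) W (timeOps ω l σ) := by
  induction l generalizing σ with
  | nil => exact ⟨_, .skip σ, le_rfl, Nat.zero_le _, le_rfl⟩
  | cons o l ih =>
    have h := (Runs.op hW.1 le_rfl).seq (ih hW.2)
    rw [List.length_cons]
    exact h.mono (by omega) le_rfl le_rfl

theorem intSize_zero : intSize 0 = 1 := by simp [intSize]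

theorem intSize_one : intSize 1 = 2 := by simp [intSize]

/-! ### Linear maps -/

/-- The instructions that push the product of a row and the vector in registers `1` to `4`. -/
def rowOps (c : Fin 4 → ℤ) : List Op :=
  [.const 5 (c 0), .mul 6 5 1, .const 5 (c 1), .mul 5 5 2, .add 6 6 5, .const 5 (c 2),
    .mul 5 5 3, .add 6 6 5, .const 5 (c 3), .mul 5 5 4, .add 6 6 5, .push 1 6]

/-- The vector in registers `1` to `4`. -/
def vec (σ : State) : Fin 4 → ℤ := fun i => σ.reg (i + 1)

/-- The size of the vector in registers `1` to `4`. -/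
def vecSize (σ : State) : ℕ := ∑ i, intSize (vec σ i)

theorem runs_row {c : Fin 4 → ℤ} {σ : State} {B : ℕ} (hc : ∀ i, intSize (c i) ≤ B) :
    ∃ τ, Runs ω (ops (rowOps c)) σ τ 13 (4 * B + vecSize σ) (40 * (B * vecSize σ)) ∧
      Frame σ τ ∧ vec τ = vec σ ∧ τ.stk 0 = σ.stk 0 ∧ τ.stk 1 = c ⬝ᵥ vec σ :: σ.stk 1 := by
  set V := vecSize σ with hV
  have hVsum : V = intSize (σ.reg 1) + intSize (σ.reg 2) + intSize (σ.reg 3) +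
      intSize (σ.reg 4) := by
    rw [hV, vecSize, Fin.sum_univ_four]; rfl
  have hdot : c ⬝ᵥ vec σ = c 0 * σ.reg 1 + c 1 * σ.reg 2 + c 2 * σ.reg 3 + c 3 * σ.reg 4 := by
    rw [dotProduct, Fin.sum_univ_four]; rfl
  have p1 := intSize_mul_le (c 0) (σ.reg 1)
  have p2 := intSize_mul_le (c 1) (σ.reg 2)
  have p3 := intSize_mul_le (c 2) (σ.reg 3)
  have p4 := intSize_mul_le (c 3) (σ.reg 4)
  have s1 := intSize_add_le (c 0 * σ.reg 1) (c 1 * σ.reg 2)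
  have s2 := intSize_add_le (c 0 * σ.reg 1 + c 1 * σ.reg 2) (c 2 * σ.reg 3)
  have s3 := intSize_add_le (c 0 * σ.reg 1 + c 1 * σ.reg 2 + c 2 * σ.reg 3) (c 3 * σ.reg 4)
  have b0 := hc 0
  have b1 := hc 1
  have b2 := hc 2
  have b3 := hc 3
  have o1 := one_le_intSize (σ.reg 1)
  have o2 := one_le_intSize (σ.reg 2)
  have o3 := one_le_intSize (σ.reg 3)
  have o4 := one_le_intSize (σ.reg 4)
  have oB := (one_le_intSize (c 0)).trans b0
  have hW : WidthOps ω (4 * B + V) (rowOps c) σ := by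
    simp only [rowOps, WidthOps, Op.val, Op.next, State.set, Function.update_self, ne_eq,
      Nat.reduceEqDiff, not_false_eq_true, Function.update_of_ne, OfNat.one_ne_ofNat]
    refine ⟨?_, ?_, ?_, ?_, ?_, ?_, ?_, ?_, ?_, ?_, ?_, ?_, trivial⟩ <;> omega
  have hT : timeOps ω (rowOps c) σ ≤ 40 * (B * V) := by
    simp only [rowOps, timeOps, Op.bitOps, Op.val, Op.next, State.set, Function.update_self, ne_eq,
      Nat.reduceEqDiff, not_false_eq_true, Function.update_of_ne, OfNat.one_ne_ofNat]
    have q1 : intSize (c 0) * intSize (σ.reg 1) ≤ B * V := Nat.mul_le_mul b0 (by omega)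
    have q2 : intSize (c 1) * intSize (σ.reg 2) ≤ B * V := Nat.mul_le_mul b1 (by omega)
    have q3 : intSize (c 2) * intSize (σ.reg 3) ≤ B * V := Nat.mul_le_mul b2 (by omega)
    have q4 : intSize (c 3) * intSize (σ.reg 4) ≤ B * V := Nat.mul_le_mul b3 (by omega)
    have q5 : B ≤ B * V := Nat.le_mul_of_pos_right _ (by omega)
    have q6 : V ≤ B * V := Nat.le_mul_of_pos_left _ (by omega)
    have q7 : 4 * B ≤ B * V := by rw [mul_comm]; exact Nat.mul_le_mul_left _ (by omega)
    omega
  refine ⟨_, (Runs.ops hW).mono le_rfl le_rfl hT, ⟨?_, ?_, rfl⟩, ?_, ?_, ?_⟩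
  · intro r hr
    have h5 : r ≠ 5 := by omega
    have h6 : r ≠ 6 := by omega
    simp [rowOps, runOps, Op.next, State.set, Function.update_of_ne h5, Function.update_of_ne h6]
  · intro k hk
    have h1 : k ≠ 1 := by omega
    simp [rowOps, runOps, Op.next, State.set, Function.update_of_ne h1]
  · funext i
    fin_cases i <;> simp [vec, rowOps, runOps, Op.next, State.set]
  · simp [rowOps, runOps, Op.next, State.set]
  · rw [hdot]
    simp [rowOps, runOps, Op.next, Op.val, State.set]

/-- The program that pushes the products of all rows and the vector in registers `1` to `4`. -/
def rowsProg : List (Fin 4 → ℤ) → Prog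
  | [] => .skip
  | c :: l => .seq (ops (rowOps c)) (rowsProg l)

theorem runs_rows {rows : List (Fin 4 → ℤ)} {σ : State} {B : ℕ}
    (hc : ∀ c ∈ rows, ∀ i, intSize (c i) ≤ B) :
    ∃ τ, Runs ω (rowsProg rows) σ τ (13 * rows.length + 1) (4 * B + vecSize σ)
      (40 * (B * vecSize σ) * rows.length + 1) ∧
      Frame σ τ ∧ τ.stk 0 = σ.stk 0 ∧
      τ.stk 1 = (rows.map fun c => c ⬝ᵥ vec σ).reverse ++ σ.stk 1 := by
  induction rows generalizing σ with
  | nil =>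
    exact ⟨σ, ⟨_, .skip σ, le_rfl, Nat.zero_le _, by simp [Cost.unit]⟩, Frame.refl σ, rfl, rfl⟩
  | cons c l ih =>
    obtain ⟨τ, h1, hf, hv, h0, hs⟩ := runs_row (ω := ω) (σ := σ) (hc c List.mem_cons_self)
    obtain ⟨υ, h2, hf', h0', hs'⟩ := ih (σ := τ) fun d hd => hc d (List.mem_cons_of_mem _ hd)
    have hvs : vecSize τ = vecSize σ := by rw [vecSize, vecSize, hv]
    rw [hvs] at h2
    refine ⟨υ, (h1.seq h2).mono ?_ le_rfl ?_, hf.trans hf', h0'.trans h0, ?_⟩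
    · rw [List.length_cons]; omega
    · rw [List.length_cons, mul_add, mul_one]; omega
    · rw [hs', hs, hv]; simp

end Programs

/-! ### The linear programs and their composition with a given program. -/

section Transform

variable {ω : ℕ → Bool}

/-- The instructions that load the next vector. -/
def loadOps : List Op := [.pop 1 0, .pop 2 0, .pop 3 0, .pop 4 0]

/-- Load the next vector and push its products with all rows. -/
def chunk (rows : List (Fin 4 → ℤ)) : Prog :=
  .seq (ops loadOps) (.seq (rowsProg rows) (.op (.nonempty 0 0)))

/-- The vector formed by the first four entries of a list. -/
def headVec (l : List ℤ) : Fin 4 → ℤ :=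
  ![l.headD 0, l.tail.headD 0, l.tail.tail.headD 0, l.tail.tail.tail.headD 0]

theorem headVec_append (v : Fin 4 → ℤ) (l : List ℤ) : headVec (List.ofFn v ++ l) = v := by
  funext i
  fin_cases i <;> simp [headVec, List.ofFn_succ]

/-- A pop from an exhausted stack returns 0, of bit length one, so an incomplete block may be
padded. The factor 4 covers the padding and lets the block costs telescope. -/
theorem size_headVec {l : List ℤ} (hl : l ≠ []) :
    (∑ i, intSize (headVec l i)) + 4 * listSize (l.drop 4) ≤ 4 * listSize l := by
  have h0 := intSize_zero
  rw [Fin.sum_univ_four]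
  rcases l with _ | ⟨a, _ | ⟨b, _ | ⟨c, _ | ⟨d, l⟩⟩⟩⟩
  · exact absurd rfl hl
  · have := one_le_intSize a
    simp [headVec]; omega
  · have := one_le_intSize a
    simp [headVec]; omega
  · have := one_le_intSize a
    simp [headVec]; omega
  · have := one_le_intSize a
    simp [headVec]; omega

theorem intSize_headVec_le {l : List ℤ} {w : ℕ} (hw : 1 ≤ w) (hl : ∀ z ∈ l, intSize z ≤ w)
    (i : Fin 4) : intSize (headVec l i) ≤ w := by
  have h0 : ∀ l' : List ℤ, (∀ z ∈ l', intSize z ≤ w) → intSize (l'.headD 0) ≤ w := by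
    intro l' h
    rcases l' with _ | ⟨z, l'⟩
    · rw [List.headD_nil, intSize_zero]; exact hw
    · exact h z List.mem_cons_self
  have ht : ∀ l' : List ℤ, (∀ z ∈ l', intSize z ≤ w) → ∀ z ∈ l'.tail, intSize z ≤ w :=
    fun l' h z hz => h z (List.mem_of_mem_tail hz)
  fin_cases i
  · exact h0 _ hl
  · exact h0 _ (ht _ hl)
  · exact h0 _ (ht _ (ht _ hl))
  · exact h0 _ (ht _ (ht _ (ht _ hl)))

/-- The truth value of the test whether a list is nonempty. -/
def flag (l : List ℤ) : ℤ := if l.isEmpty then 0 else 1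

theorem intSize_flag_le (l : List ℤ) : intSize (flag l) ≤ 2 := by
  rw [flag]
  split_ifs
  · rw [intSize_zero]; norm_num
  · rw [intSize_one]

theorem flag_pos {l : List ℤ} : 0 < flag l ↔ l ≠ [] := by
  rcases l with _ | ⟨z, l⟩ <;> simp [flag]

theorem runs_flag (σ : State) (k : ℕ) {W : ℕ} (hW : 2 ≤ W) :
    Runs ω (.op (.nonempty 0 k)) σ (σ.set 0 (flag (σ.stk k))) 1 W 2 :=
  Runs.op ((intSize_flag_le _).trans hW) (intSize_flag_le _)

theorem frame_set (σ : State) {r : ℕ} (hr : r ≤ 6) (v : ℤ) : Frame σ (σ.set r v) := by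
  refine ⟨fun r' hr' => ?_, fun _ _ => rfl, rfl⟩
  have : r' ≠ r := by omega
  simp [State.set, Function.update_of_ne this]

theorem runs_chunk {rows : List (Fin 4 → ℤ)} {σ : State} {B w : ℕ} (hrows : rows.length = 16)
    (hc : ∀ c ∈ rows, ∀ i, intSize (c i) ≤ B) (hB : 1 ≤ B) (hw : 1 ≤ w)
    (hl : ∀ z ∈ σ.stk 0, intSize z ≤ w) :
    ∃ τ, Runs ω (chunk rows) σ τ 300 (4 * B + 4 * w)
      (700 * (B * ∑ i, intSize (headVec (σ.stk 0) i))) ∧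
      Frame σ τ ∧ τ.stk 0 = (σ.stk 0).drop 4 ∧ τ.reg 0 = flag (τ.stk 0) ∧
      τ.stk 1 = (rows.map fun c => c ⬝ᵥ headVec (σ.stk 0)).reverse ++ σ.stk 1 := by
  set v := headVec (σ.stk 0) with hv
  have hload : ∃ τ, Runs ω (ops loadOps) σ τ 5 (4 * B + 4 * w) ((∑ i, intSize (v i)) + 1) ∧
      Frame σ τ ∧ τ.stk 0 = (σ.stk 0).drop 4 ∧ vec τ = v ∧ τ.stk 1 = σ.stk 1 := by
    refine ⟨_, (Runs.ops (l := loadOps) ?_).mono le_rfl le_rfl ?_, ⟨?_, ?_, ?_⟩, ?_, ?_, ?_⟩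
    · have h0 := intSize_headVec_le hw hl 0
      have h1 := intSize_headVec_le hw hl 1
      have h2 := intSize_headVec_le hw hl 2
      have h3 := intSize_headVec_le hw hl 3
      simp only [headVec, Matrix.cons_val_zero, Matrix.cons_val_one, Matrix.cons_val] at h0 h1 h2 h3
      simp only [loadOps, WidthOps, Op.val, Op.next, State.set, Function.update_self]
      refine ⟨?_, ?_, ?_, ?_, trivial⟩ <;> omega
    · rw [Fin.sum_univ_four]
      simp only [loadOps, timeOps, Op.bitOps, Op.val, Op.next, State.set, Function.update_self]
      simp [hv, headVec]
      omega
    · intro r hr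
      have h1 : r ≠ 1 := by omega
      have h2 : r ≠ 2 := by omega
      have h3 : r ≠ 3 := by omega
      have h4 : r ≠ 4 := by omega
      simp [loadOps, runOps, Op.next, State.set, h1, h2, h3, h4]
    · intro k hk
      have h0 : k ≠ 0 := by omega
      simp [loadOps, runOps, Op.next, State.set, h0]
    · rfl
    · simp only [loadOps, runOps, Op.next, State.set, Function.update_self]
      rcases σ.stk 0 with _ | ⟨_, _ | ⟨_, _ | ⟨_, _ | _⟩⟩⟩ <;> rfl
    · funext i
      fin_cases i <;> simp [vec, hv, headVec, loadOps, runOps, Op.next, Op.val, State.set]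
    · simp [loadOps, runOps, Op.next, State.set]
  obtain ⟨τ, h1, f1, s1, v1, t1⟩ := hload
  obtain ⟨υ, h2, f2, s2, t2⟩ := runs_rows (ω := ω) (σ := τ) hc
  have hvs : vecSize τ = ∑ i, intSize (v i) := by rw [vecSize, v1]
  rw [hvs, hrows] at h2
  have hVw : ∑ i, intSize (v i) ≤ 4 * w := by
    refine (Finset.sum_le_card_nsmul _ _ w fun i _ => intSize_headVec_le hw hl i).trans ?_
    rw [Finset.card_fin, smul_eq_mul]
  have hV1 : 1 ≤ ∑ i, intSize (v i) :=
    (one_le_intSize (v 0)).trans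
      (Finset.single_le_sum (f := fun i => intSize (v i)) (fun _ _ => Nat.zero_le _)
        (Finset.mem_univ 0))
  have hBV : ∑ i, intSize (v i) ≤ B * ∑ i, intSize (v i) := Nat.le_mul_of_pos_left _ hB
  refine ⟨_, (h1.seq ((h2.mono le_rfl (Nat.add_le_add_left hVw _) le_rfl).seq
    (runs_flag υ 0 (by omega)))).mono (by omega) le_rfl (by omega),
    (f1.trans f2).trans (frame_set υ (by omega) _), ?_, ?_, ?_⟩
  · change υ.stk 0 = _
    rw [s2, s1]
  · simp [State.set]
  · change υ.stk 1 = _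
    rw [t2, t1, v1]

theorem flatMap_cons_ne_nil {v : Fin 4 → ℤ} {gs : List (Fin 4 → ℤ)} :
    (v :: gs).flatMap List.ofFn ≠ ([] : List ℤ) := by
  simp [List.ofFn_succ]

/-- Halting and cost are proved for arbitrary stack contents, because the cost bounds concern every
run on which A halts, even one whose output is not a list of vectors. The meaning of the result is
asserted only for concatenations of vectors. -/
theorem runs_loop {rows : List (Fin 4 → ℤ)} {B w : ℕ} (hrows : rows.length = 16)
    (hc : ∀ c ∈ rows, ∀ i, intSize (c i) ≤ B) (hB : 1 ≤ B) (hw : 1 ≤ w) (n : ℕ) :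
    ∀ σ : State, (σ.stk 0).length ≤ n → σ.reg 0 = flag (σ.stk 0) →
      (∀ z ∈ σ.stk 0, intSize z ≤ w) →
      ∃ τ out, Runs ω (.loop 0 (chunk rows)) σ τ (301 * (σ.stk 0).length + 1) (4 * B + 4 * w)
        (3000 * (B * listSize (σ.stk 0)) + 1) ∧
        Frame σ τ ∧ τ.stk 0 = [] ∧ τ.stk 1 = out.reverse ++ σ.stk 1 ∧
        ∀ gs : List (Fin 4 → ℤ), σ.stk 0 = gs.flatMap List.ofFn →
          out = gs.flatMap fun v => rows.map fun c => c ⬝ᵥ v := by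
  induction n with
  | zero =>
    intro σ hn hr _
    have h0 : σ.stk 0 = [] := List.length_eq_zero_iff.mp (Nat.le_zero.mp hn)
    refine ⟨σ, [], (Runs.loop_done _ ?_).mono (by omega) le_rfl (by omega), Frame.refl σ, h0, rfl,
      ?_⟩
    · rw [hr, flag_pos]; exact fun h => h h0
    · intro gs hgs
      rcases gs with _ | ⟨v, gs⟩
      · rfl
      · exact absurd (hgs.symm.trans h0) flatMap_cons_ne_nil
  | succ n ih =>
    intro σ hn hr hl
    by_cases h0 : σ.stk 0 = []
    · exact ih σ (by rw [h0]; exact Nat.zero_le _) hr hl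
    obtain ⟨τ, h1, f1, s1, r1, t1⟩ := runs_chunk (ω := ω) hrows hc hB hw hl
    have hlen : 0 < (σ.stk 0).length := List.length_pos_iff.mpr h0
    have hτl : (τ.stk 0).length = (σ.stk 0).length - 4 := by rw [s1, List.length_drop]
    obtain ⟨υ, out, h2, f2, s2, t2, g2⟩ := ih τ (by omega) r1 (by
      rw [s1]
      exact fun z hz => hl z (List.mem_of_mem_drop hz))
    have hsz := size_headVec h0
    have hsz' := Nat.mul_le_mul_left B hsz
    rw [mul_add, Nat.mul_left_comm B 4, Nat.mul_left_comm B 4] at hsz'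
    have hone : 1 ≤ B * ∑ i, intSize (headVec (σ.stk 0) i) := by
      refine Nat.mul_pos hB ((one_le_intSize (headVec (σ.stk 0) 0)).trans
        (Finset.single_le_sum (f := fun i => intSize (headVec (σ.stk 0) i))
          (fun _ _ => Nat.zero_le _) (Finset.mem_univ 0)))
    rw [s1] at h2
    refine ⟨υ, (rows.map fun c => c ⬝ᵥ headVec (σ.stk 0)) ++ out, (Runs.loop_step ?_ h1 h2).mono ?_ le_rfl ?_, f1.trans f2, s2, ?_, ?_⟩
    · rw [hr, flag_pos]; exact h0
    · rw [List.length_drop]; omega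
    · omega
    · rw [t2, t1, List.reverse_append, List.append_assoc]
    · intro gs hgs
      rcases gs with _ | ⟨v, gs⟩
      · exact absurd hgs h0
      · rw [List.flatMap_cons] at hgs ⊢
        rw [g2 gs, hgs, headVec_append]
        rw [s1, hgs]
        exact List.drop_left' (by simp)

/-- The body of the loop that moves stack `1` to stack `0`. -/
def moveBody : Prog := ops [.pop 1 1, .push 0 1, .nonempty 0 1]

theorem runs_move {w : ℕ} (hw : 2 ≤ w) (l : List ℤ) :
    ∀ σ : State, σ.stk 1 = l → σ.reg 0 = flag l → (∀ z ∈ l, intSize z ≤ w) →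
      ∃ τ, Runs ω (.loop 0 moveBody) σ τ (5 * l.length + 1) w (10 * listSize l + 1) ∧
        Frame σ τ ∧ τ.stk 1 = [] ∧ τ.stk 0 = l.reverse ++ σ.stk 0 := by
  induction l with
  | nil =>
    intro σ hl hr _
    exact ⟨σ, (Runs.loop_done _ (by rw [hr, flag_pos]; simp)).mono (by simp) le_rfl (by simp),
      Frame.refl σ, hl, rfl⟩
  | cons z l ih =>
    intro σ hl hr hz
    have hbody : ∃ τ, Runs ω moveBody σ τ 4 w (2 * intSize z + 3) ∧ Frame σ τ ∧
        τ.stk 1 = l ∧ τ.stk 0 = z :: σ.stk 0 ∧ τ.reg 0 = flag l := by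
      have hz' := hz z List.mem_cons_self
      have hf := intSize_flag_le l
      refine ⟨_, (Runs.ops ?_).mono le_rfl le_rfl ?_, ⟨?_, ?_, ?_⟩, ?_, ?_, ?_⟩
      · simp only [WidthOps, Op.val, Op.next, State.set, Function.update_self, ne_eq,
          one_ne_zero, not_false_eq_true, Function.update_of_ne, hl, List.headD_cons,
          List.tail_cons]
        exact ⟨hz', hz', hf.trans hw, trivial⟩
      · simp only [timeOps, Op.bitOps, Op.val, Op.next, State.set, Function.update_self, ne_eq,
          one_ne_zero, not_false_eq_true, Function.update_of_ne, hl, List.headD_cons,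
          List.tail_cons]
        rw [flag] at hf
        omega
      · intro r hr
        have h0 : r ≠ 0 := by omega
        have h1 : r ≠ 1 := by omega
        simp [runOps, Op.next, State.set, h0, h1]
      · intro k hk
        have h0 : k ≠ 0 := by omega
        have h1 : k ≠ 1 := by omega
        simp [runOps, Op.next, State.set, h0, h1]
      · rfl
      · simp [runOps, Op.next, State.set, hl]
      · simp [runOps, Op.next, Op.val, State.set, hl]
      · simp [runOps, Op.next, Op.val, State.set, hl, flag]
    obtain ⟨τ, h1, f1, s1, t1, r1⟩ := hbody
    obtain ⟨υ, h2, f2, s2, t2⟩ := ih τ s1 r1 fun y hy => hz y (List.mem_cons_of_mem _ hy)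
    have ho := one_le_intSize z
    refine ⟨υ, (Runs.loop_step (by rw [hr, flag_pos]; simp) h1 h2).mono ?_ le_rfl ?_,
      f1.trans f2, s2, ?_⟩
    · rw [List.length_cons]; omega
    · rw [listSize_cons]; omega
    · rw [t2, t1]; simp

/-- Apply a linear map, given by its rows, to each vector on stack `0`. -/
def linProg (rows : List (Fin 4 → ℤ)) : Prog :=
  .seq (.op (.nonempty 0 0)) (.seq (.loop 0 (chunk rows))
    (.seq (.op (.nonempty 0 1)) (.loop 0 moveBody)))

/-- Results are pushed on stack 1 in reverse and the second loop reverses them again. No condition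
on the registers is needed: each register used is written before it is read. -/
theorem runs_linProg {rows : List (Fin 4 → ℤ)} {B w : ℕ} (hrows : rows.length = 16)
    (hc : ∀ c ∈ rows, ∀ i, intSize (c i) ≤ B) (hB : 1 ≤ B) (hw : 1 ≤ w) {σ : State}
    (h1 : σ.stk 1 = []) (hl : ∀ z ∈ σ.stk 0, intSize z ≤ w) :
    ∃ τ, Runs ω (linProg rows) σ τ (2000 * ((σ.stk 0).length + 1)) (4 * B + 4 * w)
        (40000 * (B * (listSize (σ.stk 0) + 1))) ∧
        Frame σ τ ∧ τ.stk 1 = [] ∧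
        (∀ gs : List (Fin 4 → ℤ), σ.stk 0 = gs.flatMap List.ofFn →
          τ.stk 0 = gs.flatMap fun v => rows.map fun c => c ⬝ᵥ v) ∧
        listSize (τ.stk 0) ≤ 40000 * (B * (listSize (σ.stk 0) + 1)) ∧
        ∀ z ∈ τ.stk 0, intSize z ≤ 4 * B + 4 * w := by
  set σ' := σ.set 0 (flag (σ.stk 0)) with hσ'
  have e0 : σ'.stk 0 = σ.stk 0 := rfl
  have e1 : σ'.stk 1 = [] := h1
  have r0 := runs_flag (ω := ω) σ 0 (W := 4 * B + 4 * w) (by omega)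
  obtain ⟨τ, out, r1, f1, s1, t1, g1⟩ := runs_loop (ω := ω) hrows hc hB hw _ σ' le_rfl
    (by simp [hσ', State.set]) (by rw [e0]; exact hl)
  rw [e1, List.append_nil] at t1
  rw [e0] at r1 g1
  -- The results are bounded by the cost of the run that pushed them.
  have hgrow : out.length ≤ 301 * (σ.stk 0).length + 1 ∧
      listSize out ≤ 3000 * (B * listSize (σ.stk 0)) + 1 ∧
      ∀ z ∈ out, intSize z ≤ 4 * B + 4 * w := by
    obtain ⟨m, hm, m1, m2, m3⟩ := r1
    obtain ⟨a1, a2, a3⟩ := hm.grows 1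
    rw [e1, t1] at a1 a2 a3
    rw [List.length_reverse] at a1
    rw [listSize_reverse] at a2
    simp only [List.length_nil, listSize_nil, zero_add] at a1 a2
    exact ⟨a1.trans m1, a2.trans m3, fun z hz => a3 _ m2 (by simp) z (List.mem_reverse.mpr hz)⟩
  obtain ⟨b1, b2, b3⟩ := hgrow
  have r2 := runs_flag (ω := ω) τ 1 (W := 4 * B + 4 * w) (by omega)
  obtain ⟨υ, r3, f3, s3, t3⟩ := runs_move (ω := ω) (w := 4 * B + 4 * w) (by omega) out.reverse
    (τ.set 0 (flag (τ.stk 1))) t1 (by simp [State.set, t1]) (fun z hz => b3 z (List.mem_reverse.mp hz))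
  have t3' : υ.stk 0 = out := by
    rw [t3]
    change out.reverse.reverse ++ τ.stk 0 = out
    rw [s1, List.reverse_reverse, List.append_nil]
  rw [List.length_reverse, listSize_reverse] at r3
  have hX : B * (listSize (σ.stk 0) + 1) = B * listSize (σ.stk 0) + B := by ring
  have hlen := length_le_listSize (σ.stk 0)
  refine ⟨υ, (r0.seq (r1.seq (r2.seq r3))).mono ?_ le_rfl ?_,
    ((frame_set σ (by omega) _).trans f1).trans ((frame_set τ (by omega) _).trans f3), s3, ?_, ?_,
    ?_⟩
  · omega
  · rw [hX]; omega
  · rw [t3']; exact g1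
  · rw [t3', hX]; omega
  · rw [t3']; exact b3

/-- Set the registers used by linear maps to zero. -/
def clearProg : Prog :=
  ops [.const 0 0, .const 1 0, .const 2 0, .const 3 0, .const 4 0, .const 5 0, .const 6 0]

/-- A has to start exactly in an initial state. Stack 1 is empty, the touched registers are reset,
and no coin has been read, so A sees the same coin sequence as it would on its own. -/
theorem runs_clear {x : List ℤ} {τ : State} (hf : Frame (initState x) τ) (h1 : τ.stk 1 = []) :
    Runs ω clearProg τ (initState (τ.stk 0)) 8 1 8 := by
  have h0 := intSize_zero
  have hτ : runOps ω [.const 0 0, .const 1 0, .const 2 0, .const 3 0, .const 4 0, .const 5 0,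
      .const 6 0] τ = initState (τ.stk 0) := by
    obtain ⟨f1, f2, f3⟩ := hf
    obtain ⟨reg, stk, pos⟩ := τ
    simp only [runOps, Op.next, Op.val, State.set, initState, State.mk.injEq]
    simp only [initState] at f1 f2 f3
    refine ⟨?_, ?_, f3⟩
    · funext r
      by_cases hr : 6 < r
      · have : r ≠ 0 ∧ r ≠ 1 ∧ r ≠ 2 ∧ r ≠ 3 ∧ r ≠ 4 ∧ r ≠ 5 ∧ r ≠ 6 := by omega
        simp [this, f1 r hr]
      · interval_cases r <;> simp
    · funext k
      by_cases hk : k = 0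
      · subst hk; simp
      by_cases hk1 : k = 1
      · subst hk1; simpa using h1
      · rw [f2 k (by omega)]
        simp [hk]
  rw [← hτ]
  refine (Runs.ops ?_).mono le_rfl le_rfl ?_
  · simp only [WidthOps, Op.val, h0, le_refl, and_self]
  · simp only [timeOps, Op.bitOps, Op.val, h0]
    norm_num

/-- Empty stack `1`. -/
def drainProg : Prog :=
  .seq (.op (.nonempty 0 1)) (.loop 0 (ops [.pop 1 1, .nonempty 0 1]))

theorem runs_drain_loop {w : ℕ} (hw : 2 ≤ w) (l : List ℤ) :
    ∀ σ : State, σ.stk 1 = l → σ.reg 0 = flag l → (∀ z ∈ l, intSize z ≤ w) →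
      ∃ τ, Runs ω (.loop 0 (ops [.pop 1 1, .nonempty 0 1])) σ τ (4 * l.length + 1) w
        (10 * listSize l + 1) ∧ τ.stk 1 = [] ∧ τ.stk 0 = σ.stk 0 := by
  induction l with
  | nil =>
    intro σ hl hr _
    exact ⟨σ, (Runs.loop_done _ (by rw [hr, flag_pos]; simp)).mono (by simp) le_rfl (by simp),
      hl, rfl⟩
  | cons z l ih =>
    intro σ hl hr hz
    have hbody : ∃ τ, Runs ω (ops [.pop 1 1, .nonempty 0 1]) σ τ 3 w (intSize z + 3) ∧
        τ.stk 1 = l ∧ τ.stk 0 = σ.stk 0 ∧ τ.reg 0 = flag l := by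
      have hz' := hz z List.mem_cons_self
      have hf := intSize_flag_le l
      refine ⟨_, (Runs.ops ?_).mono le_rfl le_rfl ?_, ?_, ?_, ?_⟩
      · simp only [WidthOps, Op.val, Op.next, State.set, Function.update_self, hl,
          List.headD_cons, List.tail_cons]
        exact ⟨hz', hf.trans hw, trivial⟩
      · simp only [timeOps, Op.bitOps, Op.val, Op.next, State.set, Function.update_self, hl,
          List.headD_cons, List.tail_cons]
        rw [flag] at hf
        omega
      · simp [runOps, Op.next, State.set, hl]
      · simp [runOps, Op.next, State.set]
      · simp [runOps, Op.next, Op.val, State.set, hl, flag]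
    obtain ⟨τ, h1, s1, t1, r1⟩ := hbody
    obtain ⟨υ, h2, s2, t2⟩ := ih τ s1 r1 fun y hy => hz y (List.mem_cons_of_mem _ hy)
    have ho := one_le_intSize z
    refine ⟨υ, (Runs.loop_step (by rw [hr, flag_pos]; simp) h1 h2).mono ?_ le_rfl ?_,
      s2, t2.trans t1⟩
    · rw [List.length_cons]; omega
    · rw [listSize_cons]; omega

/-- A may leave integers on stack 1, which the second linear program needs empty. -/
theorem runs_drain {w : ℕ} (hw : 2 ≤ w) {σ : State} (hz : ∀ z ∈ σ.stk 1, intSize z ≤ w) :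
    ∃ τ, Runs ω drainProg σ τ (4 * (σ.stk 1).length + 2) w (10 * listSize (σ.stk 1) + 3) ∧
      τ.stk 1 = [] ∧ τ.stk 0 = σ.stk 0 := by
  obtain ⟨τ, h, s, t⟩ := runs_drain_loop (ω := ω) hw _ (σ.set 0 (flag (σ.stk 1))) rfl
    (by simp [State.set]) hz
  exact ⟨τ, ((runs_flag σ 1 hw).seq h).mono (by simp [State.set]; omega) le_rfl
    (by simp [State.set]; omega), s, t⟩

/-- The program `A` between two linear maps. -/
def sandwich (rows rows' : List (Fin 4 → ℤ)) (A : Prog) : Prog :=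
  .seq (.seq (linProg rows) clearProg) (.seq A (.seq drainProg (linProg rows')))

theorem coinFree_rowsProg (rows : List (Fin 4 → ℤ)) : (rowsProg rows).CoinFree := by
  induction rows with
  | nil => trivial
  | cons c l ih => exact ⟨by simp [rowOps, ops, Prog.CoinFree], ih⟩

theorem coinFree_linProg (rows : List (Fin 4 → ℤ)) : (linProg rows).CoinFree := by
  simp [linProg, chunk, loadOps, moveBody, ops, Prog.CoinFree, coinFree_rowsProg]

theorem coinFree_sandwich {rows rows' : List (Fin 4 → ℤ)} {A : Prog} (h : A.CoinFree) :
    (sandwich rows rows' A).CoinFree := by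
  refine ⟨⟨coinFree_linProg _, ?_⟩, h, ?_, coinFree_linProg _⟩
  · simp [clearProg, ops, Prog.CoinFree]
  · simp [drainProg, ops, Prog.CoinFree]

theorem size_rowsProg_le {rows : List (Fin 4 → ℤ)} {B : ℕ} (hB : 1 ≤ B)
    (hc : ∀ c ∈ rows, ∀ i, intSize (c i) ≤ B) :
    (rowsProg rows).size ≤ 40 * B * rows.length + 1 := by
  induction rows with
  | nil => simp [rowsProg, Prog.size]
  | cons c l ih =>
    have h0 := hc c List.mem_cons_self 0
    have h1 := hc c List.mem_cons_self 1
    have h2 := hc c List.mem_cons_self 2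
    have h3 := hc c List.mem_cons_self 3
    have := ih fun d hd => hc d (List.mem_cons_of_mem _ hd)
    rw [List.length_cons, mul_add, mul_one]
    simp only [rowsProg, rowOps, ops, Prog.size]
    omega

theorem size_linProg_le {rows : List (Fin 4 → ℤ)} {B : ℕ} (hrows : rows.length = 16) (hB : 1 ≤ B)
    (hc : ∀ c ∈ rows, ∀ i, intSize (c i) ≤ B) : (linProg rows).size ≤ 1000 * B := by
  have := size_rowsProg_le hB hc
  rw [hrows] at this
  simp only [linProg, chunk, loadOps, moveBody, ops, Prog.size]
  omega

theorem size_sandwich_le {rows rows' : List (Fin 4 → ℤ)} {B B' : ℕ} (A : Prog)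
    (hrows : rows.length = 16) (hc : ∀ c ∈ rows, ∀ i, intSize (c i) ≤ B) (hB : 1 ≤ B)
    (hrows' : rows'.length = 16) (hc' : ∀ c ∈ rows', ∀ i, intSize (c i) ≤ B') (hB' : 1 ≤ B') :
    (sandwich rows rows' A).size ≤ A.size + 2000 * (B + B') := by
  have h1 := size_linProg_le hrows hB hc
  have h2 := size_linProg_le hrows' hB' hc'
  have h0 := intSize_zero
  simp only [sandwich, clearProg, drainProg, ops, Prog.size, h0]
  omega

/-- The size is read off from a run of the program computing the list; the choice of coins is
immaterial. -/
theorem listSize_map_rows_le {rows : List (Fin 4 → ℤ)} {B : ℕ} (hrows : rows.length = 16)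
    (hc : ∀ c ∈ rows, ∀ i, intSize (c i) ≤ B) (hB : 1 ≤ B) (gs : List (Fin 4 → ℤ)) :
    listSize (gs.flatMap fun v => rows.map fun c => c ⬝ᵥ v) ≤
      40000 * (B * (listSize (gs.flatMap List.ofFn) + 1)) := by
  set x := gs.flatMap List.ofFn with hx
  obtain ⟨τ, -, -, -, h1, h2, -⟩ := runs_linProg (ω := fun _ => false) (w := listSize x + 1)
    (σ := initState x) hrows hc hB (by omega) rfl
    (fun z hz => (intSize_le_listSize hz).trans (Nat.le_succ _))
  rw [← h1 gs hx]
  exact h2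

/-- The numbers of instructions do not involve B and B', since a multiplication is one step whatever
its operands. The widths of the constants add, whereas the bit operations acquire the product B B':
the first map enlarges its input by a factor of order B, and the second one multiplies by constants
of length B'. -/
theorem halts_sandwich {rows rows' : List (Fin 4 → ℤ)} {B B' : ℕ} {A : Prog}
    (hrows : rows.length = 16) (hc : ∀ c ∈ rows, ∀ i, intSize (c i) ≤ B) (hB : 1 ≤ B)
    (hrows' : rows'.length = 16) (hc' : ∀ c ∈ rows', ∀ i, intSize (c i) ≤ B') (hB' : 1 ≤ B')
    {gs : List (Fin 4 → ℤ)} {m : Cost} {y : List ℤ}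
    (hA : Halts A (gs.flatMap fun v => rows.map fun c => c ⬝ᵥ v) ω m y) :
    ∃ m' y', Halts (sandwich rows rows' A) (gs.flatMap List.ofFn) ω m' y' ∧
      (∀ hs : List (Fin 4 → ℤ), y = hs.flatMap List.ofFn →
        y' = hs.flatMap fun v => rows'.map fun c => c ⬝ᵥ v) ∧
      m'.steps ≤ 10 ^ 8 * (m.steps + listSize (gs.flatMap List.ofFn) + 1) ∧
      m'.width ≤ 10 ^ 3 * (B + B' + m.width + listSize (gs.flatMap List.ofFn)) ∧
      m'.time ≤ 10 ^ 12 * (B * B' * (m.time + listSize (gs.flatMap List.ofFn) + 1)) := by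
  set x := gs.flatMap List.ofFn with hx
  obtain ⟨τ, r1, f1, s1, g1, z1, w1⟩ := runs_linProg (ω := ω) (w := listSize x + 1)
    (σ := initState x) hrows hc hB (by omega) rfl
    (fun z hz => (intSize_le_listSize hz).trans (Nat.le_succ _))
  have hx0 : (initState x).stk 0 = x := rfl
  rw [hx0] at r1 z1 g1
  have r2 := runs_clear (ω := ω) f1 s1
  have gx := g1 gs hx
  -- Bounding the length of the intermediate list by steps keeps B out of the step count, whereas
  -- its bit size carries a factor B.
  have hstep : (τ.stk 0).length ≤ 2001 * (x.length + 1) := by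
    obtain ⟨n1, e1, a1, -, -⟩ := r1
    obtain ⟨n2, e2, a2, -, -⟩ := runs_clear (ω := ω) f1 s1
    have := (e1.grows 0).1
    rw [hx0] at this
    omega
  set x' := τ.stk 0 with hx'
  rw [← gx] at hA
  obtain ⟨υ, eA, rfl⟩ := hA
  have G0 := eA.grows 0
  have G1 := eA.grows 1
  have hi0 : (initState x').stk 0 = x' := rfl
  have hi1 : (initState x').stk 1 = [] := rfl
  rw [hi0] at G0
  rw [hi1] at G1
  obtain ⟨a1, a2, a3⟩ := G0
  obtain ⟨b1, b2, b3⟩ := G1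
  simp only [List.length_nil, listSize_nil, zero_add] at b1 b2
  obtain ⟨φ, r4, s4, t4⟩ := runs_drain (ω := ω) (w := m.width + 2) (σ := υ) (by omega)
    (b3 _ (by omega) (by simp))
  have hy : ∀ z ∈ φ.stk 0, intSize z ≤ m.width + (4 * B + 4 * (listSize x + 1)) := by
    rw [t4]
    exact a3 _ (by omega) fun z hz => (w1 z hz).trans (by omega)
  obtain ⟨ψ, r5, -, -, g5, -, -⟩ := runs_linProg (ω := ω) (σ := φ) hrows' hc' hB' (by omega) s4 hy
  rw [t4] at r5 g5
  set Wd := 10 ^ 3 * (B + B' + m.width + listSize x) with hWd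
  have rA : Runs ω A (initState x') υ m.steps Wd m.time := ⟨m, eA, le_rfl, by omega, le_rfl⟩
  obtain ⟨m', e', c1, c2, c3⟩ := ((r1.mono le_rfl (by omega) le_rfl).seq
    (r2.mono le_rfl (by omega) le_rfl)).seq
    (rA.seq ((r4.mono le_rfl (by omega) le_rfl).seq (r5.mono le_rfl (by omega) le_rfl)))
  have hlx : x.length ≤ listSize x := length_le_listSize x
  refine ⟨m', ψ.stk 0, ⟨ψ, e', rfl⟩, g5, ?_, c2, ?_⟩
  · refine c1.trans ?_
    clear_value x' Wd
    clear c2 c3 hWd hx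
    norm_num
    linarith
  · refine c3.trans ?_
    have k1 : listSize (υ.stk 0) + 1 ≤ 80001 * (B * (m.time + listSize x + 1)) := by
      have q1 : m.time ≤ B * m.time := Nat.le_mul_of_pos_left _ hB
      have q2 : B * (m.time + listSize x + 1) = B * m.time + B * (listSize x + 1) := by ring
      have q3 : 1 ≤ B * (listSize x + 1) := Nat.mul_pos hB (by omega)
      omega
    have k2 : B' * (listSize (υ.stk 0) + 1) ≤ 80001 * (B * B' * (m.time + listSize x + 1)) := by
      refine (Nat.mul_le_mul_left B' k1).trans_eq (by ring)
    have k3 : B * (listSize x + 1) ≤ B * B' * (m.time + listSize x + 1) :=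
      Nat.mul_le_mul (Nat.le_mul_of_pos_right _ hB') (by omega)
    have k4 : m.time + listSize x + 1 ≤ B * B' * (m.time + listSize x + 1) :=
      Nat.le_mul_of_pos_left _ (Nat.mul_pos hB hB')
    omega

end Transform

section Costs

open MeasureTheory

/-! ### Expected and largest costs -/

instance : IsProbabilityMeasure coin := by
  unfold coin
  infer_instance

theorem runCost_eq {f : Cost → ℕ} {A : Prog} {x : List ℤ} {ω : ℕ → Bool} {m : Cost} {y : List ℤ}
    (h : Halts A x ω m y) : runCost f A x ω = f m := by
  refine le_antisymm (iInf_le_of_le m (iInf_le_of_le y (iInf_le _ h))) ?_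
  refine le_iInf fun m' => le_iInf fun y' => le_iInf fun h' => ?_
  obtain ⟨τ, e, -⟩ := h
  obtain ⟨τ', e', -⟩ := h'
  rw [(e.det e').1]

/-- The comparison is made for one fixed coin sequence. If A does not halt, the right side is c · ∞,
which is ∞ because c ≠ 0. -/
theorem runCost_le {f : Cost → ℕ} {A A' : Prog} {x x' : List ℤ} {ω : ℕ → Bool} {c d : ℕ}
    (hc : c ≠ 0) (h : ∀ m y, Halts A x' ω m y → ∃ m' y', Halts A' x ω m' y' ∧
      f m' ≤ c * (f m + d)) : runCost f A' x ω ≤ c * (runCost f A x' ω + d) := by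
  by_cases hh : ∃ m y, Halts A x' ω m y
  · obtain ⟨m, y, hm⟩ := hh
    obtain ⟨m', y', hm', hf⟩ := h m y hm
    rw [runCost_eq hm, runCost_eq hm']
    exact_mod_cast hf
  · have : runCost f A x' ω = ⊤ := by
      refine iInf_eq_top.mpr fun m => iInf_eq_top.mpr fun y => iInf_eq_top.mpr fun hm => ?_
      exact absurd ⟨m, y, hm⟩ hh
    rw [this, top_add, ENNReal.mul_top (by exact_mod_cast hc)]
    exact le_top

/-- Some run in an almost sure event costs no more than the mean. Applied to the width, it selects
the run whose output is built into A'. -/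
theorem exists_runCost_le (f : Cost → ℕ) (A : Prog) (x : List ℤ) {p : (ℕ → Bool) → Prop}
    (hp : ∀ᵐ ω ∂coin, p ω) (hA : ∀ ω, p ω → ∃ m y, Halts A x ω m y) :
    ∃ ω, p ω ∧ runCost f A x ω ≤ ∫⁻ ω, runCost f A x ω ∂coin := by
  set I := ∫⁻ ω, runCost f A x ω ∂coin with hI
  by_contra! h
  obtain ⟨ω, hω⟩ := hp.exists
  have htop : I ≠ ⊤ := ((h ω hω).trans_le le_top).ne
  -- Costs are integers, so exceeding I means being at least ⌊I⌋ + 1. Comparison with this constant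
  -- needs no measurability of the cost.
  have hle : ((⌊I.toNNReal⌋₊ + 1 : ℕ) : ℝ≥0∞) ≤ I := by
    calc ((⌊I.toNNReal⌋₊ + 1 : ℕ) : ℝ≥0∞)
        = ∫⁻ _, ((⌊I.toNNReal⌋₊ + 1 : ℕ) : ℝ≥0∞) ∂coin := by
          rw [lintegral_const, measure_univ, mul_one]
      _ ≤ I := by
          refine lintegral_mono_ae (hp.mono fun ω hω => ?_)
          obtain ⟨m, y, hm⟩ := hA ω hω
          have := h ω hω
          rw [runCost_eq hm, ← ENNReal.coe_toNNReal htop] at this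
          rw [runCost_eq hm, Nat.cast_le, Nat.succ_le_iff]
          refine (Nat.floor_lt zero_le).mpr ?_
          exact_mod_cast this
  rw [← ENNReal.coe_toNNReal htop] at hle
  have h' : ((⌊I.toNNReal⌋₊ + 1 : ℕ) : NNReal) ≤ I.toNNReal := by exact_mod_cast hle
  have := Nat.lt_floor_add_one I.toNNReal
  push_cast at h'
  exact absurd h' this.not_ge

variable {a b : ℤ} {O₁ O₂ : Subring (Quat a b)} {e₁ : Module.Basis (Fin 4) ℤ O₁}
  {e₂ : Module.Basis (Fin 4) ℤ O₂} {f : Cost → ℕ} {A A' : Prog} {n n' c d : ℕ}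

theorem lintegral_le_expCost {x : List ℤ} (hx : x ∈ inputs e₁ n) :
    ∫⁻ ω, runCost f A x ω ∂coin ≤ expCost f e₁ A n :=
  le_iSup₂_of_le x hx le_rfl

theorem expCost_mono (h : n ≤ n') : expCost f e₁ A n ≤ expCost f e₁ A n' :=
  iSup₂_le fun _ hx => lintegral_le_expCost ⟨hx.1.trans h, hx.2⟩

theorem expCost_le_maxCost : expCost f e₁ A n ≤ maxCost f e₁ A n := by
  refine iSup₂_mono fun x _ => ?_
  refine (lintegral_mono fun ω => le_iSup (fun ω => runCost f A x ω) ω).trans ?_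
  rw [lintegral_const, measure_univ, mul_one]

theorem expCost_le (h : ∀ x ∈ inputs e₂ n, ∃ x' ∈ inputs e₁ n', ∀ ω,
    runCost f A' x ω ≤ c * (runCost f A x' ω + d)) :
    expCost f e₂ A' n ≤ c * (expCost f e₁ A n' + d) := by
  refine iSup₂_le fun x hx => ?_
  obtain ⟨x', hx', hω⟩ := h x hx
  refine (lintegral_mono hω).trans ?_
  -- The second summand is constant and c is finite, so the integral splits without measurability of
  -- `runCost`.
  rw [lintegral_const_mul' _ _ (ENNReal.natCast_ne_top c), lintegral_add_right _ measurable_const,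
    lintegral_const, measure_univ, mul_one]
  gcongr
  exact lintegral_le_expCost hx'

theorem maxCost_le (h : ∀ x ∈ inputs e₂ n, ∃ x' ∈ inputs e₁ n', ∀ ω,
    runCost f A' x ω ≤ c * (runCost f A x' ω + d)) :
    maxCost f e₂ A' n ≤ c * (maxCost f e₁ A n' + d) := by
  refine iSup₂_le fun x hx => iSup_le fun ω => ?_
  obtain ⟨x', hx', hω⟩ := h x hx
  refine (hω ω).trans ?_
  gcongr
  exact le_iSup₂_of_le x' hx' (le_iSup (fun ω => runCost f A x' ω) ω)

end Costs

/-! ### Matrices as lists of rows. -/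

section Rows

/-- All rows of a list of matrices. -/
def rowsOf (M : Fin 4 → Matrix (Fin 4) (Fin 4) ℤ) : List (Fin 4 → ℤ) :=
  (List.ofFn M).flatMap fun m => List.ofFn fun i => m i

theorem length_rowsOf (M : Fin 4 → Matrix (Fin 4) (Fin 4) ℤ) : (rowsOf M).length = 16 := by
  simp [rowsOf, List.ofFn_succ]

theorem intSize_rowsOf_le {M : Fin 4 → Matrix (Fin 4) (Fin 4) ℤ} {B : ℕ}
    (h : ∀ j i k, intSize (M j i k) ≤ B) : ∀ c ∈ rowsOf M, ∀ i, intSize (c i) ≤ B := by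
  intro c hc i
  obtain ⟨m, hm, hc⟩ := List.mem_flatMap.mp hc
  obtain ⟨j, rfl⟩ := List.mem_ofFn.mp hm
  obtain ⟨k, rfl⟩ := List.mem_ofFn.mp hc
  exact h j k i

theorem flatMap_rowsOf (M : Fin 4 → Matrix (Fin 4) (Fin 4) ℤ) (gs : List (Fin 4 → ℤ)) :
    (gs.flatMap fun v => (rowsOf M).map fun c => c ⬝ᵥ v) = (transList M gs).flatMap List.ofFn := by
  rw [transList, List.flatMap_assoc]
  refine List.flatMap_congr fun v _ => ?_
  simp [rowsOf, List.ofFn_succ, Matrix.mulVec]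

theorem listSize_unitList : listSize (unitList.flatMap List.ofFn) ≤ 32 := by
  simp [unitList, List.ofFn_succ, intSize_zero, intSize_one]

end Rows

/-! ### Assembly of the constants and of the new program. -/

section Main

open MeasureTheory

/-- B is linear in s, and B' is linear in s + w + X with X itself linear in s; so B B' is quadratic
in s and linear in w + 1. The spare factor q between q⁴ s² and q⁵ s² absorbs the numerical
constants. The 33 is one more than the bound 32 for `unitList`. -/
theorem bounds_le {q s w X B B' : ℕ} (hq : 10 ^ 20 ≤ q) (hs : 1 ≤ s) (hB : B = q * s)
    (hX : X ≤ 40000 * (B * 33)) (hB' : B' = q * (s + (w + X))) :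
    40000 * B ≤ q ^ 5 * s ^ 2 ∧ X ≤ q ^ 5 * s ^ 2 ∧ B + B' ≤ q ^ 4 * s ^ 2 * (w + 1) ∧
      10 ^ 12 * (q ^ 4 * s ^ 2) ≤ q ^ 5 * s ^ 2 ∧ 10 ^ 12 * (B * B') ≤ q ^ 5 * s ^ 2 * (w + 1) := by
  have hD : 10 ^ 12 * (q ^ 4 * s ^ 2) ≤ q ^ 5 * s ^ 2 := by
    calc 10 ^ 12 * (q ^ 4 * s ^ 2) ≤ q * (q ^ 4 * s ^ 2) :=
          Nat.mul_le_mul_right _ ((by norm_num : 10 ^ 12 ≤ 10 ^ 20).trans hq)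
      _ = q ^ 5 * s ^ 2 := by ring
  have h1 : B ≤ q ^ 4 * s ^ 2 := by
    rw [hB]
    exact Nat.mul_le_mul (Nat.le_self_pow (by norm_num) q) (Nat.le_self_pow (by norm_num) s)
  have h2 : B' ≤ q ^ 3 * s * (w + 1) := by
    calc B' ≤ q * (s + (w + 40000 * (q * s * 33))) := by rw [hB', ← hB]; gcongr
      _ ≤ q * (q * s * (w + 1) + 1320000 * (q * s * (w + 1))) := by
          have a1 : s + w ≤ s * (w + 1) := by nlinarith
          have a2 : s * (w + 1) ≤ q * s * (w + 1) := by
            rw [mul_assoc]; exact Nat.le_mul_of_pos_left _ (by omega)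
          have a3 : q * s ≤ q * s * (w + 1) := Nat.le_mul_of_pos_right _ (by omega)
          exact Nat.mul_le_mul_left _ (by omega)
      _ = 1320001 * (q ^ 2 * s * (w + 1)) := by ring
      _ ≤ q * (q ^ 2 * s * (w + 1)) :=
          Nat.mul_le_mul_right _ ((by norm_num : 1320001 ≤ 10 ^ 20).trans hq)
      _ = q ^ 3 * s * (w + 1) := by ring
  refine ⟨by omega, by omega, ?_, hD, ?_⟩
  · have b1 : B ≤ q ^ 3 * s * (w + 1) := by
      rw [hB]
      calc q * s ≤ q ^ 3 * s * 1 := by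
            rw [mul_one]; exact Nat.mul_le_mul_right _ (Nat.le_self_pow (by norm_num) q)
        _ ≤ _ := Nat.mul_le_mul_left _ (by omega)
    calc B + B' ≤ 2 * (q ^ 3 * s * (w + 1)) := by omega
      _ ≤ q * s * (q ^ 3 * s * (w + 1)) :=
          Nat.mul_le_mul_right _ ((by omega : 2 ≤ q).trans (Nat.le_mul_of_pos_right _ hs))
      _ = q ^ 4 * s ^ 2 * (w + 1) := by ring
  · calc 10 ^ 12 * (B * B') ≤ 10 ^ 12 * (q * s * (q ^ 3 * s * (w + 1))) := by
          rw [hB] at *; gcongr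
      _ = 10 ^ 12 * (q ^ 4 * s ^ 2) * (w + 1) := by ring
      _ ≤ _ := Nat.mul_le_mul_right _ hD

variable {a b : ℤ} {O₁ O₂ : Subring (Quat a b)} {e₁ : Module.Basis (Fin 4) ℤ O₁}
  {e₂ : Module.Basis (Fin 4) ℤ O₂}

theorem genIdeal_unitList_ne_bot : genIdeal e₂ unitList ≠ ⊥ := by
  intro h
  have h0 : e₂ 0 ∈ genIdeal e₂ unitList := by rw [genIdeal_unitList]; trivial
  rw [h] at h0
  exact e₂.ne_zero 0 h0

theorem intSize_output_le {ω : ℕ → Bool} {A : Prog} {x : List ℤ} {m : Cost}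
    {hs : List (Fin 4 → ℤ)} (h : Halts A x ω m (hs.flatMap List.ofFn)) :
    ∀ v ∈ hs, ∀ i, intSize (v i) ≤ m.width + listSize x := by
  intro v hv i
  obtain ⟨τ, e, hτ⟩ := h
  refine (e.grows 0).2.2 _ (Nat.le_add_right _ _) ?_ _ ?_
  · exact fun z hz => (intSize_le_listSize hz).trans (Nat.le_add_left _ _)
  · rw [hτ]
    exact List.mem_flatMap.mpr ⟨v, hv, List.mem_ofFn.mpr ⟨i, rfl⟩⟩

/-- Here w is the width of one successful run of A on the image of the unit ideal. A' contains only
the matrices derived from its output and never repeats that run. The cost bounds are stated for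
every coin sequence on which A halts, so they serve both the expected and the worst case. -/
theorem exists_transfer {q : ℕ} (hq : q = 10 ^ 80) (ha : a < 0) (hb : b < 0)
    (hO₁ : IsMaximalOrder O₁)
    (hO₂ : IsMaximalOrder O₂) {C : ℕ} (hC : C = q ^ 5 * specSize e₁ e₂ ^ 2) {ℓ : ℕ}
    (hℓ : ℓ.Prime) {A : Prog} (hA : SolvesPath e₁ ℓ A) :
    ∃ (A' : Prog) (w D B B' : ℕ), (w : ℝ≥0∞) ≤ expCost Cost.width e₁ A C ∧
      10 ^ 12 * D ≤ C ∧ 0 < D ∧ B + B' ≤ D * (w + 1) ∧ 10 ^ 12 * (B * B') ≤ C * (w + 1) ∧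
      0 < B ∧ 0 < B' ∧
      SolvesPath e₂ ℓ A' ∧ (A.CoinFree → A'.CoinFree) ∧ A'.size ≤ A.size + 2000 * (B + B') ∧
      ∀ n, ∀ x ∈ inputs e₂ n, ∃ x' ∈ inputs e₁ (C * (n + 1)), ∀ ω m y, Halts A x' ω m y →
        ∃ m' y', Halts A' x ω m' y' ∧ m'.steps ≤ 10 ^ 8 * (m.steps + (n + 1)) ∧
          m'.width ≤ 10 ^ 3 * (m.width + (B + B' + n)) ∧
          m'.time ≤ 10 ^ 12 * (B * B') * (m.time + (n + 1)) := by
  set s := specSize e₁ e₂ with hs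
  have hs1 : 1 ≤ s := by
    have := one_le_orderSize (e := e₁)
    rw [hs, specSize]; omega
  obtain ⟨M, hM, hbot, hpost⟩ := exists_reduction ha hb hO₁ hO₂ e₁ e₂
  rw [← hs, ← hq] at hM
  have hq1 : 10 ^ 20 ≤ q := by rw [hq]; exact Nat.pow_le_pow_right (by norm_num) (by norm_num)
  have hB : 1 ≤ q * s := Nat.mul_pos (by omega) hs1
  have hrows := intSize_rowsOf_le hM
  have hsize : ∀ gs : List (Fin 4 → ℤ), listSize ((transList M gs).flatMap List.ofFn) ≤
      40000 * (q * s * (listSize (gs.flatMap List.ofFn) + 1)) := by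
    intro gs
    rw [← flatMap_rowsOf]
    exact listSize_map_rows_le (length_rowsOf M) hrows hB gs
  set x₀ := (transList M unitList).flatMap List.ofFn with hx₀
  have hX : listSize x₀ ≤ 40000 * (q * s * 33) := by
    refine (hsize unitList).trans ?_
    have := listSize_unitList
    gcongr
    omega
  have hx₀bot := hbot _ (genIdeal_unitList_ne_bot (e₂ := e₂))
  have hrep₀ : Represents e₁ x₀ (genIdeal e₁ (transList M unitList)) := ⟨_, hx₀, rfl⟩
  -- One coin sequence on which A answers correctly for the connecting ideal, with width at most the
  -- expected one.
  obtain ⟨ω₀, ⟨m₀, y₀, J₀, h₀, ⟨hs₀, rfl, rfl⟩, hequiv₀, k₀, hk₀⟩, hcost₀⟩ :=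
    exists_runCost_le Cost.width A x₀ (hA _ _ hx₀bot hrep₀)
      (fun ω ⟨m, y, _, h, _⟩ => ⟨m, y, h⟩)
  rw [runCost_eq h₀] at hcost₀
  obtain ⟨M', hM', hout⟩ := hpost ℓ hℓ hs₀ _ k₀ hequiv₀ hk₀ (intSize_output_le h₀)
  rw [← hs, ← hq] at hM'
  obtain ⟨n1, n2, n3, n4, n5⟩ := bounds_le (w := m₀.width) hq1 hs1 rfl hX rfl
  rw [← hC] at n1 n2 n4 n5
  have hB' : 1 ≤ q * (s + (m₀.width + listSize x₀)) := Nat.mul_pos (by omega) (by omega)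
  set B := q * s
  set B' := q * (s + (m₀.width + listSize x₀))
  have hrows' := intSize_rowsOf_le hM'
  refine ⟨sandwich (rowsOf M) (rowsOf M') A, m₀.width, q ^ 4 * s ^ 2, B, B', ?_, n4, ?_, n3, n5,
    hB, hB', ?_, coinFree_sandwich,
    size_sandwich_le A (length_rowsOf M) hrows hB (length_rowsOf M') hrows' hB', ?_⟩
  · exact hcost₀.trans (lintegral_le_expCost ⟨n2, _, hx₀bot, hrep₀⟩)
  · exact Nat.mul_pos (pow_pos (by omega) 4) (pow_pos hs1 2)
  · rintro _ _ hI ⟨gs, rfl, rfl⟩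
    refine (hA _ _ (hbot gs hI) ⟨_, rfl, rfl⟩).mono ?_
    rintro ω ⟨m, _, _, hm, ⟨hs', rfl, rfl⟩, hequiv, hk⟩
    rw [← flatMap_rowsOf] at hm
    obtain ⟨m', y', hm', hy', -⟩ := halts_sandwich (length_rowsOf M) hrows hB (length_rowsOf M')
      hrows' hB' hm
    obtain ⟨h1, h2⟩ := hout gs hs' hequiv hk
    refine ⟨m', y', _, hm', ⟨transList M' hs', ?_, rfl⟩, h1, h2⟩
    rw [hy' hs' rfl, flatMap_rowsOf]
  · rintro n _ ⟨hn, _, hI, gs, rfl, rfl⟩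
    refine ⟨(transList M gs).flatMap List.ofFn, ⟨?_, _, hbot gs hI, ⟨_, rfl, rfl⟩⟩, ?_⟩
    · calc _ ≤ 40000 * (B * (n + 1)) := (hsize gs).trans (by gcongr)
        _ = 40000 * B * (n + 1) := by ring
        _ ≤ _ := Nat.mul_le_mul_right _ n1
    · intro ω m y hm
      rw [← flatMap_rowsOf] at hm
      obtain ⟨m', y', hm', -, c1, c2, c3⟩ := halts_sandwich (length_rowsOf M) hrows hB
        (length_rowsOf M') hrows' hB' hm
      refine ⟨m', y', hm', c1.trans ?_, c2.trans ?_, c3.trans ?_⟩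
      · refine Nat.mul_le_mul_left _ ?_
        omega
      · refine Nat.mul_le_mul_left _ ?_
        omega
      · rw [← mul_assoc]
        exact Nat.mul_le_mul_left _ (by omega)

/-- The built-in constants enter the width additively, and w is at most the width E of A, so they
are absorbed into E. In the bit operations they enter as a factor, which is why w + 1 remains there.
-/
theorem width_bound {D C n : ℕ} {E : ℝ≥0∞} {N w : ℕ} (hD : 0 < D) (hC : 10 ^ 12 * D ≤ C)
    (hN : N ≤ D * (w + 1)) (hw : (w : ℝ≥0∞) ≤ E) :
    ((10 ^ 3 : ℕ) : ℝ≥0∞) * (E + (N + n : ℕ)) ≤ C * (E + n + 1) := by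
  have hD1 : (1 : ℝ≥0∞) ≤ D := by exact_mod_cast hD
  have hN' : (N : ℝ≥0∞) ≤ D * (E + n + 1) := by
    calc (N : ℝ≥0∞) ≤ D * (w + 1) := by exact_mod_cast hN
      _ ≤ _ := by
        gcongr
        exact hw.trans le_self_add
  have h1 : E + n ≤ D * (E + n + 1) :=
    le_self_add.trans (le_mul_of_one_le_left (zero_le) hD1)
  have h2 : ((2 * 10 ^ 3 * D : ℕ) : ℝ≥0∞) ≤ C := by
    rw [Nat.cast_le]; omega
  calc ((10 ^ 3 : ℕ) : ℝ≥0∞) * (E + (N + n : ℕ)) = (10 ^ 3 : ℕ) * (E + n + N) := by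
        push_cast; ring
    _ ≤ (10 ^ 3 : ℕ) * (D * (E + n + 1) + D * (E + n + 1)) := by gcongr
    _ = (2 * 10 ^ 3 * D : ℕ) * (E + n + 1) := by push_cast; ring
    _ ≤ _ := by gcongr

end Main

end QuatPath

end

theorem mainTheorem2 :
    ∃ P : Polynomial ℕ, ∀ (p : ℕ) (_ : p.Prime) (a b : ℤ) (_ : RamifiedExactlyAt p a b)
      (O₁ O₂ : Subring (Quat a b)) (_ : IsMaximalOrder O₁) (_ : IsMaximalOrder O₂)
      (e₁ : Module.Basis (Fin 4) ℤ O₁) (e₂ : Module.Basis (Fin 4) ℤ O₂)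
      (C : ℕ) (_ : C = P.eval (specSize e₁ e₂))
      (ℓ : ℕ) (_ : ℓ.Prime) (A : Prog) (_ : SolvesPath e₁ ℓ A),
      ∃ A' : Prog, SolvesPath e₂ ℓ A' ∧ (A.CoinFree → A'.CoinFree) ∧
        (A'.size : ENNReal) ≤ A.size + C * (expCost Cost.width e₁ A C + 1) ∧
        ∀ n : ℕ,
          expCost Cost.steps e₂ A' n ≤ C * (expCost Cost.steps e₁ A (C * (n + 1)) + n + 1) ∧
          maxCost Cost.steps e₂ A' n ≤ C * (maxCost Cost.steps e₁ A (C * (n + 1)) + n + 1) ∧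
          expCost Cost.width e₂ A' n ≤ C * (expCost Cost.width e₁ A (C * (n + 1)) + n + 1) ∧
          maxCost Cost.width e₂ A' n ≤ C * (maxCost Cost.width e₁ A (C * (n + 1)) + n + 1) ∧
          expCost Cost.time e₂ A' n ≤ C * (expCost Cost.width e₁ A C + 1) *
            (expCost Cost.time e₁ A (C * (n + 1)) + n + 1) ∧
          maxCost Cost.time e₂ A' n ≤ C * (expCost Cost.width e₁ A C + 1) *
            (maxCost Cost.time e₁ A (C * (n + 1)) + n + 1) := by
  -- The polynomial is q⁵ X² with q = 10^80: quadratic because B and B' each bring one factor s.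
  obtain ⟨q, hq⟩ : ∃ q : ℕ, q = 10 ^ 80 := ⟨_, rfl⟩
  refine ⟨Polynomial.C (q ^ 5) * Polynomial.X ^ 2, ?_⟩
  intro p _ a b hram O₁ O₂ hO₁ hO₂ e₁ e₂ C hC ℓ hℓ A hA
  rw [Polynomial.eval_mul, Polynomial.eval_C, Polynomial.eval_pow, Polynomial.eval_X] at hC
  obtain ⟨ha, hb⟩ := neg_of_ramifiedOver_real hram.1
  obtain ⟨A', w, D, B, B', hw, hDC, hD, hBD, hBC, hB, hB', hsolve, hcoin, hsize, hrun⟩ :=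
    exists_transfer hq ha hb hO₁ hO₂ hC hℓ hA
  have hwC : ((C * (w + 1) : ℕ) : ENNReal) ≤ C * (expCost Cost.width e₁ A C + 1) := by
    push_cast
    gcongr
  have hC8 : ((10 ^ 8 : ℕ) : ENNReal) ≤ C := by
    rw [Nat.cast_le]; omega
  refine ⟨A', hsolve, hcoin, ?_, fun n => ?_⟩
  · refine le_trans ?_ (add_le_add_right hwC _)
    rw [← Nat.cast_add, Nat.cast_le]
    refine hsize.trans (Nat.add_le_add_left ?_ _)
    calc 2000 * (B + B') ≤ 2000 * (D * (w + 1)) := Nat.mul_le_mul_left _ hBD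
      _ = 2000 * D * (w + 1) := by ring
      _ ≤ C * (w + 1) := Nat.mul_le_mul_right _ (by omega)
  -- The width of the selected run is controlled at input length C; monotonicity moves this to C (n
  -- + 1).
  have hmono : expCost Cost.width e₁ A C ≤ expCost Cost.width e₁ A (C * (n + 1)) :=
    expCost_mono (Nat.le_mul_of_pos_right _ (Nat.succ_pos n))
  have hsteps : ∀ x ∈ inputs e₂ n, ∃ x' ∈ inputs e₁ (C * (n + 1)), ∀ ω,
      runCost Cost.steps A' x ω ≤ (10 ^ 8 : ℕ) * (runCost Cost.steps A x' ω + (n + 1 : ℕ)) := by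
    intro x hx
    obtain ⟨x', hx', h⟩ := hrun n x hx
    refine ⟨x', hx', fun ω => runCost_le (by norm_num) fun m y hm => ?_⟩
    obtain ⟨m', y', hm', h1, -, -⟩ := h ω m y hm
    exact ⟨m', y', hm', h1⟩
  have hwidth : ∀ x ∈ inputs e₂ n, ∃ x' ∈ inputs e₁ (C * (n + 1)), ∀ ω,
      runCost Cost.width A' x ω ≤
        (10 ^ 3 : ℕ) * (runCost Cost.width A x' ω + (B + B' + n : ℕ)) := by
    intro x hx
    obtain ⟨x', hx', h⟩ := hrun n x hx
    refine ⟨x', hx', fun ω => runCost_le (by norm_num) fun m y hm => ?_⟩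
    obtain ⟨m', y', hm', -, h1, -⟩ := h ω m y hm
    exact ⟨m', y', hm', h1⟩
  have htime : ∀ x ∈ inputs e₂ n, ∃ x' ∈ inputs e₁ (C * (n + 1)), ∀ ω,
      runCost Cost.time A' x ω ≤
        (10 ^ 12 * (B * B') : ℕ) * (runCost Cost.time A x' ω + (n + 1 : ℕ)) := by
    intro x hx
    obtain ⟨x', hx', h⟩ := hrun n x hx
    refine ⟨x', hx', fun ω => runCost_le (Nat.mul_pos (by norm_num)
      (Nat.mul_pos hB hB')).ne' fun m y hm => ?_⟩
    obtain ⟨m', y', hm', -, -, h1⟩ := h ω m y hm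
    exact ⟨m', y', hm', h1⟩
  have hn : ∀ E : ENNReal, E + (n + 1 : ℕ) = E + n + 1 := fun E => by
    rw [Nat.cast_add, Nat.cast_one, add_assoc]
  have hBC' : ((10 ^ 12 * (B * B') : ℕ) : ENNReal) ≤ C * (expCost Cost.width e₁ A C + 1) :=
    (Nat.cast_le.mpr hBC).trans hwC
  refine ⟨(expCost_le hsteps).trans ?_, (maxCost_le hsteps).trans ?_,
    (expCost_le hwidth).trans (width_bound hD hDC hBD (hw.trans hmono)),
    (maxCost_le hwidth).trans (width_bound hD hDC hBD
      (hw.trans (hmono.trans expCost_le_maxCost))),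
    (expCost_le htime).trans ?_, (maxCost_le htime).trans ?_⟩
  all_goals
    rw [hn]
    gcongr
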